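/- Let $(X,g)$ be an oriented Riemannian $4$-manifold with a spin structure, let $\mathbb S'$ be the associated primed spinor bundle, and assume that $g$ is anti self-dual ($W^+=0$) and Einstein with $\Lambda:=R/24$ nowhere zero, where $R$ is the scalar curvature. Conventions: $Spin(4)=SU(2)\times SU(2)$ acts on $$\mathbb M=\Bigl\{\tfrac1{\sqrt2}\begin{pmatrix}x^0+ix^3&x^1+ix^2\\-x^1+ix^2&x^0-ix^3\end{pmatrix}\Bigr\}\cong\mathbb R^4,\qquad \langle Y,Y\rangle=2\det Y,$$ by $(A,B)\cdot Y=AYB^{-1}$, the orientation of $\mathbb M$ being the one for which $(x^1,x^2,x^3,x^0)$ are positive coordinates; $\mathbb S,\mathbb S'$ are associated with the representations $A$ and $\overline B$ on $\mathbb C^2$, so that $\mathbb C TX\cong\mathbb S\otimes\mathbb S'$, $v^a\leftrightarrow v^{AA'}$; $\mathbb S'$ carries the connection $\nabla$ induced by the Levi-Civita connection, the skew form $\varepsilon_{A'B'}=\begin{pmatrix}0&1\\-1&0\end{pmatrix}$, the lowering $\eta_{B'}=\eta^{A'}\varepsilon_{A'B'}$, and the antilinear map $\sigma\,{}^t(a,b)={}^t(\bar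 b,-\bar a)$. For $0\neq\pi\in\mathbb S'_x$ put $\|\pi\|^2=(\sigma\pi)_{A'}\pi^{A'}$ and let $I_\pi,J_\pi$ be the endomorphisms $v^{AA'}\mapsto v^{AB'}I_{B'}{}^{A'}$, $v^{AA'}\mapsto v^{AB'}J_{B'}{}^{A'}$ of $T_xX$, where $$I_{B'}{}^{A'}=\frac{-i}{\|\pi\|^2}\bigl(\pi_{B'}(\sigma\pi)^{A'}+(\sigma\pi)_{B'}\pi^{A'}\bigr),\qquad J_{B'}{}^{A'}=\frac{-1}{\|\pi\|^2}\bigl(\pi_{B'}\pi^{A'}+(\sigma\pi)_{B'}(\sigma\pi)^{A'}\bigr).$$ With respect to the splitting $T_\pi(\mathbb S'\setminus\{0\})\cong T_xX\oplus\mathbb S'_x$ into the horizontal space of $\nabla$ and the tangent space of the fibre, let $\mathbb I=I_\pi\oplus i$ (the Atiyah–Hitchin–Singer almost complex structure) and $\mathbb J=J_\pi\oplus\sigma$. Then $\mathbb J$ is a smooth almost complex structure on $\mathbb S'\setminus\{0\}$ (that is, $\mathbb J^2=-1$), it is integrable, i.e. its Nijenhuis tensor vanishes, equivalently $T^{0,1}$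 is closed under the Lie bracket, and $\mathbb I\mathbb J=-\mathbb J\mathbb I$. -/

import Mathlib

open scoped Manifold ContDiff Matrix

noncomputable section

namespace SpinorTwistor

/-! ## Almost complex structures on an open subset of a manifold -/

section AlmostComplex

variable {E : Type*} [NormedAddCommGroup E] [NormedSpace ℝ E]
  {H : Type*} [TopologicalSpace H] (I : ModelWithCorners ℝ E H)
  {M : Type*} [TopologicalSpace M] [ChartedSpace H M]

/-- The field of endomorphisms `J` of the tangent bundle is a smooth almost complex structure on
the set `U`: it is a smooth section of `End(TM)` over `U`, and `J² = -1` on `U`. -/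
structure IsAlmostComplexOn [IsManifold I 1 M]
    (J : ∀ p : M, TangentSpace I p →L[ℝ] TangentSpace I p)
    (U : Set M) : Prop where
  contMDiffOn : ContMDiffOn I (I.prod 𝓘(ℝ, E →L[ℝ] E)) ∞
    (fun p => Bundle.TotalSpace.mk' (E →L[ℝ] E)
      (E := fun p : M => TangentSpace I p →L[ℝ] TangentSpace I p) p (J p)) U
  sq_eq_neg : ∀ p ∈ U, ∀ ξ : TangentSpace I p, J p (J p ξ) = -ξ

/-- The Nijenhuis expression `[V, W] + J[JV, W] + J[V, JW] - [JV, JW]`. -/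
def nijenhuis (J : ∀ p : M, TangentSpace I p →L[ℝ] TangentSpace I p)
    (V W : ∀ p : M, TangentSpace I p) (p : M) : TangentSpace I p :=
  VectorField.mlieBracket I V W p
    + J p (VectorField.mlieBracket I (fun q => J q (V q)) W p
      + VectorField.mlieBracket I V (fun q => J q (W q)) p)
    - VectorField.mlieBracket I (fun q => J q (V q)) (fun q => J q (W q)) p

/-- Integrability of `J` on the open set `U`: the Nijenhuis expression of any two smooth vector
fields defined on an open subset of `U` vanishes. As
`[V + iJV, W + iJW] = ([V, W] - [JV, JW]) + i([JV, W] + [V, JW])`, this says that the Lie bracket of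
any two local sections of `T^{0,1}` is again a section of `T^{0,1}`, equivalently that the exterior
derivatives of `(1,0)`-forms have no `(0,2)`-part. -/
def IsIntegrableOn [IsManifold I 1 M]
    (J : ∀ p : M, TangentSpace I p →L[ℝ] TangentSpace I p) (U : Set M) : Prop :=
  ∀ (O : Set M) (V W : ∀ p : M, TangentSpace I p), IsOpen O → O ⊆ U →
    ContMDiffOn I I.tangent ∞ (fun p => (⟨p, V p⟩ : TangentBundle I M)) O →
    ContMDiffOn I I.tangent ∞ (fun p => (⟨p, W p⟩ : TangentBundle I M)) O →
    ∀ p ∈ O, nijenhuis I J V W p = 0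

end AlmostComplex

/-! ## Two-component spinor algebra -/

/-- The spin representation space `ℂ²`. -/
abbrev Spinor : Type := Fin 2 → ℂ

/-- The orthonormal basis of the Euclidean space `𝕄` of matrices
`(1/√2) [[x⁰ + i x³, x¹ + i x²], [-x¹ + i x², x⁰ - i x³]]` with `⟨Y, Y⟩ = 2 det Y`, listed in the
order `x¹, x², x³, x⁰`. This order is positive for the orientation given by the volume form
`e_{abcd} = ε_{AC} ε_{BD} ε_{A'D'} ε_{B'C'} - ε_{AD} ε_{BC} ε_{A'C'} ε_{B'D'}`. -/
def mBasis (a : Fin 4) : Matrix (Fin 2) (Fin 2) ℂ :=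
  ((Real.sqrt 2 : ℝ) : ℂ)⁻¹ •
    (![!![0, 1; -1, 0], !![0, Complex.I; Complex.I, 0], !![Complex.I, 0; 0, -Complex.I], 1] :
      Fin 4 → Matrix (Fin 2) (Fin 2) ℂ) a

/-- The coordinates `x^a` of `Y = ∑ x^a m_a ∈ 𝕄`. -/
def mCoord (a : Fin 4) (Y : Matrix (Fin 2) (Fin 2) ℂ) : ℝ :=
  (((mBasis a)ᴴ * Y).trace).re

/-- The skew form `ε`. -/
def eps : Matrix (Fin 2) (Fin 2) ℂ := !![0, 1; -1, 0]

/-- Lowering an index: `η_{B'} = η^{A'} ε_{A'B'}`. -/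
def lower (η : Spinor) : Spinor := Matrix.vecMul η eps

/-- The antilinear map `σ(a, b) = (b̄, -ā)` on `ℂ²`, as a real linear map. -/
def sigma : Spinor →L[ℝ] Spinor :=
  ContinuousLinearMap.pi
    ![(Complex.conjCLE : ℂ →L[ℝ] ℂ) ∘L ContinuousLinearMap.proj 1,
      -((Complex.conjCLE : ℂ →L[ℝ] ℂ) ∘L ContinuousLinearMap.proj 0)]

theorem sigma_apply (η : Spinor) : sigma η = ![star (η 1), -star (η 0)] := by
  ext i
  fin_cases i <;> simp [sigma]

/-- `‖π‖² = (σπ)_{A'} π^{A'}`. -/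
def normSq (π : Spinor) : ℂ := lower (sigma π) ⬝ᵥ π

theorem normSq_eq (π : Spinor) : normSq π = ((‖π 0‖ ^ 2 + ‖π 1‖ ^ 2 : ℝ) : ℂ) := by
  simp [normSq, lower, eps, sigma_apply, Matrix.vecMul, dotProduct, Fin.sum_univ_two,
    Complex.conj_mul']

/-- `I_{B'}^{A'} = (-i/‖π‖²) (π_{B'} (σπ)^{A'} + (σπ)_{B'} π^{A'})`; row index `B'`, column
index `A'`. -/
def iMat (π : Spinor) : Matrix (Fin 2) (Fin 2) ℂ :=
  (-Complex.I / normSq π) •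
    (Matrix.vecMulVec (lower π) (sigma π) + Matrix.vecMulVec (lower (sigma π)) π)

/-- `J_{B'}^{A'} = (-1/‖π‖²) (π_{B'} π^{A'} + (σπ)_{B'} (σπ)^{A'})`; row index `B'`, column
index `A'`. -/
def jMat (π : Spinor) : Matrix (Fin 2) (Fin 2) ℂ :=
  (-1 / normSq π) •
    (Matrix.vecMulVec (lower π) π + Matrix.vecMulVec (lower (sigma π)) (sigma π))

/-- The matrix, in the basis `m_a` of `𝕄`, of the endomorphism `v^{AA'} ↦ v^{AB'} T_{B'}^{A'}`. -/
def rightMulMat (T : Matrix (Fin 2) (Fin 2) ℂ) (a b : Fin 4) : ℝ := mCoord a (mBasis b * T)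

/-! ## Local orthonormal frames and curvature of a Riemannian 4-manifold -/

section Riemannian

variable {X : Type*} [TopologicalSpace X] [ChartedSpace (EuclideanSpace ℝ (Fin 4)) X]
  [IsManifold (𝓡 4) ∞ X]

/-- Smooth Riemannian metrics on the 4-manifold `X`. -/
abbrev Metric (X : Type*) [TopologicalSpace X] [ChartedSpace (EuclideanSpace ℝ (Fin 4)) X]
    [IsManifold (𝓡 4) ∞ X] :=
  Bundle.ContMDiffRiemannianMetric (𝓡 4) ∞ (EuclideanSpace ℝ (Fin 4))
    (fun x : X => TangentSpace (𝓡 4) x)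

/-- Four vector fields `e 0, …, e 3` on `X`; only their values on the domain of a frame matter. -/
abbrev Frame (X : Type*) [TopologicalSpace X] [ChartedSpace (EuclideanSpace ℝ (Fin 4)) X] :=
  Fin 4 → ∀ x : X, TangentSpace (𝓡 4) x

variable (g : Metric X) (o : ∀ x : X, Orientation ℝ (TangentSpace (𝓡 4) x) (Fin 4))

/-- `e` is a smooth oriented orthonormal frame of `(X, g, o)` over the open set `U`. -/
structure IsOrientedFrameOn (e : Frame X) (U : Set X) : Prop where
  isOpen : IsOpen U
  contMDiffOn : ∀ a, ContMDiffOn (𝓡 4) (𝓡 4).tangent ∞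
    (fun x => (⟨x, e a x⟩ : TangentBundle (𝓡 4) X)) U
  orthonormal : ∀ x ∈ U, ∀ a b, g.inner x (e a x) (e b x) = if a = b then 1 else 0
  oriented : ∀ x ∈ U, ∃ b : Module.Basis (Fin 4) ℝ (TangentSpace (𝓡 4) x),
    (∀ a, b a = e a x) ∧ b.orientation = o x

/-- The components `g([e_c, e_b], e_a)`. -/
def bracketCoeff (e : Frame X) (c b a : Fin 4) (x : X) : ℝ :=
  g.inner x (VectorField.mlieBracket (𝓡 4) (e c) (e b) x) (e a x)

/-- The Levi-Civita connection in the orthonormal frame `e`: the component `g(∇_{e_c} e_b, e_a)`,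
given by the Koszul formula. -/
def lcCoeff (e : Frame X) (c b a : Fin 4) (x : X) : ℝ :=
  (1 / 2) * (bracketCoeff g e c b a x - bracketCoeff g e c a b x - bracketCoeff g e b a c x)

/-- The connection given by `lcCoeff` is metric. -/
theorem lcCoeff_skew (e : Frame X) (c b a : Fin 4) (x : X) :
    lcCoeff g e c b a x = -lcCoeff g e c a b x := by
  have : bracketCoeff g e b a c x = -bracketCoeff g e a b c x := by
    unfold bracketCoeff
    rw [VectorField.mlieBracket_swap_apply]
    simp
  unfold lcCoeff
  linarith

/-- The connection given by `lcCoeff` is torsion-free. -/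
theorem lcCoeff_torsion (e : Frame X) (c b a : Fin 4) (x : X) :
    lcCoeff g e c b a x - lcCoeff g e b c a x = bracketCoeff g e c b a x := by
  have : bracketCoeff g e b c a x = -bracketCoeff g e c b a x := by
    unfold bracketCoeff
    rw [VectorField.mlieBracket_swap_apply]
    simp
  unfold lcCoeff
  linarith

/-- The derivative of the function `f` in the direction `v`. -/
def dirDeriv (f : X → ℝ) (x : X) (v : TangentSpace (𝓡 4) x) : ℝ :=
  mvfderiv (𝓡 4) f x v

/-- The curvature components
`R_{abcd} = g((∇_{e_a} ∇_{e_b} - ∇_{e_b} ∇_{e_a} - ∇_{[e_a, e_b]}) e_d, e_c)`. -/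
def riem (e : Frame X) (x : X) (a b c d : Fin 4) : ℝ :=
  dirDeriv (lcCoeff g e b d c) x (e a x) - dirDeriv (lcCoeff g e a d c) x (e b x)
    + ∑ k, (lcCoeff g e b d k x * lcCoeff g e a k c x - lcCoeff g e a d k x * lcCoeff g e b k c x)
    - ∑ k, bracketCoeff g e a b k x * lcCoeff g e k d c x

/-- The Ricci tensor `R_{ab} = R_{ca}{}^c{}_b`. -/
def ricci (e : Frame X) (x : X) (a b : Fin 4) : ℝ := ∑ c, riem g e x c a c b

/-- The scalar curvature `R = R_a{}^a`. -/
def scalarCurv (e : Frame X) (x : X) : ℝ := ∑ a, ricci g e x a a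

/-- `Λ = R / 24`. -/
def capLambda (e : Frame X) (x : X) : ℝ := scalarCurv g e x / 24

/-- The Kronecker symbol, i.e. the components of `g` in an orthonormal frame. -/
def kron (a b : Fin 4) : ℝ := if a = b then 1 else 0

/-- The Schouten tensor `P_{ab} = R_{ab}/2 - R g_{ab}/12`. -/
def schouten (e : Frame X) (x : X) (a b : Fin 4) : ℝ :=
  ricci g e x a b / 2 - scalarCurv g e x / 12 * kron a b

/-- The Weyl curvature `W_{abcd} = R_{abcd} - 2 P_{c[a} g_{b]d} + 2 P_{d[a} g_{b]c}`. -/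
def weyl (e : Frame X) (x : X) (a b c d : Fin 4) : ℝ :=
  riem g e x a b c d
    - (schouten g e x c a * kron b d - schouten g e x c b * kron a d)
    + (schouten g e x d a * kron b c - schouten g e x d b * kron a c)

/-- The components `e_{abcd}` of the volume form in an oriented orthonormal frame. -/
def volSymbol (a b c d : Fin 4) : ℝ :=
  Matrix.det (fun i j : Fin 4 => kron ((![a, b, c, d] : Fin 4 → Fin 4) i) j)

/-- The self-dual part `W⁺_{abcd} = (W_{abcd} + (1/2) e_{cd}{}^{pq} W_{abpq}) / 2` of the Weyl
curvature. -/
def weylPlus (e : Frame X) (x : X) (a b c d : Fin 4) : ℝ :=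
  (weyl g e x a b c d + (1 / 2) * ∑ p, ∑ q, volSymbol c d p q * weyl g e x a b p q) / 2

/-- The metric is anti self-dual: `W⁺ = 0`. -/
def IsAntiSelfDual : Prop :=
  ∀ (U : Set X) (e : Frame X), IsOrientedFrameOn g o e U → ∀ x ∈ U, ∀ a b c d,
    weylPlus g e x a b c d = 0

/-- The metric is Einstein: the trace-free part of the Ricci tensor vanishes. -/
def IsEinstein : Prop :=
  ∀ (U : Set X) (e : Frame X), IsOrientedFrameOn g o e U → ∀ x ∈ U, ∀ a b,
    ricci g e x a b = scalarCurv g e x / 4 * kron a b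

/-- `Λ` vanishes nowhere. -/
def LambdaNeZero : Prop :=
  ∀ (U : Set X) (e : Frame X), IsOrientedFrameOn g o e U → ∀ x ∈ U, capLambda g e x ≠ 0

/-- The endomorphism of `T_xX` whose matrix in the orthonormal basis `e_a(x)` is `C`. -/
def frameEndo (e : Frame X) (x : X) (C : Fin 4 → Fin 4 → ℝ) :
    TangentSpace (𝓡 4) x →L[ℝ] TangentSpace (𝓡 4) x :=
  ∑ a, ∑ b, C a b • (g.inner x (e b x)).smulRight (e a x)

/-- The second component `β` of the lift `(α, β) ∈ 𝔰𝔲(2) ⊕ 𝔰𝔲(2)` of a skew matrix `w^a_b`, i.e. of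
the unique pair with `∑_a w^a_b m_a = α m_b - m_b β`. Indeed `∑_b m_b† m_b = 2` and
`∑_b m_b† α m_b = tr α = 0`, so that `∑_{a,b} w^a_b m_b† m_a = -2 β`. -/
def liftBeta (w : Fin 4 → Fin 4 → ℝ) : Matrix (Fin 2) (Fin 2) ℂ :=
  (-1 / 2 : ℂ) • ∑ a, ∑ b, (w a b : ℂ) • ((mBasis b)ᴴ * mBasis a)

/-- The connection matrix `Γ_{c B'}^{A'}` (row `A'`, column `B'`) of `𝕊'` in the spin frame over the
oriented orthonormal frame `e`: the image of the Levi-Civita connection form under the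
derivative `(α, β) ↦ -βᵀ` of the representation `(A, B) ↦ (Bᵀ)⁻¹`. -/
def spinConn (e : Frame X) (x : X) (c : Fin 4) : Matrix (Fin 2) (Fin 2) ℂ :=
  -(liftBeta (fun a b => lcCoeff g e c b a x))ᵀ

/-- The map `v ↦ v^c Γ_{c B'}^{A'} η^{B'}`. -/
def connTerm (e : Frame X) (x : X) (η : Spinor) : TangentSpace (𝓡 4) x →L[ℝ] Spinor :=
  ∑ c, (g.inner x (e c x)).smulRight (spinConn g e x c *ᵥ η)

/-! ## Spin structures and the spinor bundle `𝕊'` -/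

/-- `SU(2)`. -/
abbrev SU2 := Matrix.specialUnitaryGroup (Fin 2) ℂ

/-- A spin structure on `(X, g, o)`: the principal `Spin(4) = SU(2) × SU(2)`-bundle is given by the
transition functions `h i j = (A i j, B i j)` between local sections `s i` over a cover,
`s j = s i · h i j`, and the double covering onto the oriented orthonormal frame bundle maps `s i`
to the frame `frame i`. Here `(A, B)` acts on `𝕄` by `Y ↦ A Y B⁻¹`. -/
structure SpinStructure (ι : Type*) where
  baseSet : ι → Set X
  indexAt : X → ι
  mem_baseSet_at : ∀ x, x ∈ baseSet (indexAt x)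
  frame : ι → Frame X
  isOrientedFrameOn : ∀ i, IsOrientedFrameOn g o (frame i) (baseSet i)
  A : ι → ι → X → SU2
  B : ι → ι → X → SU2
  contMDiffOn_A : ∀ i j r s, ContMDiffOn (𝓡 4) 𝓘(ℝ, ℂ) ∞
    (fun x => (A i j x : Matrix (Fin 2) (Fin 2) ℂ) r s) (baseSet i ∩ baseSet j)
  contMDiffOn_B : ∀ i j r s, ContMDiffOn (𝓡 4) 𝓘(ℝ, ℂ) ∞
    (fun x => (B i j x : Matrix (Fin 2) (Fin 2) ℂ) r s) (baseSet i ∩ baseSet j)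
  cocycle_A : ∀ i j k, ∀ x ∈ baseSet i ∩ baseSet j ∩ baseSet k, A i j x * A j k x = A i k x
  cocycle_B : ∀ i j k, ∀ x ∈ baseSet i ∩ baseSet j ∩ baseSet k, B i j x * B j k x = B i k x
  frame_change : ∀ i j, ∀ x ∈ baseSet i ∩ baseSet j, ∀ b,
    frame j b x = ∑ a, mCoord a ((A i j x : Matrix (Fin 2) (Fin 2) ℂ) * mBasis b *
      (B i j x : Matrix (Fin 2) (Fin 2) ℂ)ᴴ) • frame i a x

/-- A complex `2 × 2` matrix as a real linear map of `ℂ²`. -/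
def matCLM : (Fin 2 → Fin 2 → ℂ) →L[ℝ] (Spinor →L[ℝ] Spinor) :=
  LinearMap.toContinuousLinearMap
    { toFun := fun m => LinearMap.toContinuousLinearMap
        ((Matrix.mulVecLin (Matrix.of m)).restrictScalars ℝ)
      map_add' := fun m n => by
        ext v i
        fin_cases i <;> simp [Matrix.mulVec, dotProduct, Fin.sum_univ_two] <;> ring
      map_smul' := fun c m => by
        ext v i
        fin_cases i <;> simp [Matrix.mulVec, dotProduct, Fin.sum_univ_two] <;> ring }

theorem matCLM_apply (m : Fin 2 → Fin 2 → ℂ) (v : Spinor) : matCLM m v = Matrix.of m *ᵥ v := rfl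

namespace SpinStructure

variable {g o} {ι : Type*} (S : SpinStructure g o ι)

theorem B_self (i : ι) (x : X) (hx : x ∈ S.baseSet i) : S.B i i x = 1 := by
  have h := S.cocycle_B i i i x ⟨⟨hx, hx⟩, hx⟩
  have h2 : star (S.B i i x : Matrix (Fin 2) (Fin 2) ℂ) * (S.B i i x) = 1 :=
    (Matrix.mem_unitaryGroup_iff').1 (Matrix.specialUnitaryGroup_le_unitaryGroup (S.B i i x).2)
  apply Subtype.ext
  have h' := congrArg (fun t : SU2 => star (S.B i i x : Matrix (Fin 2) (Fin 2) ℂ) * t.1) h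
  simp only [Submonoid.coe_mul, ← mul_assoc, h2, one_mul] at h'
  exact h'

theorem contMDiffOn_conjB (i j : ι) : ContMDiffOn (𝓡 4) 𝓘(ℝ, Spinor →L[ℝ] Spinor) ∞
    (fun x => matCLM (fun r s => star ((S.B j i x : Matrix (Fin 2) (Fin 2) ℂ) r s)))
    (S.baseSet i ∩ S.baseSet j) := by
  refine matCLM.contMDiff.comp_contMDiffOn ?_
  refine contMDiffOn_pi_space.2 fun r => contMDiffOn_pi_space.2 fun s => ?_
  refine (Complex.conjCLE : ℂ →L[ℝ] ℂ).contMDiff.comp_contMDiffOn ?_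
  rw [Set.inter_comm]
  exact S.contMDiffOn_B j i r s

/-- The bundle `𝕊'` associated with the representation `ρ₋(A, B) = B̄` on `ℂ²`. Since
`s i = s j · h j i`, the coordinates of a spinor satisfy `η_j = B̄_{ji} η_i`. -/
def core : VectorBundleCore ℝ X Spinor ι where
  baseSet := S.baseSet
  isOpen_baseSet i := (S.isOrientedFrameOn i).isOpen
  indexAt := S.indexAt
  mem_baseSet_at := S.mem_baseSet_at
  coordChange i j x := matCLM (fun r s => star ((S.B j i x : Matrix (Fin 2) (Fin 2) ℂ) r s))
  coordChange_self i x hx v := by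
    rw [S.B_self i x hx, matCLM_apply]
    ext r
    fin_cases r <;> simp [Matrix.mulVec, dotProduct, Fin.sum_univ_two]
  continuousOn_coordChange i j := (S.contMDiffOn_conjB i j).continuousOn
  coordChange_comp i j k x hx v := by
    rw [← S.cocycle_B k j i x ⟨⟨hx.2, hx.1.2⟩, hx.1.1⟩]
    simp only [matCLM_apply, Matrix.mulVec_mulVec]
    congr 1
    ext r s
    simp [Matrix.mul_apply]

instance : S.core.IsContMDiff (𝓡 4) ∞ where
  contMDiffOn_coordChange i j := S.contMDiffOn_conjB i j

/-- The total space of `𝕊'`. A point over `x` is a pair `⟨x, η⟩`, with `η ∈ ℂ²` the coordinates of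
the spinor in the spin frame `s (indexAt x)`. -/
abbrev SPrime : Type _ := Bundle.TotalSpace Spinor S.core.Fiber

/-- The model with corners of the smooth 8-manifold `𝕊'`. -/
abbrev modelSPrime : ModelWithCorners ℝ (EuclideanSpace ℝ (Fin 4) × Spinor)
    (ModelProd (EuclideanSpace ℝ (Fin 4)) Spinor) := (𝓡 4).prod 𝓘(ℝ, Spinor)

/-- `𝕊'` with the zero section removed. -/
def nonzero : Set S.SPrime := {p | (p.2 : Spinor) ≠ 0}

/-- The frame used at `x`. -/
def frameAt (x : X) : Frame X := S.frame (S.indexAt x)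

/-- The identification `T_π 𝕊' ≅ T_xX ⊕ 𝕊'_x` given by the connection, `ξ ↦ (dx(ξ), δπ(ξ))` with
`δπ^{A'} = dπ^{A'} + Γ_{cB'}^{A'} π^{B'} θ^c`. By construction of the manifold `𝕊'`, a tangent
vector at `p` is a pair `(v, w)` of its components `v = dx(ξ)`, `w = dπ(ξ)` in the trivialization
given by the spin frame `s (indexAt x)`, see `split_fst` and `split_snd`. The horizontal lift of
`v` corresponds to `(v, 0)`. -/
def split (p : S.SPrime) :
    TangentSpace modelSPrime p ≃L[ℝ] TangentSpace (𝓡 4) p.1 × Spinor :=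
  let Γ : EuclideanSpace ℝ (Fin 4) →L[ℝ] Spinor := connTerm g (S.frameAt p.1) p.1 p.2
  let fst := ContinuousLinearMap.fst ℝ (EuclideanSpace ℝ (Fin 4)) Spinor
  let snd := ContinuousLinearMap.snd ℝ (EuclideanSpace ℝ (Fin 4)) Spinor
  (ContinuousLinearEquiv.equivOfInverse (fst.prod (snd + Γ ∘L fst)) (fst.prod (snd - Γ ∘L fst))
    (fun ξ => by simp [fst, snd]) (fun ξ => by simp [fst, snd]) :
    (EuclideanSpace ℝ (Fin 4) × Spinor) ≃L[ℝ] (EuclideanSpace ℝ (Fin 4) × Spinor))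

theorem hasMFDerivAt_triv (p : S.SPrime) :
    HasMFDerivAt modelSPrime modelSPrime
      (fun q : S.SPrime => S.core.localTriv (S.indexAt p.1) q) p
      (ContinuousLinearMap.id ℝ (EuclideanSpace ℝ (Fin 4) × Spinor)) := by
  have hs : p ∈ (trivializationAt Spinor S.core.Fiber p.1).source :=
    FiberBundle.mem_trivializationAt_proj_source
  have hc : ContinuousAt (trivializationAt Spinor S.core.Fiber p.1) p :=
    (trivializationAt Spinor S.core.Fiber p.1).continuousAt hs
  refine ⟨hc, ?_⟩
  have ht := extChartAt_target_mem_nhdsWithin (I := modelSPrime) p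
  refine HasFDerivWithinAt.congr_of_eventuallyEq (hasFDerivWithinAt_id _ _) ?_ ?_
  · filter_upwards [ht] with y hy
    exact FiberBundle.writtenInExtChartAt_trivializationAt (IB := 𝓡 4) hy
  · exact FiberBundle.writtenInExtChartAt_trivializationAt (IB := 𝓡 4)
      (mem_extChartAt_target (I := modelSPrime) p)

theorem split_fst (p : S.SPrime) (ξ : TangentSpace modelSPrime p) :
    (S.split p ξ).1 = mfderiv modelSPrime (𝓡 4) (Bundle.TotalSpace.proj : S.SPrime → X) p ξ := by
  have h := (hasMFDerivAt_fst (I := 𝓡 4) (I' := 𝓘(ℝ, Spinor)) 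
    (x := S.core.localTriv (S.indexAt p.1) p)).comp p (S.hasMFDerivAt_triv p)
  have h2 : HasMFDerivAt modelSPrime (𝓡 4) (Bundle.TotalSpace.proj : S.SPrime → X) p _ := h
  rw [h2.mfderiv]
  rfl

theorem split_snd (p : S.SPrime) (ξ : TangentSpace modelSPrime p) :
    (S.split p ξ).2 =
      mvfderiv modelSPrime (fun q : S.SPrime => (S.core.localTriv (S.indexAt p.1) q).2) p ξ
      + connTerm g (S.frameAt p.1) p.1 p.2 (S.split p ξ).1 := by
  have h := (hasMFDerivAt_snd (I := 𝓡 4) (I' := 𝓘(ℝ, Spinor)) 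
    (x := S.core.localTriv (S.indexAt p.1) p)).comp p (S.hasMFDerivAt_triv p)
  have h2 : HasMFDerivAt modelSPrime 𝓘(ℝ, Spinor)
    (fun q : S.SPrime => (S.core.localTriv (S.indexAt p.1) q).2) p _ := h
  rw [mvfderiv, h2.mfderiv]
  rfl

/-- The endomorphism `I_π` of `T_xX`. -/
def baseI (x : X) (π : Spinor) : TangentSpace (𝓡 4) x →L[ℝ] TangentSpace (𝓡 4) x :=
  frameEndo g (S.frameAt x) x (rightMulMat (iMat π))

/-- The endomorphism `J_π` of `T_xX`. -/
def baseJ (x : X) (π : Spinor) : TangentSpace (𝓡 4) x →L[ℝ] TangentSpace (𝓡 4) x :=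
  frameEndo g (S.frameAt x) x (rightMulMat (jMat π))

/-- The Atiyah–Hitchin–Singer almost complex structure `𝕀 = I_π ⊕ i`. -/
def bigI (p : S.SPrime) : TangentSpace modelSPrime p →L[ℝ] TangentSpace modelSPrime p :=
  ((S.split p).symm : _ →L[ℝ] _) ∘L
    ((S.baseI p.1 p.2).prodMap (Complex.I • ContinuousLinearMap.id ℝ Spinor)) ∘L
      (S.split p : _ →L[ℝ] _)

/-- The almost complex structure `𝕁 = J_π ⊕ σ`. -/
def bigJ (p : S.SPrime) : TangentSpace modelSPrime p →L[ℝ] TangentSpace modelSPrime p :=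
  ((S.split p).symm : _ →L[ℝ] _) ∘L ((S.baseJ p.1 p.2).prodMap sigma) ∘L (S.split p : _ →L[ℝ] _)

end SpinStructure

end Riemannian

end SpinorTwistor

end

open SpinorTwistor

/-!
Write `θ = dx` for the horizontal and `Dη` for the vertical component of a vector field on
`𝕊' \ 0` in a local oriented orthonormal frame of `X` and the spin frame above it (`coframe` and
`nablaSpin`, with `η = coord` the fibre coordinate). In these components `𝕁` acts by `J_η` on `θ`
and by `σ` on `Dη`. Right multiplication by imaginary quaternions on `𝕄` gives `J_η`, where
`η ↦ J_η` is a map to the unit quaternions; with `σ² = -1` this yields `𝕁² = -1`, and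
`I_η J_η = -J_η I_η` holds because the two quaternions are orthogonal.

The Nijenhuis expression is computed from the structure equations of the Levi-Civita connection,
`θ[V, W] = ∇_V θ(W) - ∇_W θ(V)` (`coframe_mlieBracket`) and
`Dη[V, W] = ∇_V Dη(W) - ∇_W Dη(V) - Ω(V, W) η` (`nablaSpin_mlieBracket`), with `Ω` the curvature of
`𝕊'`.

* The horizontal part. As `J_η` depends equivariantly on `η`, its covariant derivative in the
  direction `ξ` is its derivative in the direction `δ = Dη(ξ)` (`nablaVec_jEndo`). All terms cancel
  because `η ↦ J_η` is `σ`-holomorphic: the derivative in the direction `σδ` is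
  `J_η` times the derivative in the direction `δ` (`jEndo_mul_deriv`).
* The vertical part. As `σ` is parallel, what remains is the part of type `(0,2)` of `Ω`, applied
  to `η`. The curvature of `𝕊'` is the self-dual part, in the second pair of indices, of the Riemann
  tensor. For `W⁺ = 0` and an Einstein metric it is `2Λ` times the self-dual projection
  (`selfDual_riem`), as for constant curvature, and a computation with quaternions shows that its
  `(0,2)`-part annihilates `η` (`curvature_type`).

The manifold `𝕊'` has, over each point `x`, a preferred spin frame `s (indexAt x)`, and `𝕁` is
defined with it. To differentiate `𝕁`, its expression is needed in one fixed spin frame near a given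
point. So the components have to be independent of the spin frame, which is the
transformation law of the spin connection (`nablaSpin_change`). It follows from the uniqueness of
the torsion-free metric connection (`lcCoeff_change`) and the computation of the lift to
`𝔰𝔲(2) ⊕ 𝔰𝔲(2)` of the Maurer–Cartan form of the rotation group (`liftBeta_maurerCartan`).
-/

open scoped Manifold ContDiff Matrix

noncomputable section

namespace SpinorTwistor

/-! ### Quaternions and the matrix of `J_η` -/

/-- The trace-free anti-Hermitian matrix with three real components `s`, an imaginary quaternion.
The signs are chosen so that `liftBeta w = -(1/2) quat (selfDual w)` for skew `w`. -/
def quat (s : Fin 3 → ℝ) : Matrix (Fin 2) (Fin 2) ℂ :=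
  !![Complex.I * s 0, -(Complex.I * s 1) + s 2; -(Complex.I * s 1) - s 2, -(Complex.I * s 0)]

/-- The components of the self-dual part of a skew `4 × 4` matrix. -/
def selfDual (w : Fin 4 → Fin 4 → ℝ) : Fin 3 → ℝ :=
  ![w 0 1 + w 2 3, w 0 2 - w 1 3, w 0 3 + w 1 2]

/-- The squared norm of a spinor, as a real number. -/
def normR (η : Spinor) : ℝ := (η 0).re ^ 2 + (η 0).im ^ 2 + (η 1).re ^ 2 + (η 1).im ^ 2

/-- The quadratic form whose quotient by the squared norm gives the components of `jMat`. -/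
def jQuad (η : Spinor) : Fin 3 → ℝ :=
  ![2 * ((η 0).re * (η 1).im + (η 0).im * (η 1).re),
    2 * ((η 0).re * (η 0).im - (η 1).re * (η 1).im),
    (η 0).re ^ 2 - (η 0).im ^ 2 + (η 1).re ^ 2 - (η 1).im ^ 2]

/-- The components of the imaginary unit quaternion `jMat η`. -/
def jVec (η : Spinor) : Fin 3 → ℝ := fun k => jQuad η k / normR η

theorem normR_pos {η : Spinor} (h : η ≠ 0) : 0 < normR η := by
  have h' : 0 < ‖η 0‖ ^ 2 + ‖η 1‖ ^ 2 := by
    by_contra hn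
    have h0 : ‖η 0‖ = 0 := by nlinarith [norm_nonneg (η 0), norm_nonneg (η 1)]
    have h1 : ‖η 1‖ = 0 := by nlinarith [norm_nonneg (η 0), norm_nonneg (η 1)]
    apply h
    ext i
    fin_cases i
    · exact norm_eq_zero.1 h0
    · exact norm_eq_zero.1 h1
  rw [← Complex.normSq_eq_norm_sq, ← Complex.normSq_eq_norm_sq, Complex.normSq_apply,
    Complex.normSq_apply] at h'
  unfold normR
  linarith

theorem normSq_eq_normR (η : Spinor) : normSq η = (normR η : ℂ) := by
  rw [normSq_eq]
  congr 1
  simp only [normR, ← Complex.normSq_eq_norm_sq, Complex.normSq_apply]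
  ring

theorem lower_eq (η : Spinor) : lower η = ![-η 1, η 0] := by
  ext i
  fin_cases i <;> simp [lower, eps, Matrix.vecMul, dotProduct, Fin.sum_univ_two]

theorem jMat_eq_quat (η : Spinor) : jMat η = quat (jVec η) := by
  have hq : quat (jVec η) = ((1 / normR η : ℝ) : ℂ) • quat (jQuad η) := by
    ext i j
    fin_cases i <;> fin_cases j <;> simp [quat, jVec, div_eq_inv_mul] <;> ring
  have hm : -1 / (normR η : ℂ) = ((1 / normR η : ℝ) : ℂ) * (-1) := by
    push_cast
    ring
  rw [hq, jMat, normSq_eq_normR, hm, mul_smul]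
  congr 1
  ext i j
  simp only [Matrix.smul_apply, Matrix.add_apply, Matrix.vecMulVec_apply, lower_eq, sigma_apply]
  fin_cases i <;> fin_cases j <;> apply Complex.ext <;>
    simp [quat, jQuad, pow_two] <;> ring

theorem sum_jVec_sq {η : Spinor} (h : η ≠ 0) :
    jVec η 0 ^ 2 + jVec η 1 ^ 2 + jVec η 2 ^ 2 = 1 := by
  have hn := (normR_pos h).ne'
  simp only [jVec]
  field_simp
  simp [jQuad, normR]
  ring

/-- The matrices `√2 m_a`. -/
def mBasis' : Fin 4 → Matrix (Fin 2) (Fin 2) ℂ :=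
  ![!![0, 1; -1, 0], !![0, Complex.I; Complex.I, 0], !![Complex.I, 0; 0, -Complex.I], 1]

theorem mBasis_eq (a : Fin 4) : mBasis a = ((Real.sqrt 2 : ℝ) : ℂ)⁻¹ • mBasis' a := rfl

theorem inv_sqrt_two_mul_self :
    ((Real.sqrt 2 : ℝ) : ℂ)⁻¹ * ((Real.sqrt 2 : ℝ) : ℂ)⁻¹ = 1 / 2 := by
  rw [← mul_inv, ← Complex.ofReal_mul, Real.mul_self_sqrt (by norm_num)]
  norm_num

theorem mBasis_conjTranspose_mul (a b : Fin 4) (T : Matrix (Fin 2) (Fin 2) ℂ) :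
    (mBasis b)ᴴ * (T * mBasis a) = (1 / 2 : ℂ) • ((mBasis' b)ᴴ * (T * mBasis' a)) := by
  rw [mBasis_eq, mBasis_eq, Matrix.conjTranspose_smul, Matrix.mul_smul, Matrix.smul_mul,
    Matrix.mul_smul, smul_smul, ← inv_sqrt_two_mul_self]
  simp

theorem sum_mBasis_mul (T : Matrix (Fin 2) (Fin 2) ℂ) :
    ∑ b, (mBasis b)ᴴ * (T * mBasis b) = T.trace • 1 := by
  simp only [mBasis_conjTranspose_mul, Fin.sum_univ_four]
  ext i j
  fin_cases i <;> fin_cases j <;>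
    simp [mBasis', Matrix.mul_apply, Fin.sum_univ_two, Matrix.trace] <;>
    ring_nf <;> simp <;> ring

/-- On skew matrices, `liftBeta` only sees the self-dual part. -/
theorem liftBeta_eq (w : Fin 4 → Fin 4 → ℝ) (hw : ∀ a b, w a b = -w b a) :
    liftBeta w = (-1 / 2 : ℂ) • quat (selfDual w) := by
  have h0 : ∀ a, w a a = 0 := fun a => by linarith [hw a a]
  have h : ∀ a b, (mBasis b)ᴴ * mBasis a = (1 / 2 : ℂ) • ((mBasis' b)ᴴ * mBasis' a) := by
    intro a b
    simpa using mBasis_conjTranspose_mul a b 1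
  simp only [liftBeta, h, Fin.sum_univ_four, h0, hw 1 0, hw 2 0, hw 3 0, hw 2 1, hw 3 1, hw 3 2]
  ext i j
  fin_cases i <;> fin_cases j <;>
    simp [mBasis', quat, selfDual, Matrix.mul_apply, Fin.sum_univ_two] <;>
    ring

/-- The matrix of right multiplication by `quat s`. -/
theorem rightMulMat_quat (s : Fin 3 → ℝ) : rightMulMat (quat s) =
    !![0, s 0, s 1, s 2; -s 0, 0, s 2, -s 1; -s 1, -s 2, 0, s 0; -s 2, s 1, -s 0, 0] := by
  have h : ∀ a b, (mBasis a)ᴴ * (mBasis b * quat s) =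
      (1 / 2 : ℂ) • ((mBasis' a)ᴴ * (mBasis' b * quat s)) := by
    intro a b
    have := congrArg (· * quat s) (mBasis_conjTranspose_mul b a 1)
    simpa [Matrix.mul_assoc] using this
  ext a b
  simp only [rightMulMat, mCoord, h]
  fin_cases a <;> fin_cases b <;>
    simp [mBasis', quat, Matrix.mul_apply, Fin.sum_univ_two, Matrix.trace] <;>
    ring

/-- `I_η` and `J_η` are right multiplications by orthogonal imaginary quaternions. -/
theorem iMat_eq_quat (η : Spinor) : ∃ s : Fin 3 → ℝ, iMat η = quat s ∧
    s 0 * jVec η 0 + s 1 * jVec η 1 + s 2 * jVec η 2 = 0 := by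
  refine ⟨fun k => (![(η 1).re ^ 2 + (η 1).im ^ 2 - (η 0).re ^ 2 - (η 0).im ^ 2,
    2 * ((η 0).im * (η 1).im + (η 0).re * (η 1).re),
    2 * ((η 0).re * (η 1).im - (η 0).im * (η 1).re)] : Fin 3 → ℝ) k / normR η, ?_, ?_⟩
  · have hm : -Complex.I / (normR η : ℂ) = ((1 / normR η : ℝ) : ℂ) * (-Complex.I) := by
      push_cast
      ring
    rw [iMat, normSq_eq_normR, hm, mul_smul]
    trans ((1 / normR η : ℝ) : ℂ) •
      quat ![(η 1).re ^ 2 + (η 1).im ^ 2 - (η 0).re ^ 2 - (η 0).im ^ 2,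
        2 * ((η 0).im * (η 1).im + (η 0).re * (η 1).re),
        2 * ((η 0).re * (η 1).im - (η 0).im * (η 1).re)]
    · congr 1
      ext i j
      simp only [Matrix.smul_apply, Matrix.add_apply, Matrix.vecMulVec_apply, lower_eq, sigma_apply]
      fin_cases i <;> fin_cases j <;> apply Complex.ext <;>
        simp [quat, pow_two] <;> ring
    · ext i j
      fin_cases i <;> fin_cases j <;> simp [quat, div_eq_inv_mul] <;> ring
  · by_cases hn : normR η = 0
    · simp [hn]
    simp only [jVec, jQuad]
    field_simp
    simp
    ring

/-! ### The algebra of `J_η`, of `σ` and of the spin action -/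

/-- Right multiplication by `quat s` on `𝕄`, in the basis `m_a`. -/
def quatEndo (s : Fin 3 → ℝ) : Matrix (Fin 4) (Fin 4) ℝ :=
  !![0, s 0, s 1, s 2; -s 0, 0, s 2, -s 1; -s 1, -s 2, 0, s 0; -s 2, s 1, -s 0, 0]

theorem quatEndo_mul_quatEndo_self (s : Fin 3 → ℝ) :
    quatEndo s * quatEndo s = -(s 0 ^ 2 + s 1 ^ 2 + s 2 ^ 2) • (1 : Matrix (Fin 4) (Fin 4) ℝ) := by
  ext a b
  fin_cases a <;> fin_cases b <;>
    simp [quatEndo, Matrix.mul_apply, Fin.sum_univ_four] <;> ring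

theorem quatEndo_anticomm {s t : Fin 3 → ℝ} (h : s 0 * t 0 + s 1 * t 1 + s 2 * t 2 = 0) :
    quatEndo s * quatEndo t = -(quatEndo t * quatEndo s) := by
  ext a b
  fin_cases a <;> fin_cases b <;>
    simp [quatEndo, Matrix.mul_apply, Fin.sum_univ_four] <;> linarith

/-- The matrix of `J_η` in the basis `m_a`. -/
def jEndo (η : Spinor) : Matrix (Fin 4) (Fin 4) ℝ := quatEndo (jVec η)

theorem rightMulMat_jMat (η : Spinor) : rightMulMat (jMat η) = jEndo η := by
  rw [jMat_eq_quat, rightMulMat_quat]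
  rfl

theorem jEndo_mul_jEndo {η : Spinor} (h : η ≠ 0) : jEndo η * jEndo η = -1 := by
  rw [jEndo, quatEndo_mul_quatEndo_self, sum_jVec_sq h, neg_smul, one_smul]

theorem rightMulMat_iMat_mul_jMat (η : Spinor) :
    (Matrix.of (rightMulMat (iMat η)) * jEndo η : Matrix (Fin 4) (Fin 4) ℝ) =
      -(jEndo η * Matrix.of (rightMulMat (iMat η))) := by
  obtain ⟨s, hs, h⟩ := iMat_eq_quat η
  rw [hs, rightMulMat_quat]
  exact quatEndo_anticomm h

/-- The polarization of `normR`. -/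
def normPolar (η δ : Spinor) : ℝ :=
  2 * ((η 0).re * (δ 0).re + (η 0).im * (δ 0).im + (η 1).re * (δ 1).re + (η 1).im * (δ 1).im)

/-- The polarization of `jQuad`. -/
def jPolar (η δ : Spinor) : Fin 3 → ℝ :=
  ![2 * ((η 0).re * (δ 1).im + (δ 0).re * (η 1).im + (η 0).im * (δ 1).re + (δ 0).im * (η 1).re),
    2 * ((η 0).re * (δ 0).im + (δ 0).re * (η 0).im - (η 1).re * (δ 1).im - (δ 1).re * (η 1).im),
    2 * ((η 0).re * (δ 0).re - (η 0).im * (δ 0).im + (η 1).re * (δ 1).re - (η 1).im * (δ 1).im)]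

/-- The derivative of `jVec` at `η` in the direction `δ`. -/
def jVecDeriv (η δ : Spinor) : Fin 3 → ℝ := fun k =>
  (jPolar η δ k * normR η - jQuad η k * normPolar η δ) / normR η ^ 2

theorem contDiff_normR : ContDiff ℝ ∞ normR := by
  unfold normR
  have h : ∀ i, ContDiff ℝ ∞ (fun η : Spinor => (η i).re) := fun i =>
    (Complex.reCLM ∘L ContinuousLinearMap.proj i : Spinor →L[ℝ] ℝ).contDiff
  have h' : ∀ i, ContDiff ℝ ∞ (fun η : Spinor => (η i).im) := fun i =>
    (Complex.imCLM ∘L ContinuousLinearMap.proj i : Spinor →L[ℝ] ℝ).contDiff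
  have h0 := h 0
  have h1 := h 1
  have h2 := h' 0
  have h3 := h' 1
  fun_prop

theorem contDiff_jQuad (k : Fin 3) : ContDiff ℝ ∞ (fun η => jQuad η k) := by
  have h : ∀ i, ContDiff ℝ ∞ (fun η : Spinor => (η i).re) := fun i =>
    (Complex.reCLM ∘L ContinuousLinearMap.proj i : Spinor →L[ℝ] ℝ).contDiff
  have h' : ∀ i, ContDiff ℝ ∞ (fun η : Spinor => (η i).im) := fun i =>
    (Complex.imCLM ∘L ContinuousLinearMap.proj i : Spinor →L[ℝ] ℝ).contDiff
  have h0 := h 0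
  have h1 := h 1
  have h2 := h' 0
  have h3 := h' 1
  fin_cases k <;> simp [jQuad] <;> fun_prop

theorem contDiffAt_jVec {η : Spinor} (h : η ≠ 0) (k : Fin 3) :
    ContDiffAt ℝ ∞ (fun η => jVec η k) η :=
  (contDiff_jQuad k).contDiffAt.div contDiff_normR.contDiffAt (normR_pos h).ne'

theorem normR_add_smul (η δ : Spinor) (t : ℝ) :
    normR (η + t • δ) = normR η + t * normPolar η δ + t ^ 2 * normR δ := by
  simp [normR, normPolar]
  ring

theorem jQuad_add_smul (η δ : Spinor) (t : ℝ) (k : Fin 3) :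
    jQuad (η + t • δ) k = jQuad η k + t * jPolar η δ k + t ^ 2 * jQuad δ k := by
  fin_cases k <;> simp [jQuad, jPolar] <;> ring

theorem fderiv_jVec {η : Spinor} (h : η ≠ 0) (k : Fin 3) (δ : Spinor) :
    fderiv ℝ (fun η => jVec η k) η δ = jVecDeriv η δ k := by
  have hd : DifferentiableAt ℝ (fun η => jVec η k) η :=
    (contDiffAt_jVec h k).differentiableAt (by simp)
  rw [← hd.lineDeriv_eq_fderiv]
  apply HasLineDerivAt.lineDeriv
  have hp : ∀ a b c : ℝ, HasDerivAt (fun t : ℝ => a + t * b + t ^ 2 * c) b 0 := by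
    intro a b c
    have := (((hasDerivAt_id (0 : ℝ)).mul_const b).const_add a).add
      (((hasDerivAt_id (0 : ℝ)).pow 2).mul_const c)
    exact this.congr_deriv (by simp)
  unfold HasLineDerivAt
  simp only [jVec, normR_add_smul, jQuad_add_smul]
  exact ((hp (jQuad η k) (jPolar η δ k) (jQuad δ k)).div
    (hp (normR η) (normPolar η δ) (normR δ)) (by simpa using (normR_pos h).ne')).congr_deriv
      (by simp [jVecDeriv])

theorem sigma_zero_re (δ : Spinor) : (sigma δ 0).re = (δ 1).re := by simp [sigma_apply]
theorem sigma_zero_im (δ : Spinor) : (sigma δ 0).im = -(δ 1).im := by simp [sigma_apply]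
theorem sigma_one_re (δ : Spinor) : (sigma δ 1).re = -(δ 0).re := by simp [sigma_apply]
theorem sigma_one_im (δ : Spinor) : (sigma δ 1).im = (δ 0).im := by simp [sigma_apply]

/-- The map `J` is `σ`-holomorphic. -/
theorem jEndo_mul_deriv {η : Spinor} (h : η ≠ 0) (δ : Spinor) :
    jEndo η * quatEndo (jVecDeriv η δ) = quatEndo (jVecDeriv η (sigma δ)) := by
  have hn := (normR_pos h).ne'
  -- the derivative of a unit vector is orthogonal to it
  have key : jVec η 0 * jVecDeriv η δ 0 + jVec η 1 * jVecDeriv η δ 1 +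
      jVec η 2 * jVecDeriv η δ 2 = 0 := by
    simp only [jVec, jVecDeriv]
    field_simp
    simp [jQuad, jPolar, normPolar, normR]
    ring
  have k0 : jVecDeriv η (sigma δ) 0 =
      jVec η 2 * jVecDeriv η δ 1 - jVec η 1 * jVecDeriv η δ 2 := by
    simp only [jVec, jVecDeriv]
    field_simp
    simp only [jQuad, jPolar, normPolar, sigma_zero_re, sigma_zero_im, sigma_one_re, sigma_one_im]
    simp [normR]
    ring
  have k1 : jVecDeriv η (sigma δ) 1 =
      jVec η 0 * jVecDeriv η δ 2 - jVec η 2 * jVecDeriv η δ 0 := by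
    simp only [jVec, jVecDeriv]
    field_simp
    simp only [jQuad, jPolar, normPolar, sigma_zero_re, sigma_zero_im, sigma_one_re, sigma_one_im]
    simp [normR]
    ring
  have k2 : jVecDeriv η (sigma δ) 2 =
      jVec η 1 * jVecDeriv η δ 0 - jVec η 0 * jVecDeriv η δ 1 := by
    simp only [jVec, jVecDeriv]
    field_simp
    simp only [jQuad, jPolar, normPolar, sigma_zero_re, sigma_zero_im, sigma_one_re, sigma_one_im]
    simp [normR]
    ring
  ext a b
  fin_cases a <;> fin_cases b <;>
    simp [jEndo, quatEndo, Matrix.mul_apply, Fin.sum_univ_four, k0, k1, k2] <;> linarith [key]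

/-- The action on `𝕊'` of the curvature or connection matrix `w`. -/
def spinAct (w : Fin 4 → Fin 4 → ℝ) : Matrix (Fin 2) (Fin 2) ℂ := -(liftBeta w)ᵀ

theorem spinAct_eq {w : Fin 4 → Fin 4 → ℝ} (hw : ∀ a b, w a b = -w b a) :
    spinAct w = (1 / 2 : ℂ) • (quat (selfDual w))ᵀ := by
  rw [spinAct, liftBeta_eq w hw, Matrix.transpose_smul]
  ext i j
  simp
  ring

theorem quat_transpose_mulVec (t : Fin 3 → ℝ) (η : Spinor) :
    ((1 / 2 : ℂ) • (quat t)ᵀ) *ᵥ η =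
      ![(1 / 2 : ℂ) * (Complex.I * t 0 * η 0 - (Complex.I * t 1 + t 2) * η 1),
        (1 / 2 : ℂ) * ((t 2 - Complex.I * t 1) * η 0 - Complex.I * t 0 * η 1)] := by
  ext i
  fin_cases i <;> simp [quat, Matrix.mulVec, dotProduct, Fin.sum_univ_two] <;> ring

/-- `σ` is a quaternionic structure invariant under `SU(2)`. -/
theorem sigma_spinAct {w : Fin 4 → Fin 4 → ℝ} (hw : ∀ a b, w a b = -w b a) (η : Spinor) :
    sigma (spinAct w *ᵥ η) = spinAct w *ᵥ sigma η := by
  rw [spinAct_eq hw, quat_transpose_mulVec, quat_transpose_mulVec, sigma_apply, sigma_apply]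
  ext i
  fin_cases i <;> simp <;> ring

/-- The infinitesimal equivariance of `J`. -/
theorem jVecDeriv_spinAct {w : Fin 4 → Fin 4 → ℝ} (hw : ∀ a b, w a b = -w b a) {η : Spinor}
    (h : η ≠ 0) :
    quatEndo (jVecDeriv η (spinAct w *ᵥ η)) =
      Matrix.of w * jEndo η - jEndo η * Matrix.of w := by
  have hn := (normR_pos h).ne'
  -- the action of `𝔰𝔲(2)` preserves the norm
  have hN : normPolar η (spinAct w *ᵥ η) = 0 := by
    rw [spinAct_eq hw, quat_transpose_mulVec]
    simp [normPolar]
    ring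
  have k0 : jVecDeriv η (spinAct w *ᵥ η) 0 = selfDual w 2 * jVec η 1 - selfDual w 1 * jVec η 2 := by
    simp only [jVecDeriv, hN, jVec]
    field_simp
    rw [spinAct_eq hw, quat_transpose_mulVec]
    simp [jPolar, jQuad]
    ring
  have k1 : jVecDeriv η (spinAct w *ᵥ η) 1 = selfDual w 0 * jVec η 2 - selfDual w 2 * jVec η 0 := by
    simp only [jVecDeriv, hN, jVec]
    field_simp
    rw [spinAct_eq hw, quat_transpose_mulVec]
    simp [jPolar, jQuad]
    ring
  have k2 : jVecDeriv η (spinAct w *ᵥ η) 2 = selfDual w 1 * jVec η 0 - selfDual w 0 * jVec η 1 := by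
    simp only [jVecDeriv, hN, jVec]
    field_simp
    rw [spinAct_eq hw, quat_transpose_mulVec]
    simp [jPolar, jQuad]
    ring
  have h0 : ∀ a, w a a = 0 := fun a => by linarith [hw a a]
  generalize jVecDeriv η (spinAct w *ᵥ η) = d at k0 k1 k2
  ext a b
  simp only [Matrix.sub_apply, Matrix.mul_apply, Fin.sum_univ_four, jEndo, Matrix.of_apply]
  fin_cases a <;> fin_cases b <;>
    simp [quatEndo, k0, k1, k2, selfDual, h0,
      hw 1 0, hw 2 0, hw 3 0, hw 2 1, hw 3 1, hw 3 2] <;> ring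

/-- The cross product, in the orientation for which `quat s * quat t` has imaginary part
`quat (cross s t)`. -/
def cross (s t : Fin 3 → ℝ) : Fin 3 → ℝ :=
  ![s 1 * t 2 - s 2 * t 1, s 2 * t 0 - s 0 * t 2, s 0 * t 1 - s 1 * t 0]

theorem quat_mul_quat (s t : Fin 3 → ℝ) :
    quat s * quat t = -((s 0 * t 0 + s 1 * t 1 + s 2 * t 2 : ℝ) : ℂ) • 1 + quat (cross s t) := by
  ext i j
  fin_cases i <;> fin_cases j <;> apply Complex.ext <;>
    simp [quat, cross, Matrix.mul_apply, Fin.sum_univ_two] <;> ring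

theorem quat_add (s t : Fin 3 → ℝ) : quat (s + t) = quat s + quat t := by
  ext i j
  fin_cases i <;> fin_cases j <;> simp [quat] <;> ring

theorem quat_smul (c : ℝ) (s : Fin 3 → ℝ) : quat (c • s) = (c : ℂ) • quat s := by
  ext i j
  fin_cases i <;> fin_cases j <;> simp [quat] <;> ring

theorem sigma_sigma (η : Spinor) : sigma (sigma η) = -η := by
  ext i
  fin_cases i <;> simp [sigma_apply]

theorem sigma_quat (t : Fin 3 → ℝ) (η : Spinor) :
    sigma ((quat t)ᵀ *ᵥ η) = (quat t)ᵀ *ᵥ sigma η := by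
  ext i
  fin_cases i <;> simp [sigma_apply, quat, Matrix.mulVec, dotProduct, Fin.sum_univ_two] <;> ring

/-- The imaginary quaternion `J_η` maps the spinor `η` to a multiple of `σ η`. -/
theorem quat_jVec_mulVec {η : Spinor} (h : η ≠ 0) : (quat (jVec η))ᵀ *ᵥ η = -sigma η := by
  have hn : normSq η ≠ 0 := by
    rw [normSq_eq_normR]
    exact_mod_cast (normR_pos h).ne'
  have h1 : lower (sigma η) ⬝ᵥ η = normSq η := rfl
  have h2 : lower η ⬝ᵥ η = 0 := by
    simp [lower_eq, dotProduct, Fin.sum_univ_two]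
    ring
  rw [← jMat_eq_quat, jMat, Matrix.transpose_smul, Matrix.transpose_add, Matrix.transpose_vecMulVec,
    Matrix.transpose_vecMulVec, Matrix.smul_mulVec, Matrix.add_mulVec, Matrix.vecMulVec_mulVec,
    Matrix.vecMulVec_mulVec, h1, h2]
  ext i
  simp
  field_simp

/-- The skew matrix of the bivector `V ∧ W`. -/
def wedge (V W : Fin 4 → ℝ) (a b : Fin 4) : ℝ := V a * W b - V b * W a

theorem wedge_skew (V W : Fin 4 → ℝ) (a b : Fin 4) : wedge V W a b = -wedge V W b a := by
  unfold wedge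
  ring

/-- On self-dual bivectors, right multiplication by a unit imaginary quaternion acts as the rotation by
`π` about its axis. -/
theorem selfDual_wedge_quatEndo (s : Fin 3 → ℝ) (hs : s 0 ^ 2 + s 1 ^ 2 + s 2 ^ 2 = 1)
    (V W : Fin 4 → ℝ) :
    selfDual (wedge (quatEndo s *ᵥ V) (quatEndo s *ᵥ W)) =
      -selfDual (wedge V W) + (2 * (s 0 * selfDual (wedge V W) 0 + s 1 * selfDual (wedge V W) 1 +
        s 2 * selfDual (wedge V W) 2)) • s := by
  have h0 : s 0 ^ 2 = 1 - s 1 ^ 2 - s 2 ^ 2 := by linarith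
  ext k
  fin_cases k <;>
    simp [selfDual, wedge, quatEndo, Matrix.mulVec, dotProduct, Fin.sum_univ_four] <;>
    ring_nf <;> simp only [h0] <;> ring

/-- The infinitesimal version: on self-dual bivectors, right multiplication by an imaginary quaternion
acts as a multiple of the cross product with it. -/
theorem selfDual_wedge_quatEndo_add (s : Fin 3 → ℝ) (V W : Fin 4 → ℝ) :
    selfDual (wedge (quatEndo s *ᵥ V) W) + selfDual (wedge V (quatEndo s *ᵥ W)) =
      (-2 : ℝ) • cross s (selfDual (wedge V W)) := by
  ext k
  fin_cases k <;>
    simp [selfDual, wedge, quatEndo, cross, Matrix.mulVec, dotProduct, Fin.sum_univ_four] <;>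
    ring

/-- The part of type `(0,2)` of the curvature form of `𝕊'`, applied to the tautological section,
vanishes when the curvature is a multiple of the self-dual projection. -/
theorem curvature_type {η : Spinor} (h : η ≠ 0) (V W : Fin 4 → ℝ) :
    spinAct (wedge V W) *ᵥ η + sigma (spinAct (wedge (jEndo η *ᵥ V) W) *ᵥ η +
      spinAct (wedge V (jEndo η *ᵥ W)) *ᵥ η) -
      spinAct (wedge (jEndo η *ᵥ V) (jEndo η *ᵥ W)) *ᵥ η = 0 := by
  have hs := sum_jVec_sq h
  have h1 := quat_jVec_mulVec h
  simp only [spinAct_eq (wedge_skew _ _), ← Matrix.add_mulVec, ← smul_add, ← Matrix.transpose_add,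
    ← quat_add]
  rw [jEndo, selfDual_wedge_quatEndo_add, selfDual_wedge_quatEndo _ hs]
  set s := jVec η
  set t := selfDual (wedge V W)
  have h2 := congrArg (fun M => Mᵀ *ᵥ η) (quat_mul_quat s t)
  simp only [Matrix.transpose_mul, Matrix.transpose_add, Matrix.transpose_smul,
    Matrix.transpose_one, Matrix.add_mulVec, Matrix.smul_mulVec, Matrix.one_mulVec,
    ← Matrix.mulVec_mulVec, h1, Matrix.mulVec_neg, ← sigma_quat] at h2
  -- as the quaternion `s` maps `η` to `-σ η`, the cross product acts on `η` through `σ`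
  have h3 : (quat (cross s t))ᵀ *ᵥ η = ((s 0 * t 0 + s 1 * t 1 + s 2 * t 2 : ℝ) : ℂ) • η -
      sigma ((quat t)ᵀ *ᵥ η) := by
    rw [sub_eq_add_neg, h2]
    module
  have hneg : quat (-t) = -quat t := by simpa using quat_smul (-1) t
  have hσ : ∀ (c : ℝ) (ζ : Spinor), sigma ((c : ℂ) • ζ) = (c : ℂ) • sigma ζ := by
    intro c ζ
    simp
  have h12 : (1 / 2 : ℂ) = ((1 / 2 : ℝ) : ℂ) := by push_cast; rfl
  simp only [quat_add, quat_smul, hneg, Matrix.transpose_smul, Matrix.transpose_add,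
    Matrix.transpose_neg, Matrix.smul_mulVec, Matrix.add_mulVec, Matrix.neg_mulVec, h1, h3, h12, hσ,
    map_sub, sigma_sigma]
  push_cast
  module

/-! ### The curvature of an anti-self-dual Einstein metric -/

section
variable {X : Type*} [TopologicalSpace X] [ChartedSpace (EuclideanSpace ℝ (Fin 4)) X]
  [IsManifold (𝓡 4) ∞ X] (g : Metric X)

theorem riem_skew (e : Frame X) (x : X) (a b c d : Fin 4) :
    riem g e x a b c d = -riem g e x a b d c := by
  have h : ∀ k b c, lcCoeff g e k b c = -lcCoeff g e k c b := fun k b c =>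
    funext fun x => lcCoeff_skew g e k b c x
  have h1 : ∀ k v, dirDeriv (lcCoeff g e k d c) x v = -dirDeriv (lcCoeff g e k c d) x v := by
    intro k v
    rw [h k d c, dirDeriv, dirDeriv, mvfderiv_neg]
    rfl
  simp only [riem, h1]
  have h2 : ∀ k, lcCoeff g e b d k x * lcCoeff g e a k c x
      - lcCoeff g e a d k x * lcCoeff g e b k c x =
      -(lcCoeff g e b c k x * lcCoeff g e a k d x
        - lcCoeff g e a c k x * lcCoeff g e b k d x) := by
    intro k
    rw [lcCoeff_skew g e b d k, lcCoeff_skew g e a k c, lcCoeff_skew g e a d k,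
      lcCoeff_skew g e b k c]
    ring
  have h3 : ∀ k, bracketCoeff g e a b k x * lcCoeff g e k d c x =
      -(bracketCoeff g e a b k x * lcCoeff g e k c d x) := by
    intro k
    rw [lcCoeff_skew g e k d c]
    ring
  simp only [h2, h3, Finset.sum_neg_distrib]
  ring

/-- The `3 × 3` determinant of Kronecker symbols with rows `b, c, d` and columns `k`. -/
def volSymbol₃ (k : Fin 3 → Fin 4) (b c d : Fin 4) : ℝ :=
  kron b (k 0) * kron c (k 1) * kron d (k 2) - kron b (k 0) * kron c (k 2) * kron d (k 1)
    - kron b (k 1) * kron c (k 0) * kron d (k 2) + kron b (k 1) * kron c (k 2) * kron d (k 0)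
    + kron b (k 2) * kron c (k 0) * kron d (k 1) - kron b (k 2) * kron c (k 1) * kron d (k 0)

theorem volSymbol_eq_sum (a b c d : Fin 4) : volSymbol a b c d =
    kron a 0 * volSymbol₃ ![1, 2, 3] b c d - kron a 1 * volSymbol₃ ![0, 2, 3] b c d +
      kron a 2 * volSymbol₃ ![0, 1, 3] b c d - kron a 3 * volSymbol₃ ![0, 1, 2] b c d := by
  change (Matrix.of fun i j : Fin 4 => kron ((![a, b, c, d] : Fin 4 → Fin 4) i) j).det = _
  rw [Matrix.det_succ_row_zero, Fin.sum_univ_four]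
  simp only [Matrix.det_fin_three, Matrix.submatrix_apply, volSymbol₃]
  simp [Fin.succAbove]
  ring

theorem sum_volSymbol_zero_one (f : Fin 4 → Fin 4 → ℝ) :
    ∑ p, ∑ q, volSymbol 0 1 p q * f p q = f 2 3 - f 3 2 := by
  simp [volSymbol_eq_sum, volSymbol₃, kron, Fin.sum_univ_succ]
  ring

theorem sum_volSymbol_zero_two (f : Fin 4 → Fin 4 → ℝ) :
    ∑ p, ∑ q, volSymbol 0 2 p q * f p q = f 3 1 - f 1 3 := by
  simp [volSymbol_eq_sum, volSymbol₃, kron, Fin.sum_univ_succ]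
  ring

theorem sum_volSymbol_zero_three (f : Fin 4 → Fin 4 → ℝ) :
    ∑ p, ∑ q, volSymbol 0 3 p q * f p q = f 1 2 - f 2 1 := by
  simp [volSymbol_eq_sum, volSymbol₃, kron, Fin.sum_univ_succ]
  ring

/-- For an Einstein metric, the Weyl tensor is the Riemann tensor minus that of constant curvature
`2Λ`. -/
theorem weyl_of_einstein {e : Frame X} {x : X}
    (hE : ∀ a b, ricci g e x a b = scalarCurv g e x / 4 * kron a b) (a b c d : Fin 4) :
    weyl g e x a b c d = riem g e x a b c d -
      2 * capLambda g e x * (kron a c * kron b d - kron b c * kron a d) := by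
  have hk : ∀ a b, kron a b = kron b a := fun a b => by simp [kron, eq_comm]
  simp only [weyl, schouten, hE, capLambda, hk c a, hk c b, hk d a, hk d b]
  ring

/-- For an anti-self-dual Einstein metric, the curvature of `𝕊'` is that of a space of constant
curvature. -/
theorem selfDual_riem {e : Frame X} {x : X}
    (hW : ∀ a b c d, weylPlus g e x a b c d = 0)
    (hE : ∀ a b, ricci g e x a b = scalarCurv g e x / 4 * kron a b) (a b : Fin 4) :
    selfDual (riem g e x a b) = (2 * capLambda g e x) •
      selfDual (fun c d => kron a c * kron b d - kron b c * kron a d) := by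
  have h1 := hW a b 0 1
  have h2 := hW a b 0 2
  have h3 := hW a b 0 3
  simp only [weylPlus, sum_volSymbol_zero_one, sum_volSymbol_zero_two, sum_volSymbol_zero_three,
    weyl_of_einstein g hE] at h1 h2 h3
  rw [riem_skew g e x a b 3 2] at h1
  rw [riem_skew g e x a b 3 1] at h2
  rw [riem_skew g e x a b 2 1] at h3
  ext k
  fin_cases k <;> simp [selfDual] <;> linarith

theorem spinAct_smul (c : ℝ) (w : Fin 4 → Fin 4 → ℝ) :
    spinAct (c • w) = (c : ℂ) • spinAct w := by
  simp only [spinAct, liftBeta, Pi.smul_apply, smul_eq_mul, Complex.ofReal_mul, mul_smul,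
    ← Finset.smul_sum]
  rw [smul_comm, Matrix.transpose_smul, smul_neg]

theorem spinAct_add (v w : Fin 4 → Fin 4 → ℝ) : spinAct (v + w) = spinAct v + spinAct w := by
  simp only [spinAct, liftBeta, Pi.add_apply, Complex.ofReal_add, add_smul,
    Finset.sum_add_distrib, smul_add, Matrix.transpose_add, neg_add]

theorem spinAct_zero : spinAct 0 = 0 := by simpa using spinAct_smul 0 0

theorem spinAct_sum {ι : Type*} (s : Finset ι) (w : ι → Fin 4 → Fin 4 → ℝ) :
    spinAct (∑ i ∈ s, w i) = ∑ i ∈ s, spinAct (w i) := by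
  classical
  induction s using Finset.induction_on with
  | empty => simp [spinAct_zero]
  | insert i s hi ih => rw [Finset.sum_insert hi, Finset.sum_insert hi, spinAct_add, ih]

/-- The curvature of `𝕊'` in the directions `V`, `W`, for an anti-self-dual Einstein metric. -/
theorem sum_spinAct_riem {e : Frame X} {x : X}
    (hW : ∀ a b c d, weylPlus g e x a b c d = 0)
    (hE : ∀ a b, ricci g e x a b = scalarCurv g e x / 4 * kron a b) (V W : Fin 4 → ℝ) :
    ∑ a, ∑ b, ((V a * W b : ℝ) : ℂ) • spinAct (riem g e x a b) =
      ((2 * capLambda g e x : ℝ) : ℂ) • spinAct (wedge V W) := by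
  have h : ∀ a b, spinAct (riem g e x a b) = ((2 * capLambda g e x : ℝ) : ℂ) •
      spinAct (fun c d => kron a c * kron b d - kron b c * kron a d) := by
    intro a b
    rw [spinAct_eq (riem_skew g e x a b), selfDual_riem g hW hE, quat_smul,
      spinAct_eq fun c d => by ring, Matrix.transpose_smul, smul_comm]
  have hw : wedge V W = ∑ a, ∑ b,
      (V a * W b) • (fun c d => kron a c * kron b d - kron b c * kron a d) := by
    ext c d
    simp only [Finset.sum_apply, Pi.smul_apply, smul_eq_mul, kron, mul_sub, Finset.sum_sub_distrib,
      wedge]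
    simp
  simp only [h, hw, spinAct_sum, spinAct_smul, Finset.smul_sum]
  refine Finset.sum_congr rfl fun a _ => Finset.sum_congr rfl fun b _ => ?_
  rw [smul_comm]
end

/-! ### Rotations given by pairs of unit quaternions -/

/-- The matrix is a real quaternion, i.e. it lies in `𝕄`. -/
def IsQuaternion (Y : Matrix (Fin 2) (Fin 2) ℂ) : Prop :=
  Y 1 1 = star (Y 0 0) ∧ Y 1 0 = -star (Y 0 1)

namespace IsQuaternion

theorem mul {Y Z : Matrix (Fin 2) (Fin 2) ℂ} (hY : IsQuaternion Y) (hZ : IsQuaternion Z) :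
    IsQuaternion (Y * Z) := by
  obtain ⟨h1, h2⟩ := hY
  obtain ⟨h3, h4⟩ := hZ
  constructor <;> simp [Matrix.mul_apply, Fin.sum_univ_two, h1, h2, h3, h4] <;> ring

theorem add {Y Z : Matrix (Fin 2) (Fin 2) ℂ} (hY : IsQuaternion Y) (hZ : IsQuaternion Z) :
    IsQuaternion (Y + Z) := by
  obtain ⟨h1, h2⟩ := hY
  obtain ⟨h3, h4⟩ := hZ
  constructor <;> simp [h1, h2, h3, h4] <;> ring

theorem conjTranspose {Y : Matrix (Fin 2) (Fin 2) ℂ} (hY : IsQuaternion Y) :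
    IsQuaternion Yᴴ := by
  obtain ⟨h1, h2⟩ := hY
  constructor <;> simp [Matrix.conjTranspose_apply, h1, h2]

theorem mBasis (a : Fin 4) : IsQuaternion (mBasis a) := by
  fin_cases a <;> constructor <;> simp [mBasis_eq, mBasis']

theorem quat (s : Fin 3 → ℝ) : IsQuaternion (quat s) := by
  constructor <;> simp [SpinorTwistor.quat] <;> ring

end IsQuaternion

theorem SU2.conjTranspose_mul_self (U : SU2) :
    (U : Matrix (Fin 2) (Fin 2) ℂ)ᴴ * (U : Matrix (Fin 2) (Fin 2) ℂ) = 1 :=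
  (Matrix.mem_unitaryGroup_iff').1 (Matrix.specialUnitaryGroup_le_unitaryGroup U.2)

theorem SU2.mul_conjTranspose_self (U : SU2) :
    (U : Matrix (Fin 2) (Fin 2) ℂ) * (U : Matrix (Fin 2) (Fin 2) ℂ)ᴴ = 1 :=
  (Matrix.mem_unitaryGroup_iff).1 (Matrix.specialUnitaryGroup_le_unitaryGroup U.2)

/-- The inverse of an element of `SU(2)` is both its conjugate transpose and its adjugate. -/
theorem SU2.isQuaternion (U : SU2) : IsQuaternion (U : Matrix (Fin 2) (Fin 2) ℂ) := by
  have hdet : (U : Matrix (Fin 2) (Fin 2) ℂ).det = 1 :=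
    (Matrix.mem_specialUnitaryGroup_iff.1 U.2).2
  have h : (U : Matrix (Fin 2) (Fin 2) ℂ)ᴴ = (U : Matrix (Fin 2) (Fin 2) ℂ).adjugate := by
    calc (U : Matrix (Fin 2) (Fin 2) ℂ)ᴴ
        = (U : Matrix (Fin 2) (Fin 2) ℂ)ᴴ *
          ((U : Matrix (Fin 2) (Fin 2) ℂ) * (U : Matrix (Fin 2) (Fin 2) ℂ).adjugate) := by
          rw [Matrix.mul_adjugate, hdet, one_smul, mul_one]
      _ = _ := by rw [← mul_assoc, SU2.conjTranspose_mul_self, one_mul]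
  rw [Matrix.adjugate_fin_two] at h
  constructor
  · simpa using (congrFun (congrFun h 0) 0).symm
  · have h2 : star ((U : Matrix (Fin 2) (Fin 2) ℂ) 0 1) = -(U : Matrix (Fin 2) (Fin 2) ℂ) 1 0 := by
      simpa using congrFun (congrFun h 1) 0
    rw [h2, neg_neg]

theorem mCoord_add (a : Fin 4) (Y Z : Matrix (Fin 2) (Fin 2) ℂ) :
    mCoord a (Y + Z) = mCoord a Y + mCoord a Z := by
  simp [mCoord, Matrix.mul_add]

theorem mCoord_smul (a : Fin 4) (c : ℝ) (Y : Matrix (Fin 2) (Fin 2) ℂ) :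
    mCoord a ((c : ℂ) • Y) = c * mCoord a Y := by
  simp [mCoord]

theorem mCoord_sum {ι : Type*} (s : Finset ι) (a : Fin 4) (Y : ι → Matrix (Fin 2) (Fin 2) ℂ) :
    mCoord a (∑ i ∈ s, Y i) = ∑ i ∈ s, mCoord a (Y i) := by
  simp [mCoord, Matrix.mul_sum, Matrix.trace_sum]

/-- The matrices `m_a` form an orthonormal basis of the space of quaternions, with coordinates
`mCoord`. -/
theorem sum_mCoord_smul {Y : Matrix (Fin 2) (Fin 2) ℂ} (hY : IsQuaternion Y) :
    ∑ a, (mCoord a Y : ℂ) • mBasis a = Y := by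
  obtain ⟨h1, h2⟩ := hY
  have h : ∀ a, (mCoord a Y : ℂ) • mBasis a =
      ((1 / 2 * (((mBasis' a)ᴴ * Y).trace).re : ℝ) : ℂ) • mBasis' a := by
    intro a
    have hs : (Real.sqrt 2)⁻¹ * (Real.sqrt 2)⁻¹ = 1 / 2 := by
      rw [← mul_inv, Real.mul_self_sqrt (by norm_num)]
      norm_num
    rw [← hs, mCoord, mBasis_eq, Matrix.conjTranspose_smul, Matrix.smul_mul, Matrix.trace_smul,
      smul_smul]
    congr 1
    have hst : star (((Real.sqrt 2 : ℝ) : ℂ)⁻¹) = (((Real.sqrt 2)⁻¹ : ℝ) : ℂ) := by simp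
    rw [hst, smul_eq_mul, Complex.re_ofReal_mul]
    push_cast
    ring
  simp only [h, Fin.sum_univ_four]
  ext i j
  fin_cases i <;> fin_cases j <;> apply Complex.ext <;>
    simp [mBasis', h1, h2, Matrix.trace, Matrix.mul_apply, Fin.sum_univ_two] <;> ring

/-- Right multiplication by the quaternion `T` maps `∑ v_b m_b` to the vector with components
`rightMulMat T v`. -/
theorem sum_rightMulMat_smul {T : Matrix (Fin 2) (Fin 2) ℂ} (hT : IsQuaternion T) (b : Fin 4) :
    ∑ a, (rightMulMat T a b : ℂ) • mBasis a = mBasis b * T :=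
  sum_mCoord_smul ((IsQuaternion.mBasis b).mul hT)

/-- The matrix of `Y ↦ A Y B⁻¹` in the basis `m_a`. -/
def spinRot (A B : Matrix (Fin 2) (Fin 2) ℂ) (a b : Fin 4) : ℝ := mCoord a (A * mBasis b * Bᴴ)

theorem sum_spinRot_smul {A B : Matrix (Fin 2) (Fin 2) ℂ} (hA : IsQuaternion A)
    (hB : IsQuaternion B) (b : Fin 4) :
    ∑ a, (spinRot A B a b : ℂ) • mBasis a = A * mBasis b * Bᴴ :=
  sum_mCoord_smul ((hA.mul (IsQuaternion.mBasis b)).mul hB.conjTranspose)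

theorem spinRot_transpose (A B : Matrix (Fin 2) (Fin 2) ℂ) (a b : Fin 4) :
    spinRot A B a b = spinRot Aᴴ Bᴴ b a := by
  have h : ((mBasis a)ᴴ * (A * mBasis b * Bᴴ)).trace =
      star ((mBasis b)ᴴ * (Aᴴ * mBasis a * Bᴴᴴ)).trace := by
    rw [← Matrix.trace_conjTranspose]
    simp only [Matrix.conjTranspose_mul, Matrix.conjTranspose_conjTranspose]
    rw [← Matrix.mul_assoc, Matrix.trace_mul_comm]
    simp only [Matrix.mul_assoc]
  simp only [spinRot, mCoord, h]
  simp

theorem sum_spinRot_smul' {A B : Matrix (Fin 2) (Fin 2) ℂ} (hA : IsQuaternion A)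
    (hB : IsQuaternion B) (k : Fin 4) :
    ∑ a, (spinRot A B k a : ℂ) • mBasis a = Aᴴ * mBasis k * B := by
  simp only [spinRot_transpose A B k]
  rw [sum_spinRot_smul hA.conjTranspose hB.conjTranspose, Matrix.conjTranspose_conjTranspose]

/-- Right multiplications are intertwined by rotations. -/
theorem spinRot_mul_rightMulMat {A B T : Matrix (Fin 2) (Fin 2) ℂ} (hA : IsQuaternion A)
    (hB : IsQuaternion B) (hT : IsQuaternion T) (hB1 : Bᴴ * B = 1) :
    (Matrix.of (spinRot A B) * Matrix.of (rightMulMat T) : Matrix (Fin 4) (Fin 4) ℝ) =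
      Matrix.of (rightMulMat (B * T * Bᴴ)) * Matrix.of (spinRot A B) := by
  ext a b
  simp only [Matrix.mul_apply, Matrix.of_apply]
  trans mCoord a (A * (mBasis b * T) * Bᴴ)
  · rw [← sum_rightMulMat_smul hT, Matrix.mul_sum, Matrix.sum_mul, mCoord_sum]
    refine Finset.sum_congr rfl fun k _ => ?_
    rw [Matrix.mul_smul, Matrix.smul_mul, mCoord_smul, spinRot, mul_comm]
  · trans mCoord a (A * mBasis b * Bᴴ * (B * T * Bᴴ))
    · congr 1
      calc A * (mBasis b * T) * Bᴴ = A * mBasis b * 1 * T * Bᴴ := by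
            simp only [Matrix.mul_assoc, Matrix.one_mul]
        _ = _ := by rw [← hB1]; simp only [Matrix.mul_assoc]
    · rw [← sum_spinRot_smul hA hB, Matrix.sum_mul, mCoord_sum]
      refine Finset.sum_congr rfl fun k _ => ?_
      rw [Matrix.smul_mul, mCoord_smul, rightMulMat, mul_comm]

theorem matCLM_star_apply (B : Matrix (Fin 2) (Fin 2) ℂ) (η : Spinor) :
    matCLM (fun r s => star (B r s)) η = ![star (B 0 0) * η 0 + star (B 0 1) * η 1,
      star (B 1 0) * η 0 + star (B 1 1) * η 1] := by
  rw [matCLM_apply]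
  ext i
  fin_cases i <;> simp [Matrix.mulVec, dotProduct, Fin.sum_univ_two]

theorem sigma_matCLM_star {B : Matrix (Fin 2) (Fin 2) ℂ} (hB : IsQuaternion B) (η : Spinor) :
    sigma (matCLM (fun r s => star (B r s)) η) = matCLM (fun r s => star (B r s)) (sigma η) := by
  obtain ⟨h1, h2⟩ := hB
  rw [matCLM_star_apply, matCLM_star_apply, sigma_apply, sigma_apply, h1, h2]
  ext i
  fin_cases i <;> simp <;> ring

theorem IsQuaternion.normSq_eq_one {B : Matrix (Fin 2) (Fin 2) ℂ} (hB : IsQuaternion B)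
    (hB1 : Bᴴ * B = 1) : star (B 0 0) * B 0 0 + star (B 0 1) * B 0 1 = 1 := by
  have h := congrFun (congrFun hB1 0) 0
  simp only [Matrix.mul_apply, Fin.sum_univ_two, Matrix.conjTranspose_apply, hB.2,
    Matrix.one_apply_eq] at h
  rw [← h]
  simp
  ring

/-- The equivariance of `J`: the spinor `B̄ η` has the quaternion `B J_η B⁻¹`. -/
theorem jMat_matCLM_star {B : Matrix (Fin 2) (Fin 2) ℂ} (hB : IsQuaternion B)
    (hB1 : Bᴴ * B = 1) (η : Spinor) :
    jMat (matCLM (fun r s => star (B r s)) η) = B * jMat η * Bᴴ := by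
  have hq := hB.normSq_eq_one hB1
  have hl : ∀ ζ : Spinor, lower (matCLM (fun r s => star (B r s)) ζ) = B *ᵥ lower ζ := by
    intro ζ
    rw [matCLM_star_apply, lower_eq, lower_eq, hB.1, hB.2]
    ext i
    fin_cases i <;> simp [Matrix.mulVec, dotProduct, Fin.sum_univ_two, hB.1, hB.2] <;> ring
  have hv : ∀ ζ : Spinor, matCLM (fun r s => star (B r s)) ζ = ζ ᵥ* Bᴴ := by
    intro ζ
    rw [matCLM_star_apply]
    ext i
    fin_cases i <;> simp [Matrix.vecMul, dotProduct, Fin.sum_univ_two] <;> ring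
  have hn : normSq (matCLM (fun r s => star (B r s)) η) = normSq η := by
    rw [normSq, sigma_matCLM_star hB, hl, hv, dotProduct_comm, ← Matrix.dotProduct_mulVec,
      Matrix.mulVec_mulVec, hB1, Matrix.one_mulVec, dotProduct_comm]
    rfl
  rw [jMat, jMat, hn, sigma_matCLM_star hB, hl, hl, hv, hv]
  rw [Matrix.mul_smul, Matrix.smul_mul, Matrix.mul_add, Matrix.add_mul]
  simp only [Matrix.mul_vecMulVec, Matrix.vecMulVec_mul]

/-- The image of the Maurer–Cartan form: for the rotation `R` given by `(A, B)`, the second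
component of the lift of `R⁻¹ dR` is `B⁻¹ dB`. -/
theorem liftBeta_maurerCartan {A B A' B' : Matrix (Fin 2) (Fin 2) ℂ} (hA : IsQuaternion A)
    (hB : IsQuaternion B) (hA' : IsQuaternion A') (hB' : IsQuaternion B')
    (hA1 : Aᴴ * A = 1) (hB1 : Bᴴ * B = 1) (htr : (Aᴴ * A').trace = 0)
    (hBB : B'ᴴ * B = -(Bᴴ * B')) :
    liftBeta (fun a b => ∑ k, spinRot A B k a *
      mCoord k (A' * mBasis b * Bᴴ + A * mBasis b * B'ᴴ)) = Bᴴ * B' := by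
  have h : ∀ b, ∑ a, ((∑ k, spinRot A B k a *
      mCoord k (A' * mBasis b * Bᴴ + A * mBasis b * B'ᴴ) : ℝ) : ℂ) • mBasis a =
      Aᴴ * A' * mBasis b - mBasis b * (Bᴴ * B') := by
    intro b
    calc _ = ∑ k, (mCoord k (A' * mBasis b * Bᴴ + A * mBasis b * B'ᴴ) : ℂ) •
          ∑ a, (spinRot A B k a : ℂ) • mBasis a := by
          simp only [Complex.ofReal_sum, Complex.ofReal_mul, Finset.sum_smul, Finset.smul_sum,
            smul_smul]
          rw [Finset.sum_comm]
          simp only [mul_comm]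
      _ = Aᴴ * (∑ k, (mCoord k (A' * mBasis b * Bᴴ + A * mBasis b * B'ᴴ) : ℂ) • mBasis k) * B := by
          simp only [sum_spinRot_smul' hA hB, Matrix.mul_sum, Matrix.sum_mul, Matrix.mul_smul,
            Matrix.smul_mul]
      _ = Aᴴ * A' * mBasis b * (Bᴴ * B) + (Aᴴ * A) * mBasis b * (B'ᴴ * B) := by
          rw [sum_mCoord_smul (((hA'.mul (IsQuaternion.mBasis b)).mul hB.conjTranspose).add
            ((hA.mul (IsQuaternion.mBasis b)).mul hB'.conjTranspose))]
          simp only [Matrix.mul_add, Matrix.add_mul, Matrix.mul_assoc]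
      _ = _ := by
          rw [hA1, hB1, hBB]
          simp only [Matrix.mul_one, Matrix.one_mul, Matrix.mul_neg, sub_eq_add_neg]
  have h2 : liftBeta (fun a b => ∑ k, spinRot A B k a *
      mCoord k (A' * mBasis b * Bᴴ + A * mBasis b * B'ᴴ)) =
      (-1 / 2 : ℂ) • ∑ b, (mBasis b)ᴴ * (Aᴴ * A' * mBasis b - mBasis b * (Bᴴ * B')) := by
    rw [liftBeta, Finset.sum_comm]
    congr 1
    refine Finset.sum_congr rfl fun b _ => ?_
    rw [← h b, Matrix.mul_sum]
    simp only [Matrix.mul_smul]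
  have h3 := sum_mBasis_mul 1
  simp only [Matrix.one_mul] at h3
  rw [h2]
  simp only [Matrix.mul_sub, Finset.sum_sub_distrib, sum_mBasis_mul, htr]
  simp only [← Matrix.mul_assoc (mBasis _)ᴴ (mBasis _), ← Matrix.sum_mul, h3]
  simp [Matrix.trace, smul_smul]

/-- Conjugating a skew matrix by a rotation conjugates the second component of its lift. -/
theorem liftBeta_rotate {A B : Matrix (Fin 2) (Fin 2) ℂ} (hA : IsQuaternion A)
    (hB : IsQuaternion B) (hA1 : A * Aᴴ = 1) (w : Fin 4 → Fin 4 → ℝ) :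
    liftBeta (fun a b => ∑ k, ∑ l, spinRot A B k a * spinRot A B l b * w k l) =
      Bᴴ * liftBeta w * B := by
  have h : ∀ k l, Bᴴ * ((mBasis l)ᴴ * mBasis k) * B =
      ∑ a, ∑ b, ((spinRot A B k a * spinRot A B l b : ℝ) : ℂ) • ((mBasis b)ᴴ * mBasis a) := by
    intro k l
    have h1 : (∑ b, (spinRot A B l b : ℂ) • mBasis b)ᴴ * ∑ a, (spinRot A B k a : ℂ) • mBasis a =
        Bᴴ * ((mBasis l)ᴴ * mBasis k) * B := by
      rw [sum_spinRot_smul' hA hB, sum_spinRot_smul' hA hB]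
      simp only [Matrix.conjTranspose_mul, Matrix.conjTranspose_conjTranspose]
      calc _ = Bᴴ * ((mBasis l)ᴴ * (A * Aᴴ) * mBasis k) * B := by simp only [Matrix.mul_assoc]
        _ = _ := by rw [hA1, Matrix.mul_one]
    rw [← h1, Matrix.conjTranspose_sum, Matrix.mul_sum]
    refine Finset.sum_congr rfl fun a _ => ?_
    rw [Matrix.sum_mul]
    refine Finset.sum_congr rfl fun b _ => ?_
    rw [Matrix.conjTranspose_smul, Matrix.smul_mul, Matrix.mul_smul, smul_smul]
    congr 1
    simp
    ring
  simp only [liftBeta, Matrix.mul_smul, Matrix.smul_mul, Matrix.mul_sum, Matrix.sum_mul, h,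
    Complex.ofReal_sum, Complex.ofReal_mul, Finset.sum_smul, Finset.smul_sum, smul_smul]
  have hsum : ∀ f : Fin 4 → Fin 4 → Fin 4 → Fin 4 → Matrix (Fin 2) (Fin 2) ℂ,
      ∑ a, ∑ b, ∑ k, ∑ l, f a b k l = ∑ k, ∑ l, ∑ a, ∑ b, f a b k l := by
    intro f
    calc _ = ∑ a, ∑ k, ∑ b, ∑ l, f a b k l :=
          Finset.sum_congr rfl fun a _ => Finset.sum_comm
      _ = ∑ k, ∑ a, ∑ b, ∑ l, f a b k l := Finset.sum_comm
      _ = ∑ k, ∑ a, ∑ l, ∑ b, f a b k l :=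
          Finset.sum_congr rfl fun k _ => Finset.sum_congr rfl fun a _ => Finset.sum_comm
      _ = _ := Finset.sum_congr rfl fun k _ => Finset.sum_comm
  rw [hsum]
  refine Finset.sum_congr rfl fun k _ => Finset.sum_congr rfl fun l _ =>
    Finset.sum_congr rfl fun a _ => Finset.sum_congr rfl fun b _ => ?_
  congr 1
  ring

/-! ### Smooth vector fields and brackets on manifolds -/

section
open VectorField
variable {E : Type*} [NormedAddCommGroup E] [NormedSpace ℝ E]
  {H : Type*} [TopologicalSpace H] {I : ModelWithCorners ℝ E H}
  {M : Type*} [TopologicalSpace M] [ChartedSpace H M]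
  {E' : Type*} [NormedAddCommGroup E'] [NormedSpace ℝ E']
  {F : Type*} [NormedAddCommGroup F] [NormedSpace ℝ F]

/-- A map to a space of linear maps on a finite-dimensional space is smooth when its values at
fixed vectors are. -/
theorem contMDiffAt_clm_of_apply [FiniteDimensional ℝ E'] {f : M → E' →L[ℝ] F} {p : M}
    (h : ∀ y, ContMDiffAt I 𝓘(ℝ, F) ∞ (fun q => f q y) p) :
    ContMDiffAt I 𝓘(ℝ, E' →L[ℝ] F) ∞ f p := by
  let d := Module.finrank ℝ E'
  have hd : d = Module.finrank ℝ (Fin d → ℝ) := (Module.finrank_fin_fun ℝ).symm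
  let e₁ := ContinuousLinearEquiv.ofFinrankEq hd
  let e₂ := (e₁.arrowCongr (1 : F ≃L[ℝ] F)).trans (ContinuousLinearEquiv.piRing (Fin d))
  rw [← Function.id_comp f, ← e₂.symm_comp_self]
  exact e₂.symm.contDiff.contMDiff.contMDiffAt.comp p (contMDiffAt_pi_space.2 fun i => h _)

end

section
open VectorField
variable {E : Type*} [NormedAddCommGroup E] [NormedSpace ℝ E]
  {H : Type*} [TopologicalSpace H] {I : ModelWithCorners ℝ E H}
  {M : Type*} [TopologicalSpace M] [ChartedSpace H M] [IsManifold I ∞ M]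
  {E' : Type*} [NormedAddCommGroup E'] [NormedSpace ℝ E']
  {H' : Type*} [TopologicalSpace H'] {I' : ModelWithCorners ℝ E' H'}
  {M' : Type*} [TopologicalSpace M'] [ChartedSpace H' M'] [IsManifold I' ∞ M']
  {F : Type*} [NormedAddCommGroup F] [NormedSpace ℝ F]

theorem contMDiffAt_mfderiv_apply {f : M → M'} {p : M} {V : ∀ q : M, TangentSpace I q}
    (hf : ContMDiffAt I I' ∞ f p)
    (hV : ContMDiffAt I I.tangent ∞ (fun q => (⟨q, V q⟩ : TangentBundle I M)) p) :
    ContMDiffAt I I'.tangent ∞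
      (fun q => (⟨f q, mfderiv I I' f q (V q)⟩ : TangentBundle I' M')) p :=
  ContMDiffAt.clm_apply_of_inCoordinates (F₁ := E) (F₂ := E') (E₁ := fun x : M => TangentSpace I x)
    (E₂ := fun x : M' => TangentSpace I' x) (b₁ := id) (b₂ := f)
    (ϕ := fun q => mfderiv I I' f q) (v := V) (hf.mfderiv_const le_rfl) hV hf

theorem contMDiffAt_mvfderiv_apply {f : M → F} {p : M} {V : ∀ q : M, TangentSpace I q}
    (hf : ContMDiffAt I 𝓘(ℝ, F) ∞ f p)
    (hV : ContMDiffAt I I.tangent ∞ (fun q => (⟨q, V q⟩ : TangentBundle I M)) p) :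
    ContMDiffAt I 𝓘(ℝ, F) ∞ (fun q => mvfderiv I f q (V q)) p :=
  (contMDiff_snd_tangentBundle_modelSpace F 𝓘(ℝ, F)).contMDiffAt.comp p
    (contMDiffAt_mfderiv_apply hf hV)

/-- A vector field is smooth when its components in the chart are. -/
theorem contMDiffAt_of_extChartAt {p : M} {Z : ∀ q : M, TangentSpace I q}
    (h : ContMDiffAt I 𝓘(ℝ, E) ∞ (fun q => mvfderiv I (extChartAt I p) q (Z q)) p) :
    ContMDiffAt I I.tangent ∞ (fun q => (⟨q, Z q⟩ : TangentBundle I M)) p := by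
  rw [ModelWithCorners.tangent, Bundle.contMDiffAt_section]
  refine h.congr_of_eventuallyEq ?_
  filter_upwards [chart_source_mem_nhds H p] with q hq
  have h1 := congrArg (fun L : TangentSpace I q →L[ℝ] E => L (Z q))
    (TangentBundle.continuousLinearMapAt_trivializationAt (I := I) hq)
  refine Eq.trans ?_ h1
  change _ = (trivializationAt E (TangentSpace I) p).continuousLinearMapAt ℝ q (Z q)
  rw [Bundle.Trivialization.continuousLinearMapAt_apply,
    Bundle.Trivialization.coe_linearMapAt_of_mem _ (by simpa using hq)]

/-- A field of endomorphisms is smooth when it maps smooth vector fields to smooth vector fields; it is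
enough to test the fields that are constant in a trivialization. -/
theorem contMDiffAt_endomorphism [FiniteDimensional ℝ E] {p : M}
    {J : ∀ q : M, TangentSpace I q →L[ℝ] TangentSpace I q}
    (h : ∀ Z : ∀ q : M, TangentSpace I q,
      ContMDiffAt I I.tangent ∞ (fun q => (⟨q, Z q⟩ : TangentBundle I M)) p →
      ContMDiffAt I I.tangent ∞ (fun q => (⟨q, J q (Z q)⟩ : TangentBundle I M)) p) :
    ContMDiffAt I (I.prod 𝓘(ℝ, E →L[ℝ] E)) ∞
      (fun p => Bundle.TotalSpace.mk' (E →L[ℝ] E)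
        (E := fun p : M => TangentSpace I p →L[ℝ] TangentSpace I p) p (J p)) p := by
  rw [contMDiffAt_hom_bundle]
  refine ⟨contMDiffAt_id, contMDiffAt_clm_of_apply fun y => ?_⟩
  set e := trivializationAt E (TangentSpace I : M → Type _) p with he
  have hmem : ∀ᶠ q in nhds p, q ∈ e.baseSet :=
    e.open_baseSet.mem_nhds (FiberBundle.mem_baseSet_trivializationAt' p)
  have hZ : ContMDiffAt I I.tangent ∞
      (fun q => (⟨q, e.symmL ℝ q y⟩ : TangentBundle I M)) p := by
    rw [ModelWithCorners.tangent, Bundle.contMDiffAt_section]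
    refine (contMDiffAt_const (c := y)).congr_of_eventuallyEq ?_
    filter_upwards [hmem] with q hq
    have := e.continuousLinearMapAt_symmL (R := ℝ) hq y
    rwa [Bundle.Trivialization.continuousLinearMapAt_apply,
      Bundle.Trivialization.coe_linearMapAt_of_mem _ hq] at this
  have hJ := h _ hZ
  rw [ModelWithCorners.tangent, Bundle.contMDiffAt_section] at hJ
  refine hJ.congr_of_eventuallyEq ?_
  filter_upwards [hmem] with q hq
  change e.continuousLinearMapAt ℝ q (J q (e.symmL ℝ q y)) = _
  rw [Bundle.Trivialization.continuousLinearMapAt_apply,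
    Bundle.Trivialization.coe_linearMapAt_of_mem _ hq]

/-- The Lie bracket acts on functions as the commutator. The proof reduces this to the symmetry of the
second derivative in a chart. -/
theorem mvfderiv_mlieBracket [CompleteSpace E] {f : M → F} {p : M} {V W : ∀ q : M, TangentSpace I q}
    (hf : ContMDiffAt I 𝓘(ℝ, F) ∞ f p)
    (hV : ContMDiffAt I I.tangent ∞ (fun q => (⟨q, V q⟩ : TangentBundle I M)) p)
    (hW : ContMDiffAt I I.tangent ∞ (fun q => (⟨q, W q⟩ : TangentBundle I M)) p) :
    mvfderiv I f p (mlieBracket I V W p) =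
      mvfderiv I (fun q => mvfderiv I f q (W q)) p (V p) -
        mvfderiv I (fun q => mvfderiv I f q (V q)) p (W p) := by
  set φ := extChartAt I p with hφ
  set V' := mpullbackWithin 𝓘(ℝ, E) I φ.symm V (Set.range I) with hV'
  set W' := mpullbackWithin 𝓘(ℝ, E) I φ.symm W (Set.range I) with hW'
  have hf2 : ContDiffWithinAt ℝ ∞ (f ∘ φ.symm) (Set.range I) (φ p) := by
    have := (contMDiffAt_iff.1 hf).2
    simpa [hφ, Function.comp_def] using! this
  have hfe : ∀ᶠ q in nhds p, MDifferentiableAt I 𝓘(ℝ, F) f q := by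
    have h1 : ContMDiffAt I 𝓘(ℝ, F) 1 f p := hf.of_le (by simp)
    filter_upwards [(contMDiffAt_iff_contMDiffAt_nhds (by simp)).1 h1] with q hq
    exact hq.mdifferentiableAt (by simp)
  -- the derivative of `h` at `p` is the derivative of its expression in the chart
  have hchart : ∀ (h : M → F) (v : TangentSpace I p), MDifferentiableAt I 𝓘(ℝ, F) h p →
      mvfderiv I h p v = fderivWithin ℝ (h ∘ φ.symm) (Set.range I) (φ p) v := by
    intro h v hh
    rw [hh.mvfderiv]
    rfl
  have hinv : ∀ L : E →L[ℝ] E, L = ContinuousLinearMap.id ℝ E → ∀ v, L.inverse v = v := by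
    rintro _ rfl v
    rw [ContinuousLinearMap.inverse_id, ContinuousLinearMap.id_apply]
  have hpt : ∀ Z : ∀ q : M, TangentSpace I q,
      mpullbackWithin 𝓘(ℝ, E) I φ.symm Z (Set.range I) (φ p) = Z p := by
    intro Z
    have h2 : (mfderivWithin 𝓘(ℝ, E) I φ.symm (Set.range I) (φ p) : E →L[ℝ] E) =
        ContinuousLinearMap.id ℝ E := mfderivWithin_range_extChartAt_symm
    have h3 : ∀ q, q = p → (Z q : E) = Z p := by
      rintro _ rfl
      rfl
    exact (hinv _ h2 _).trans (h3 _ (extChartAt_to_inv p))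
  have hder : ∀ Z : ∀ q : M, TangentSpace I q,
      (fun q => mvfderiv I f q (Z q)) ∘ φ.symm =ᶠ[nhdsWithin (φ p) (Set.range I)]
        fun y => fderivWithin ℝ (f ∘ φ.symm) (Set.range I) y
          (mpullbackWithin 𝓘(ℝ, E) I φ.symm Z (Set.range I) y) := by
    intro Z
    have hc : Filter.Tendsto φ.symm (nhdsWithin (φ p) (Set.range I)) (nhds p) := by
      have := (continuousAt_extChartAt_symm (I := I) p).tendsto
      rw [extChartAt_to_inv] at this
      exact this.mono_left nhdsWithin_le_nhds
    filter_upwards [hc.eventually hfe, extChartAt_target_mem_nhdsWithin (I := I) p,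
      self_mem_nhdsWithin] with y hy hyt hyr
    have hd : MDifferentiableWithinAt 𝓘(ℝ, E) I φ.symm (Set.range I) y :=
      mdifferentiableWithinAt_extChartAt_symm hyt
    have hu : UniqueMDiffWithinAt 𝓘(ℝ, E) (Set.range I) y :=
      I.uniqueMDiffOn y hyr
    have h1 : fderivWithin ℝ (f ∘ φ.symm) (Set.range I) y =
        (mvfderiv I f (φ.symm y)).comp (mfderivWithin 𝓘(ℝ, E) I φ.symm (Set.range I) y) := by
      rw [← mfderivWithin_eq_fderivWithin]
      exact mfderiv_comp_mfderivWithin y hy hd hu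
    obtain ⟨L, hL⟩ := isInvertible_mfderivWithin_extChartAt_symm (I := I) hyt
    rw [h1, mpullbackWithin_apply]
    change mvfderiv I f (φ.symm y) (Z (φ.symm y)) = mvfderiv I f (φ.symm y)
      (mfderivWithin 𝓘(ℝ, E) I φ.symm (Set.range I) y
        ((mfderivWithin 𝓘(ℝ, E) I φ.symm (Set.range I) y).inverse (Z (φ.symm y))))
    rw [← hL, ContinuousLinearMap.inverse_equiv]
    exact congrArg _ (L.apply_symm_apply _).symm
  have hdd : ∀ Z : ∀ q : M, TangentSpace I q,
      ContMDiffAt I I.tangent ∞ (fun q => (⟨q, Z q⟩ : TangentBundle I M)) p →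
      ∀ v : TangentSpace I p, mvfderiv I (fun q => mvfderiv I f q (Z q)) p v =
        fderivWithin ℝ (fun y => fderivWithin ℝ (f ∘ φ.symm) (Set.range I) y
          (mpullbackWithin 𝓘(ℝ, E) I φ.symm Z (Set.range I) y)) (Set.range I) (φ p) v := by
    intro Z hZ v
    rw [hchart _ _ ((contMDiffAt_mvfderiv_apply hf hZ).mdifferentiableAt (by simp)),
      (hder Z).fderivWithin_eq_of_mem (Set.mem_range_self _)]
  have hdiff : ∀ Z : ∀ q : M, TangentSpace I q,
      ContMDiffAt I I.tangent ∞ (fun q => (⟨q, Z q⟩ : TangentBundle I M)) p →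
      DifferentiableWithinAt ℝ (mpullbackWithin 𝓘(ℝ, E) I φ.symm Z (Set.range I))
        (Set.range I) (φ p) := by
    intro Z hZ
    have := (hZ.mdifferentiableAt (by simp)).mdifferentiableWithinAt (s := Set.univ)
    simpa using! this.differentiableWithinAt_mpullbackWithin_vectorField
  have hbr : (mlieBracket I V W p : E) = lieBracketWithin ℝ V' W' (Set.range I) (φ p) := by
    have h1 : (mfderiv I 𝓘(ℝ, E) φ p : E →L[ℝ] E) = ContinuousLinearMap.id ℝ E :=
      mfderiv_extChartAt_self
    rw [← mlieBracketWithin_univ, mlieBracketWithin_apply]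
    refine (hinv _ h1 _).trans ?_
    rw [Set.preimage_univ, Set.univ_inter]
  rw [hdd W hW, hdd V hV, hchart _ _ (hf.mdifferentiableAt (by simp))]
  have key := fderivWithin_apply_lieBracket (V := V') (W := W') hf2
    (by rw [minSmoothness_of_isRCLikeNormedField]; exact WithTop.coe_le_coe.2 le_top) I.uniqueDiffOn
    (I.range_subset_closure_interior (Set.mem_range_self _)) (Set.mem_range_self _)
    (hdiff W hW) (hdiff V hV)
  rw [hbr, key, ← hpt V, ← hpt W]
end

/-! ### The differential of a bracket in a moving frame -/

section
open VectorField
variable {E : Type*} [NormedAddCommGroup E] [NormedSpace ℝ E]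
  {H : Type*} [TopologicalSpace H] {I : ModelWithCorners ℝ E H}
  {M : Type*} [TopologicalSpace M] [ChartedSpace H M]
  {F : Type*} [NormedAddCommGroup F] [NormedSpace ℝ F]
  {F' : Type*} [NormedAddCommGroup F'] [NormedSpace ℝ F']

theorem mvfderiv_comp_fderiv {h : M → F} {Φ : F → F'} {p : M}
    (hΦ : DifferentiableAt ℝ Φ (h p)) (hh : MDifferentiableAt I 𝓘(ℝ, F) h p)
    (v : TangentSpace I p) :
    mvfderiv I (fun q => Φ (h q)) p v = fderiv ℝ Φ (h p) (mvfderiv I h p v) := by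
  have h1 := mfderiv_comp_apply p hΦ.mdifferentiableAt hh v
  rw [mfderiv_eq_fderiv] at h1
  exact h1

theorem mvfderiv_clm_comp {h : M → F} (Φ : F →L[ℝ] F') {p : M}
    (hh : MDifferentiableAt I 𝓘(ℝ, F) h p) (v : TangentSpace I p) :
    mvfderiv I (fun q => Φ (h q)) p v = Φ (mvfderiv I h p v) := by
  rw [mvfderiv_comp_fderiv Φ.differentiableAt hh, Φ.fderiv]

theorem mvfderiv_sum {ι : Type} (s : Finset ι) {G : ι → M → F} {p : M}
    (hG : ∀ i, MDifferentiableAt I 𝓘(ℝ, F) (G i) p) (v : TangentSpace I p) :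
    mvfderiv I (fun q => ∑ i ∈ s, G i q) p v = ∑ i ∈ s, mvfderiv I (G i) p v := by
  classical
  induction s using Finset.induction_on with
  | empty =>
    simp only [Finset.sum_empty]
    rw [mvfderiv_const]
    rfl
  | insert i s hi ih =>
    simp only [Finset.sum_insert hi]
    rw [← ih]
    have h2 : MDifferentiableAt I 𝓘(ℝ, F) (fun q => ∑ i ∈ s, G i q) p := by
      have := MDifferentiableAt.sum (t := s) (f := G) (fun i _ => hG i)
      convert! this using 1
      ext q
      simp
    exact congrArg (fun L : TangentSpace I p →L[ℝ] F => L v) (mvfderiv_add (hG i) h2)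

theorem mvfderiv_smul_apply {a : M → ℝ} {G : M → F} {p : M}
    (ha : MDifferentiableAt I 𝓘(ℝ, ℝ) a p) (hG : MDifferentiableAt I 𝓘(ℝ, F) G p)
    (v : TangentSpace I p) :
    mvfderiv I (fun q => a q • G q) p v = mvfderiv I a p v • G p + a p • mvfderiv I G p v := by
  rw [mvfderiv_fun_smul ha hG, add_comm]
  rfl

theorem mvfderiv_add_apply {G G' : M → F} {p : M}
    (hG : MDifferentiableAt I 𝓘(ℝ, F) G p) (hG' : MDifferentiableAt I 𝓘(ℝ, F) G' p)
    (v : TangentSpace I p) :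
    mvfderiv I (fun q => G q + G' q) p v = mvfderiv I G p v + mvfderiv I G' p v :=
  congrArg (fun L : TangentSpace I p →L[ℝ] F => L v) (mvfderiv_add hG hG')

theorem mvfderiv_congr {G G' : M → F} {p : M} (h : G =ᶠ[nhds p] G') :
    mvfderiv I G p = mvfderiv I G' p := by
  ext v
  exact congrArg (fun L : TangentSpace I p →L[ℝ] F => L v) h.mfderiv_eq
end
/-- The terms with derivatives `D b c` of the frame (or connection) coefficients `x b` in the
antisymmetrization of a second derivative. -/
theorem sum_smul_sub_sum_smul {ι F : Type*} [Fintype ι] [AddCommGroup F] [Module ℝ F]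
    (s t v w : ι → ℝ) (x : ι → F) (D : ι → ι → F) :
    ∑ b, (s b • x b + w b • ∑ c, v c • D b c) - ∑ b, (t b • x b + v b • ∑ c, w c • D b c) =
      ∑ a, (s a - t a) • x a + ∑ c, ∑ b, (v c * w b) • (D b c - D c b) := by
  have h : ∑ b, w b • ∑ c, v c • D b c = ∑ c, ∑ b, (v c * w b) • D b c := by
    rw [Finset.sum_comm]
    simp only [Finset.smul_sum, smul_smul, mul_comm]
  have h' : ∑ b, v b • ∑ c, w c • D b c = ∑ c, ∑ b, (v c * w b) • D c b := by
    simp only [Finset.smul_sum, smul_smul]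
  simp only [Finset.sum_add_distrib, h, h', smul_sub, sub_smul, Finset.sum_sub_distrib]
  abel

/-- The action of a connection matrix on spinors as a bilinear map. -/
def spinActCLM : (Fin 4 → Fin 4 → ℝ) →L[ℝ] Spinor →L[ℝ] Spinor :=
  LinearMap.toContinuousLinearMap
    { toFun := fun w => matCLM (spinAct w)
      map_add' := fun v w => by rw [spinAct_add]; exact map_add matCLM _ _
      map_smul' := fun c w => by
        rw [spinAct_smul, RingHom.id_apply]
        exact map_smul matCLM c (spinAct w) }

section
open VectorField
variable {X : Type*} [TopologicalSpace X] [ChartedSpace (EuclideanSpace ℝ (Fin 4)) X]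
  [IsManifold (𝓡 4) ∞ X] {g : Metric X} {o : ∀ x : X, Orientation ℝ (TangentSpace (𝓡 4) x) (Fin 4)}
  {e : Frame X} {U : Set X}
  {E : Type*} [NormedAddCommGroup E] [NormedSpace ℝ E]
  {H : Type*} [TopologicalSpace H] {I : ModelWithCorners ℝ E H}
  {M : Type*} [TopologicalSpace M] [ChartedSpace H M]

theorem IsOrientedFrameOn.sum_inner_smul (he : IsOrientedFrameOn g o e U) {x : X} (hx : x ∈ U)
    (v : TangentSpace (𝓡 4) x) : ∑ a, g.inner x (e a x) v • e a x = v := by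
  obtain ⟨b, hb, -⟩ := he.oriented x hx
  have h : ∀ a, g.inner x (e a x) v = b.repr v a := by
    intro a
    conv_lhs => rw [← b.sum_repr v]
    simp only [map_sum, map_smul, hb, he.orthonormal x hx, smul_eq_mul]
    simp
  conv_rhs => rw [← b.sum_repr v]
  exact Finset.sum_congr rfl fun a _ => by rw [h, hb]

theorem IsOrientedFrameOn.contMDiffAt (he : IsOrientedFrameOn g o e U) {x : X} (hx : x ∈ U)
    (a : Fin 4) : ContMDiffAt (𝓡 4) (𝓡 4).tangent ∞
      (fun x => (⟨x, e a x⟩ : TangentBundle (𝓡 4) X)) x :=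
  (he.contMDiffOn a).contMDiffAt (he.isOpen.mem_nhds hx)

theorem contMDiffAt_inner {f : M → X} {p : M} {Y Z : ∀ q : M, TangentSpace (𝓡 4) (f q)}
    (hf : ContMDiffAt I (𝓡 4) ∞ f p)
    (hY : ContMDiffAt I (𝓡 4).tangent ∞ (fun q => (⟨f q, Y q⟩ : TangentBundle (𝓡 4) X)) p)
    (hZ : ContMDiffAt I (𝓡 4).tangent ∞ (fun q => (⟨f q, Z q⟩ : TangentBundle (𝓡 4) X)) p) :
    ContMDiffAt I 𝓘(ℝ, ℝ) ∞ (fun q => g.inner (f q) (Y q) (Z q)) p := by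
  have : ContMDiffAt I ((𝓡 4).prod 𝓘(ℝ)) ∞
      (fun m ↦ Bundle.TotalSpace.mk' ℝ (E := Bundle.Trivial X ℝ) (f m)
        (g.inner (f m) (Y m) (Z m))) p := by
    apply ContMDiffAt.clm_bundle_apply₂ (F₁ := EuclideanSpace ℝ (Fin 4))
      (F₂ := EuclideanSpace ℝ (Fin 4))
    · exact ContMDiffAt.comp p g.contMDiff.contMDiffAt hf
    · exact hY
    · exact hZ
  simp only [Bundle.contMDiffAt_totalSpace] at this
  exact this.2

theorem IsOrientedFrameOn.contMDiffAt_bracketCoeff (he : IsOrientedFrameOn g o e U) {x : X}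
    (hx : x ∈ U) (c b a : Fin 4) :
    ContMDiffAt (𝓡 4) 𝓘(ℝ, ℝ) ∞ (bracketCoeff g e c b a) x := by
  have : IsManifold (𝓡 4) (((⊤ : ℕ∞) : WithTop ℕ∞) + 1) X := ‹IsManifold (𝓡 4) ∞ X›
  have : IsManifold (𝓡 4) (minSmoothness ℝ 2) X := by
    rw [minSmoothness_of_isRCLikeNormedField]
    exact IsManifold.of_le (n := ∞) (WithTop.coe_le_coe.2 le_top)
  refine contMDiffAt_inner (f := id) contMDiffAt_id ?_ (he.contMDiffAt hx a)
  exact ContMDiffAt.mlieBracket_vectorField (n := ⊤) (m := ⊤) (he.contMDiffAt hx c)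
    (he.contMDiffAt hx b) (by rw [minSmoothness_of_isRCLikeNormedField]; exact le_rfl)

theorem IsOrientedFrameOn.contMDiffAt_lcCoeff (he : IsOrientedFrameOn g o e U) {x : X}
    (hx : x ∈ U) (c b a : Fin 4) :
    ContMDiffAt (𝓡 4) 𝓘(ℝ, ℝ) ∞ (lcCoeff g e c b a) x := by
  unfold lcCoeff
  exact contMDiffAt_const.mul (((he.contMDiffAt_bracketCoeff hx c b a).sub
    (he.contMDiffAt_bracketCoeff hx c a b)).sub (he.contMDiffAt_bracketCoeff hx b a c))

variable (g e) in
/-- The components in the frame `e` of the image of a tangent vector under `df`. -/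
def coframe (I : ModelWithCorners ℝ E H) (f : M → X) (q : M) (ξ : TangentSpace I q) :
    Fin 4 → ℝ := fun a =>
  g.inner (f q) (e a (f q)) (mfderiv I (𝓡 4) f q ξ)

theorem sum_coframe_smul (he : IsOrientedFrameOn g o e U) {f : M → X} {q : M} (hq : f q ∈ U)
    (ξ : TangentSpace I q) :
    ∑ a, coframe g e I f q ξ a • e a (f q) = mfderiv I (𝓡 4) f q ξ :=
  he.sum_inner_smul hq _

variable [IsManifold I ∞ M]

theorem contMDiffAt_coframe (he : IsOrientedFrameOn g o e U) {f : M → X} {p : M} (hp : f p ∈ U)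
    (hf : ContMDiffAt I (𝓡 4) ∞ f p) {V : ∀ q : M, TangentSpace I q}
    (hV : ContMDiffAt I I.tangent ∞ (fun q => (⟨q, V q⟩ : TangentBundle I M)) p) (a : Fin 4) :
    ContMDiffAt I 𝓘(ℝ, ℝ) ∞ (fun q => coframe g e I f q (V q) a) p :=
  contMDiffAt_inner hf ((he.contMDiffAt hp a).comp p hf) (contMDiffAt_mfderiv_apply hf hV)

/-- The Leibniz rule for a combination of functions pulled back from `X` whose coefficients are the
components of a vector field. -/
theorem mvfderiv_sum_coframe_smul (he : IsOrientedFrameOn g o e U) {f : M → X} {p : M}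
    (hp : f p ∈ U) (hf : ContMDiffAt I (𝓡 4) ∞ f p) {F : Type*} [NormedAddCommGroup F]
    [NormedSpace ℝ F] {G : Fin 4 → X → F} (hG : ∀ a, ContMDiffAt (𝓡 4) 𝓘(ℝ, F) ∞ (G a) (f p))
    {Z : ∀ q : M, TangentSpace I q}
    (hZ : ContMDiffAt I I.tangent ∞ (fun q => (⟨q, Z q⟩ : TangentBundle I M)) p)
    (v : TangentSpace I p) :
    mvfderiv I (fun q => ∑ b, coframe g e I f q (Z q) b • G b (f q)) p v =
      ∑ b, (mvfderiv I (fun q => coframe g e I f q (Z q) b) p v • G b (f p) +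
        coframe g e I f p (Z p) b •
          ∑ c, coframe g e I f p v c • mvfderiv (𝓡 4) (G b) (f p) (e c (f p))) := by
  have hfm : MDifferentiableAt I (𝓡 4) f p := hf.mdifferentiableAt (by simp)
  have hGf : ∀ b, MDifferentiableAt I 𝓘(ℝ, F) (fun q => G b (f q)) p := fun b =>
    ((hG b).comp p hf).mdifferentiableAt (by simp)
  have hc : ∀ b, MDifferentiableAt I 𝓘(ℝ, ℝ) (fun q => coframe g e I f q (Z q) b) p := fun b =>
    (contMDiffAt_coframe he hp hf hZ b).mdifferentiableAt (by simp)
  rw [mvfderiv_sum (G := fun b q => coframe g e I f q (Z q) b • G b (f q)) _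
    fun b => (hc b).smul (hGf b)]
  refine Finset.sum_congr rfl fun b _ => ?_
  rw [mvfderiv_smul_apply (hc b) (hGf b)]
  congr 2
  have h3 := mfderiv_comp_apply p ((hG b).mdifferentiableAt (by simp)) hfm v
  have h4 : mvfderiv I (fun q => G b (f q)) p v =
      mvfderiv (𝓡 4) (G b) (f p) (mfderiv I (𝓡 4) f p v) := h3
  rw [h4, ← sum_coframe_smul he hp v]
  simp only [map_sum, map_smul]

/-- The first structure equation, before taking components. -/
theorem mfderiv_mlieBracket [CompleteSpace E] (he : IsOrientedFrameOn g o e U) {f : M → X} {p : M}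
    (hp : f p ∈ U) (hf : ContMDiffAt I (𝓡 4) ∞ f p) {V W : ∀ q : M, TangentSpace I q}
    (hV : ContMDiffAt I I.tangent ∞ (fun q => (⟨q, V q⟩ : TangentBundle I M)) p)
    (hW : ContMDiffAt I I.tangent ∞ (fun q => (⟨q, W q⟩ : TangentBundle I M)) p) :
    mfderiv I (𝓡 4) f p (mlieBracket I V W p) =
      ∑ a, (mvfderiv I (fun q => coframe g e I f q (W q) a) p (V p) -
        mvfderiv I (fun q => coframe g e I f q (V q) a) p (W p)) • e a (f p) +
      ∑ c, ∑ b, (coframe g e I f p (V p) c * coframe g e I f p (W p) b) •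
        mlieBracket (𝓡 4) (e c) (e b) (f p) := by
  have hU : U ∈ nhds (f p) := he.isOpen.mem_nhds hp
  have hev : ∀ᶠ q in nhds p, f q ∈ U := hf.continuousAt.eventually hU
  set ψ : X → EuclideanSpace ℝ (Fin 4) := fun x => extChartAt (𝓡 4) (f p) x with hψ
  have hψs : ContMDiffAt (𝓡 4) 𝓘(ℝ, EuclideanSpace ℝ (Fin 4)) ∞ ψ (f p) := contMDiffAt_extChartAt
  have hψid : ∀ v : TangentSpace (𝓡 4) (f p), mvfderiv (𝓡 4) ψ (f p) v = v := by
    intro v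
    exact congrArg (fun L : EuclideanSpace ℝ (Fin 4) →L[ℝ] EuclideanSpace ℝ (Fin 4) => L v)
      (mfderiv_extChartAt_self (I := 𝓡 4) (x := f p))
  -- the components of the frame in the chart
  set ê : Fin 4 → X → EuclideanSpace ℝ (Fin 4) := fun a x => mvfderiv (𝓡 4) ψ x (e a x) with hê
  have hês : ∀ a, ContMDiffAt (𝓡 4) 𝓘(ℝ, EuclideanSpace ℝ (Fin 4)) ∞ (ê a) (f p) := fun a =>
    contMDiffAt_mvfderiv_apply hψs (he.contMDiffAt hp a)
  have hfm : MDifferentiableAt I (𝓡 4) f p := hf.mdifferentiableAt (by simp)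
  have hcomp : ∀ᶠ q in nhds p, ∀ ξ : TangentSpace I q,
      mvfderiv I (fun q => ψ (f q)) q ξ = ∑ a, coframe g e I f q ξ a • ê a (f q) := by
    have h1 : ∀ᶠ q in nhds p, ContMDiffAt I (𝓡 4) 1 f q :=
      (contMDiffAt_iff_contMDiffAt_nhds (by simp)).1 (hf.of_le (by simp))
    have h2 : ∀ᶠ x in nhds (f p), ContMDiffAt (𝓡 4) 𝓘(ℝ, EuclideanSpace ℝ (Fin 4)) 1 ψ x :=
      (contMDiffAt_iff_contMDiffAt_nhds (by simp)).1 (hψs.of_le (by simp))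
    filter_upwards [h1, hf.continuousAt.eventually h2, hev] with q hq1 hq2 hq3 ξ
    have h3 := mfderiv_comp_apply q (hq2.mdifferentiableAt (by simp))
      (hq1.mdifferentiableAt (by simp)) ξ
    have h4 : mvfderiv I (fun q => ψ (f q)) q ξ =
        mvfderiv (𝓡 4) ψ (f q) (mfderiv I (𝓡 4) f q ξ) := h3
    rw [h4, ← sum_coframe_smul he hq3 ξ]
    simp only [map_sum, map_smul, hê]
  have hD : ∀ {Z : ∀ q : M, TangentSpace I q},
      ContMDiffAt I I.tangent ∞ (fun q => (⟨q, Z q⟩ : TangentBundle I M)) p →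
      ∀ v : TangentSpace I p,
      mvfderiv I (fun q => mvfderiv I (fun q => ψ (f q)) q (Z q)) p v =
        ∑ b, (mvfderiv I (fun q => coframe g e I f q (Z q) b) p v • ê b (f p) +
          coframe g e I f p (Z p) b •
            ∑ c, coframe g e I f p v c • mvfderiv (𝓡 4) (ê b) (f p) (e c (f p))) := by
    intro Z hZ v
    rw [mvfderiv_congr (G' := fun q => ∑ a, coframe g e I f q (Z q) a • ê a (f q))
      (by filter_upwards [hcomp] with q hq using hq (Z q))]
    exact mvfderiv_sum_coframe_smul he hp hf hês hZ v
  have hb : ∀ c b, (mlieBracket (𝓡 4) (e c) (e b) (f p) : EuclideanSpace ℝ (Fin 4)) =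
      mvfderiv (𝓡 4) (ê b) (f p) (e c (f p)) - mvfderiv (𝓡 4) (ê c) (f p) (e b (f p)) :=
    fun c b => (hψid _).symm.trans
      (mvfderiv_mlieBracket hψs (he.contMDiffAt hp c) (he.contMDiffAt hp b))
  have hmain := mvfderiv_mlieBracket (f := fun q => ψ (f q)) (hψs.comp p hf) hV hW
  rw [hD hV, hD hW] at hmain
  have hlhs : mvfderiv I (fun q => ψ (f q)) p (mlieBracket I V W p) =
      mfderiv I (𝓡 4) f p (mlieBracket I V W p) := by
    refine Eq.trans ?_ (hψid _)
    exact mfderiv_comp_apply p (hψs.mdifferentiableAt (by simp)) hfm _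
  have hêe : ∀ a, ê a (f p) = e a (f p) := fun a => hψid _
  refine hlhs.symm.trans (hmain.trans ?_)
  simp only [hêe]
  refine (sum_smul_sub_sum_smul _ _ _ _ _ _).trans ?_
  simp only [← hb]
  rfl
end

/-! ### Covariant derivatives in components and the first structure equation -/

theorem quatEndo_add (s t : Fin 3 → ℝ) : quatEndo (s + t) = quatEndo s + quatEndo t := by
  ext a b
  fin_cases a <;> fin_cases b <;> simp [quatEndo] <;> ring

theorem quatEndo_smul (c : ℝ) (s : Fin 3 → ℝ) : quatEndo (c • s) = c • quatEndo s := by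
  ext a b
  fin_cases a <;> fin_cases b <;> simp [quatEndo]

theorem jVecDeriv_add (η δ δ' : Spinor) :
    jVecDeriv η (δ + δ') = jVecDeriv η δ + jVecDeriv η δ' := by
  ext k
  fin_cases k <;> simp [jVecDeriv, jPolar, normPolar] <;> ring

theorem differentiableAt_jVec {η : Spinor} (h : η ≠ 0) : DifferentiableAt ℝ jVec η :=
  differentiableAt_pi.2 fun k => (contDiffAt_jVec h k).differentiableAt (by simp)

theorem fderiv_jVec_apply {η : Spinor} (h : η ≠ 0) (δ : Spinor) :
    fderiv ℝ jVec η δ = jVecDeriv η δ := by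
  ext k
  rw [← fderiv_jVec h, fderiv_apply (differentiableAt_jVec h) k]
  rfl

/-- Right multiplication by imaginary quaternions as a bilinear map. -/
def quatEndoCLM : (Fin 3 → ℝ) →L[ℝ] (Fin 4 → ℝ) →L[ℝ] (Fin 4 → ℝ) :=
  LinearMap.toContinuousLinearMap
    { toFun := fun s => LinearMap.toContinuousLinearMap (quatEndo s).mulVecLin
      map_add' := fun s t => by
        ext v
        simp [quatEndo_add]
      map_smul' := fun c s => by
        ext v
        simp [quatEndo_smul] }

/-- The commutator of two `4 × 4` matrices. -/
def matComm (v w : Fin 4 → Fin 4 → ℝ) : Fin 4 → Fin 4 → ℝ := fun a b =>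
  ∑ k, (v a k * w k b - w a k * v k b)

theorem matComm_skew {v w : Fin 4 → Fin 4 → ℝ} (hv : ∀ a b, v a b = -v b a)
    (hw : ∀ a b, w a b = -w b a) (a b : Fin 4) : matComm v w a b = -matComm v w b a := by
  rw [matComm, matComm, ← Finset.sum_neg_distrib]
  refine Finset.sum_congr rfl fun k _ => ?_
  rw [hv a k, hw k b, hw a k, hv k b]
  ring

theorem selfDual_matComm {v w : Fin 4 → Fin 4 → ℝ} (hv : ∀ a b, v a b = -v b a)
    (hw : ∀ a b, w a b = -w b a) :
    selfDual (matComm v w) = -cross (selfDual v) (selfDual w) := by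
  have h0 : ∀ a, v a a = 0 := fun a => by linarith [hv a a]
  have h1 : ∀ a, w a a = 0 := fun a => by linarith [hw a a]
  ext k
  fin_cases k <;>
    simp [selfDual, cross, matComm, Fin.sum_univ_four, h0, h1, hv 1 0, hv 2 0,
      hv 2 1, hv 3 1, hv 3 2, hw 1 0, hw 2 0, hw 2 1, hw 3 1, hw 3 2] <;> ring

/-- `spinAct` is a homomorphism of Lie algebras on skew matrices. -/
theorem spinAct_matComm {v w : Fin 4 → Fin 4 → ℝ} (hv : ∀ a b, v a b = -v b a)
    (hw : ∀ a b, w a b = -w b a) (η : Spinor) :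
    spinAct (matComm v w) *ᵥ η
      = spinAct v *ᵥ (spinAct w *ᵥ η) - spinAct w *ᵥ (spinAct v *ᵥ η) := by
  rw [spinAct_eq (matComm_skew hv hw), spinAct_eq hv, spinAct_eq hw, selfDual_matComm hv hw]
  simp only [quat_transpose_mulVec]
  ext i
  fin_cases i <;> simp [cross] <;> ring_nf <;> simp <;> ring

section
variable {E : Type*} [NormedAddCommGroup E] [NormedSpace ℝ E]
  {H : Type*} [TopologicalSpace H] {I : ModelWithCorners ℝ E H}
  {M : Type*} [TopologicalSpace M] [ChartedSpace H M]
  {F : Type*} [NormedAddCommGroup F] [NormedSpace ℝ F]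
  {F' : Type*} [NormedAddCommGroup F'] [NormedSpace ℝ F']
  {G : Type*} [NormedAddCommGroup G] [NormedSpace ℝ G]

theorem mvfderiv_clm_apply₂ (B : F →L[ℝ] F' →L[ℝ] G) {h : M → F} {k : M → F'} {p : M}
    (hh : MDifferentiableAt I 𝓘(ℝ, F) h p) (hk : MDifferentiableAt I 𝓘(ℝ, F') k p)
    (v : TangentSpace I p) :
    mvfderiv I (fun q => B (h q) (k q)) p v =
      B (mvfderiv I h p v) (k p) + B (h p) (mvfderiv I k p v) := by
  have hhk : MDifferentiableAt I 𝓘(ℝ, F × F') (fun q => (h q, k q)) p := hh.prodMk_space hk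
  have h1 := mvfderiv_clm_comp (ContinuousLinearMap.fst ℝ F F') hhk v
  have h2 := mvfderiv_clm_comp (ContinuousLinearMap.snd ℝ F F') hhk v
  rw [mvfderiv_comp_fderiv (Φ := fun x : F × F' => B x.1 x.2)
    (B.isBoundedBilinearMap.differentiableAt _) hhk, B.isBoundedBilinearMap.fderiv]
  simp only [ContinuousLinearMap.coe_fst', ContinuousLinearMap.coe_snd'] at h1 h2
  rw [h1, h2, add_comm]
  rfl
end

section
open VectorField
variable {X : Type*} [TopologicalSpace X] [ChartedSpace (EuclideanSpace ℝ (Fin 4)) X]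
  [IsManifold (𝓡 4) ∞ X] {g : Metric X} {o : ∀ x : X, Orientation ℝ (TangentSpace (𝓡 4) x) (Fin 4)}
  {e : Frame X} {U : Set X}
  {E : Type*} [NormedAddCommGroup E] [NormedSpace ℝ E]
  {H : Type*} [TopologicalSpace H] {I : ModelWithCorners ℝ E H}
  {M : Type*} [TopologicalSpace M] [ChartedSpace H M]

variable (g e)

/-- The matrix `g(∇_{e_c} e_b, e_a)` with row index `a` and column index `b`. -/
def lcMat (x : X) (c : Fin 4) : Fin 4 → Fin 4 → ℝ := fun a b => lcCoeff g e c b a x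

variable (I) in
/-- The pull-back under `f` of the Levi-Civita connection form of the frame `e`. -/
def connForm (f : M → X) (q : M) (ξ : TangentSpace I q) : Fin 4 → Fin 4 → ℝ :=
  ∑ c, coframe g e I f q ξ c • lcMat g e (f q) c

variable (I) in
/-- The covariant derivative of a section of `f^* TX`, in components. -/
def nablaVec (f : M → X) (w : M → Fin 4 → ℝ) (q : M) (ξ : TangentSpace I q) : Fin 4 → ℝ :=
  mvfderiv I w q ξ + Matrix.of (connForm g e I f q ξ) *ᵥ w q

variable (I) in
/-- The covariant derivative of a section of the pull-back of `𝕊'` under `f`, in components. -/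
def nablaSpin (f : M → X) (δ : M → Spinor) (q : M) (ξ : TangentSpace I q) : Spinor :=
  mvfderiv I δ q ξ + spinAct (connForm g e I f q ξ) *ᵥ δ q

/-- The curvature form of the Levi-Civita connection. -/
def curvForm (x : X) (v w : Fin 4 → ℝ) : Fin 4 → Fin 4 → ℝ :=
  ∑ c, ∑ d, (v c * w d) • riem g e x c d

variable {g e}

theorem connForm_skew (f : M → X) (q : M) (ξ : TangentSpace I q) (a b : Fin 4) :
    connForm g e I f q ξ a b = -connForm g e I f q ξ b a := by
  simp only [connForm, Finset.sum_apply, Pi.smul_apply, smul_eq_mul, lcMat,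
    ← Finset.sum_neg_distrib]
  refine Finset.sum_congr rfl fun c _ => ?_
  rw [lcCoeff_skew]
  ring

theorem IsOrientedFrameOn.contMDiffAt_lcMat (he : IsOrientedFrameOn g o e U) {x : X}
    (hx : x ∈ U) (c : Fin 4) :
    ContMDiffAt (𝓡 4) 𝓘(ℝ, Fin 4 → Fin 4 → ℝ) ∞ (fun x => lcMat g e x c) x :=
  contMDiffAt_pi_space.2 fun a => contMDiffAt_pi_space.2 fun b => he.contMDiffAt_lcCoeff hx c b a

variable [IsManifold I ∞ M]

theorem contMDiffAt_coframe_vec (he : IsOrientedFrameOn g o e U) {f : M → X} {p : M}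
    (hp : f p ∈ U) (hf : ContMDiffAt I (𝓡 4) ∞ f p) {V : ∀ q : M, TangentSpace I q}
    (hV : ContMDiffAt I I.tangent ∞ (fun q => (⟨q, V q⟩ : TangentBundle I M)) p) :
    ContMDiffAt I 𝓘(ℝ, Fin 4 → ℝ) ∞ (fun q => coframe g e I f q (V q)) p :=
  contMDiffAt_pi_space.2 fun a => contMDiffAt_coframe he hp hf hV a

theorem contMDiffAt_connForm (he : IsOrientedFrameOn g o e U) {f : M → X} {p : M}
    (hp : f p ∈ U) (hf : ContMDiffAt I (𝓡 4) ∞ f p) {V : ∀ q : M, TangentSpace I q}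
    (hV : ContMDiffAt I I.tangent ∞ (fun q => (⟨q, V q⟩ : TangentBundle I M)) p) :
    ContMDiffAt I 𝓘(ℝ, Fin 4 → Fin 4 → ℝ) ∞ (fun q => connForm g e I f q (V q)) p := by
  unfold connForm
  have := fun c => (contMDiffAt_coframe he hp hf hV c).smul
    ((he.contMDiffAt_lcMat hp c).comp p hf)
  exact ContMDiffAt.sum fun c _ => this c

theorem contMDiffAt_nablaSpin (he : IsOrientedFrameOn g o e U) {f : M → X} {p : M}
    (hp : f p ∈ U) (hf : ContMDiffAt I (𝓡 4) ∞ f p) {η : M → Spinor}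
    (hη : ContMDiffAt I 𝓘(ℝ, Spinor) ∞ η p) {V : ∀ q : M, TangentSpace I q}
    (hV : ContMDiffAt I I.tangent ∞ (fun q => (⟨q, V q⟩ : TangentBundle I M)) p) :
    ContMDiffAt I 𝓘(ℝ, Spinor) ∞ (fun q => nablaSpin g e I f η q (V q)) p := by
  refine (contMDiffAt_mvfderiv_apply hη hV).add ?_
  exact (spinActCLM.contMDiff.contMDiffAt.comp p (contMDiffAt_connForm he hp hf hV)).clm_apply hη

theorem mvfderiv_coframe_apply (he : IsOrientedFrameOn g o e U) {f : M → X} {p : M}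
    (hp : f p ∈ U) (hf : ContMDiffAt I (𝓡 4) ∞ f p) {V : ∀ q : M, TangentSpace I q}
    (hV : ContMDiffAt I I.tangent ∞ (fun q => (⟨q, V q⟩ : TangentBundle I M)) p)
    (v : TangentSpace I p) (a : Fin 4) :
    mvfderiv I (fun q => coframe g e I f q (V q)) p v a =
      mvfderiv I (fun q => coframe g e I f q (V q) a) p v :=
  (mvfderiv_clm_comp (ContinuousLinearMap.proj a : (Fin 4 → ℝ) →L[ℝ] ℝ)
    ((contMDiffAt_coframe_vec he hp hf hV).mdifferentiableAt (by simp)) v).symm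

/-- The components of a bracket in terms of the structure functions of the frame. -/
theorem coframe_mlieBracket_apply [CompleteSpace E] (he : IsOrientedFrameOn g o e U) {f : M → X}
    {p : M} (hp : f p ∈ U) (hf : ContMDiffAt I (𝓡 4) ∞ f p) {V W : ∀ q : M, TangentSpace I q}
    (hV : ContMDiffAt I I.tangent ∞ (fun q => (⟨q, V q⟩ : TangentBundle I M)) p)
    (hW : ContMDiffAt I I.tangent ∞ (fun q => (⟨q, W q⟩ : TangentBundle I M)) p) (a : Fin 4) :
    coframe g e I f p (mlieBracket I V W p) a =
      mvfderiv I (fun q => coframe g e I f q (W q) a) p (V p) -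
        mvfderiv I (fun q => coframe g e I f q (V q) a) p (W p) +
      ∑ c, ∑ b, coframe g e I f p (V p) c * coframe g e I f p (W p) b *
        bracketCoeff g e c b a (f p) := by
  rw [coframe, mfderiv_mlieBracket he hp hf hV hW]
  have hbr : ∀ c b, g.inner (f p) (e a (f p)) (mlieBracket (𝓡 4) (e c) (e b) (f p)) =
      bracketCoeff g e c b a (f p) := fun c b => g.symm _ _ _
  simp only [map_add, map_sum, map_smul, he.orthonormal _ hp, smul_eq_mul, hbr]
  simp

/-- The first structure equation: the torsion vanishes. -/
theorem coframe_mlieBracket [CompleteSpace E] (he : IsOrientedFrameOn g o e U) {f : M → X} {p : M}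
    (hp : f p ∈ U) (hf : ContMDiffAt I (𝓡 4) ∞ f p) {V W : ∀ q : M, TangentSpace I q}
    (hV : ContMDiffAt I I.tangent ∞ (fun q => (⟨q, V q⟩ : TangentBundle I M)) p)
    (hW : ContMDiffAt I I.tangent ∞ (fun q => (⟨q, W q⟩ : TangentBundle I M)) p) :
    coframe g e I f p (mlieBracket I V W p) =
      nablaVec g e I f (fun q => coframe g e I f q (W q)) p (V p) -
        nablaVec g e I f (fun q => coframe g e I f q (V q)) p (W p) := by
  ext a
  simp only [nablaVec, Pi.sub_apply, Pi.add_apply, mvfderiv_coframe_apply he hp hf hV,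
    mvfderiv_coframe_apply he hp hf hW, coframe_mlieBracket_apply he hp hf hV hW]
  simp only [← lcCoeff_torsion, Matrix.mulVec, dotProduct, connForm, Matrix.of_apply,
    Finset.sum_apply, Pi.smul_apply, lcMat, smul_eq_mul, mul_sub, Finset.sum_sub_distrib,
    Finset.sum_mul]
  have h1 : ∑ c, ∑ b, coframe g e I f p (V p) c * coframe g e I f p (W p) b *
      lcCoeff g e c b a (f p) = ∑ b, ∑ c, coframe g e I f p (V p) c * lcCoeff g e c b a (f p) *
        coframe g e I f p (W p) b := by
    rw [Finset.sum_comm]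
    exact Finset.sum_congr rfl fun _ _ => Finset.sum_congr rfl fun _ _ => by ring
  have h2 : ∑ c, ∑ b, coframe g e I f p (V p) c * coframe g e I f p (W p) b *
      lcCoeff g e b c a (f p) = ∑ b, ∑ c, coframe g e I f p (W p) c * lcCoeff g e c b a (f p) *
        coframe g e I f p (V p) b :=
    Finset.sum_congr rfl fun _ _ => Finset.sum_congr rfl fun _ _ => by ring
  rw [h1, h2]
  ring

end

/-! ### The second structure equation and the Leibniz rules -/

section
open VectorField
variable {X : Type*} [TopologicalSpace X] [ChartedSpace (EuclideanSpace ℝ (Fin 4)) X]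
  [IsManifold (𝓡 4) ∞ X] {g : Metric X} {o : ∀ x : X, Orientation ℝ (TangentSpace (𝓡 4) x) (Fin 4)}
  {e : Frame X} {U : Set X}
  {E : Type*} [NormedAddCommGroup E] [NormedSpace ℝ E]
  {H : Type*} [TopologicalSpace H] {I : ModelWithCorners ℝ E H}
  {M : Type*} [TopologicalSpace M] [ChartedSpace H M]

theorem spinAct_sub (v w : Fin 4 → Fin 4 → ℝ) : spinAct (v - w) = spinAct v - spinAct w := by
  rw [eq_sub_iff_add_eq, ← spinAct_add, sub_add_cancel]

theorem IsOrientedFrameOn.mvfderiv_lcMat_apply (he : IsOrientedFrameOn g o e U) {x : X}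
    (hx : x ∈ U) (c : Fin 4) (v : TangentSpace (𝓡 4) x) (a b : Fin 4) :
    mvfderiv (𝓡 4) (fun x => lcMat g e x c) x v a b = dirDeriv (lcCoeff g e c b a) x v :=
  (mvfderiv_clm_comp ((ContinuousLinearMap.proj b : (Fin 4 → ℝ) →L[ℝ] ℝ) ∘L
    (ContinuousLinearMap.proj a : (Fin 4 → Fin 4 → ℝ) →L[ℝ] (Fin 4 → ℝ)))
    ((he.contMDiffAt_lcMat hx c).mdifferentiableAt (by simp)) v).symm

theorem matComm_sum_smul (v w : Fin 4 → ℝ) (m n : Fin 4 → Fin 4 → Fin 4 → ℝ) :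
    matComm (∑ c, v c • m c) (∑ d, w d • n d) = ∑ c, ∑ d, (v c * w d) • matComm (m c) (n d) := by
  ext a b
  simp only [matComm, Finset.sum_apply, Pi.smul_apply, smul_eq_mul]
  have h : ∀ k, (∑ c, v c * m c a k) * (∑ d, w d * n d k b) -
      (∑ d, w d * n d a k) * (∑ c, v c * m c k b) =
      ∑ c, ∑ d, v c * w d * (m c a k * n d k b - n d a k * m c k b) := by
    intro k
    rw [mul_comm (∑ d, w d * n d a k), Finset.sum_mul_sum, Finset.sum_mul_sum,
      ← Finset.sum_sub_distrib]
    refine Finset.sum_congr rfl fun c _ => ?_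
    rw [← Finset.sum_sub_distrib]
    exact Finset.sum_congr rfl fun d _ => by ring
  simp only [h]
  rw [Finset.sum_comm]
  refine Finset.sum_congr rfl fun c _ => ?_
  rw [Finset.sum_comm]
  exact Finset.sum_congr rfl fun d _ => (Finset.mul_sum _ _ _).symm

variable [IsManifold I ∞ M]

/-- The second structure equation. -/
theorem connForm_mlieBracket [CompleteSpace E] (he : IsOrientedFrameOn g o e U) {f : M → X} {p : M}
    (hp : f p ∈ U) (hf : ContMDiffAt I (𝓡 4) ∞ f p) {V W : ∀ q : M, TangentSpace I q}
    (hV : ContMDiffAt I I.tangent ∞ (fun q => (⟨q, V q⟩ : TangentBundle I M)) p)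
    (hW : ContMDiffAt I I.tangent ∞ (fun q => (⟨q, W q⟩ : TangentBundle I M)) p) :
    mvfderiv I (fun q => connForm g e I f q (W q)) p (V p) -
        mvfderiv I (fun q => connForm g e I f q (V q)) p (W p) +
        matComm (connForm g e I f p (V p)) (connForm g e I f p (W p)) =
      connForm g e I f p (mlieBracket I V W p) +
        curvForm g e (f p) (coframe g e I f p (V p)) (coframe g e I f p (W p)) := by
  have hD := fun {Z} hZ v => mvfderiv_sum_coframe_smul (I := I) (Z := Z) he hp hf
    (G := fun c x => lcMat g e x c) (fun c => he.contMDiffAt_lcMat hp c) hZ v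
  have h1 : mvfderiv I (fun q => connForm g e I f q (W q)) p (V p) -
      mvfderiv I (fun q => connForm g e I f q (V q)) p (W p) =
      ∑ a, (mvfderiv I (fun q => coframe g e I f q (W q) a) p (V p) -
        mvfderiv I (fun q => coframe g e I f q (V q) a) p (W p)) • lcMat g e (f p) a +
      ∑ c, ∑ b, (coframe g e I f p (V p) c * coframe g e I f p (W p) b) •
        (mvfderiv (𝓡 4) (fun x => lcMat g e x b) (f p) (e c (f p)) -
          mvfderiv (𝓡 4) (fun x => lcMat g e x c) (f p) (e b (f p))) := by
    unfold connForm
    rw [hD hW, hD hV]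
    exact sum_smul_sub_sum_smul _ _ _ _ _ _
  rw [h1]
  have h2 : connForm g e I f p (mlieBracket I V W p) =
      ∑ a, (mvfderiv I (fun q => coframe g e I f q (W q) a) p (V p) -
        mvfderiv I (fun q => coframe g e I f q (V q) a) p (W p)) • lcMat g e (f p) a +
      ∑ c, ∑ b, (coframe g e I f p (V p) c * coframe g e I f p (W p) b) •
        ∑ a, bracketCoeff g e c b a (f p) • lcMat g e (f p) a := by
    simp only [connForm, coframe_mlieBracket_apply he hp hf hV hW, add_smul,
      Finset.sum_add_distrib, Finset.sum_smul, Finset.smul_sum, smul_smul]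
    congr 1
    rw [Finset.sum_comm]
    exact Finset.sum_congr rfl fun c _ => Finset.sum_comm
  rw [h2, add_assoc, add_assoc]
  congr 1
  rw [connForm, connForm, matComm_sum_smul, curvForm]
  simp only [← Finset.sum_add_distrib, ← smul_add]
  refine Finset.sum_congr rfl fun c _ => Finset.sum_congr rfl fun d _ => ?_
  congr 1
  ext a b
  simp only [Pi.add_apply, Pi.sub_apply, he.mvfderiv_lcMat_apply hp, riem, matComm,
    Finset.sum_apply, Pi.smul_apply, lcMat, smul_eq_mul]
  have h3 : ∀ k, lcCoeff g e d b k (f p) * lcCoeff g e c k a (f p) -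
      lcCoeff g e c b k (f p) * lcCoeff g e d k a (f p) =
      lcCoeff g e c k a (f p) * lcCoeff g e d b k (f p) -
      lcCoeff g e d k a (f p) * lcCoeff g e c b k (f p) := fun k => by ring
  simp only [h3]
  ring

/-- The Ricci identity for spinors. -/
theorem nablaSpin_mlieBracket [CompleteSpace E] (he : IsOrientedFrameOn g o e U) {f : M → X} {p : M}
    (hp : f p ∈ U) (hf : ContMDiffAt I (𝓡 4) ∞ f p) {η : M → Spinor}
    (hη : ContMDiffAt I 𝓘(ℝ, Spinor) ∞ η p) {V W : ∀ q : M, TangentSpace I q}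
    (hV : ContMDiffAt I I.tangent ∞ (fun q => (⟨q, V q⟩ : TangentBundle I M)) p)
    (hW : ContMDiffAt I I.tangent ∞ (fun q => (⟨q, W q⟩ : TangentBundle I M)) p) :
    nablaSpin g e I f η p (mlieBracket I V W p) =
      nablaSpin g e I f (fun q => nablaSpin g e I f η q (W q)) p (V p) -
        nablaSpin g e I f (fun q => nablaSpin g e I f η q (V q)) p (W p) -
      spinAct (curvForm g e (f p) (coframe g e I f p (V p)) (coframe g e I f p (W p))) *ᵥ η p := by
  have hD : ∀ {Z : ∀ q : M, TangentSpace I q},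
      ContMDiffAt I I.tangent ∞ (fun q => (⟨q, Z q⟩ : TangentBundle I M)) p →
      ∀ v : TangentSpace I p, mvfderiv I (fun q => nablaSpin g e I f η q (Z q)) p v =
        mvfderiv I (fun q => mvfderiv I η q (Z q)) p v +
        (spinAct (mvfderiv I (fun q => connForm g e I f q (Z q)) p v) *ᵥ η p +
          spinAct (connForm g e I f p (Z p)) *ᵥ mvfderiv I η p v) := by
    intro Z hZ v
    have h1 := (contMDiffAt_connForm he hp hf hZ).mdifferentiableAt (by simp)
    have h2 := hη.mdifferentiableAt (by simp)
    have h3 : ContMDiffAt I 𝓘(ℝ, Spinor) ∞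
        (fun q => spinActCLM (connForm g e I f q (Z q)) (η q)) p :=
      (spinActCLM.contMDiff.contMDiffAt.comp p (contMDiffAt_connForm he hp hf hZ)).clm_apply hη
    refine (mvfderiv_add_apply ((contMDiffAt_mvfderiv_apply hη hZ).mdifferentiableAt (by simp))
      (h3.mdifferentiableAt (by simp)) v).trans ?_
    congr 1
    exact mvfderiv_clm_apply₂ spinActCLM h1 h2 v
  have hs := congrArg (fun w => spinAct w *ᵥ η p) (connForm_mlieBracket he hp hf hV hW)
  simp only [spinAct_add, spinAct_sub, Matrix.add_mulVec, Matrix.sub_mulVec,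
    spinAct_matComm (connForm_skew f p _) (connForm_skew f p _)] at hs
  have hn : ∀ (δ : M → Spinor) (v : TangentSpace I p), nablaSpin g e I f δ p v =
    mvfderiv I δ p v + spinAct (connForm g e I f p v) *ᵥ δ p := fun _ _ => rfl
  rw [hn η, hn fun q => nablaSpin g e I f η q (W q), hn fun q => nablaSpin g e I f η q (V q),
    hD hV, hD hW, mvfderiv_mlieBracket hη hV hW, hn, hn]
  simp only [Matrix.mulVec_add]
  have hs' := eq_sub_of_add_eq hs.symm
  rw [hs']
  abel

end

section
variable {X : Type*} [TopologicalSpace X] [ChartedSpace (EuclideanSpace ℝ (Fin 4)) X]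
  [IsManifold (𝓡 4) ∞ X] {g : Metric X}
  {e : Frame X}
  {E : Type*} [NormedAddCommGroup E] [NormedSpace ℝ E]
  {H : Type*} [TopologicalSpace H] {I : ModelWithCorners ℝ E H}
  {M : Type*} [TopologicalSpace M] [ChartedSpace H M]

/-- `σ` is parallel. -/
theorem nablaSpin_sigma {f : M → X} {δ : M → Spinor} {p : M}
    (hδ : MDifferentiableAt I 𝓘(ℝ, Spinor) δ p) (v : TangentSpace I p) :
    nablaSpin g e I f (fun q => sigma (δ q)) p v = sigma (nablaSpin g e I f δ p v) := by
  rw [nablaSpin, nablaSpin, mvfderiv_clm_comp sigma hδ, map_add,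
    sigma_spinAct (connForm_skew f p v)]

theorem mvfderiv_jVec_comp {η : M → Spinor} {p : M} (h0 : η p ≠ 0)
    (hη : MDifferentiableAt I 𝓘(ℝ, Spinor) η p) (v : TangentSpace I p) :
    mvfderiv I (fun q => jVec (η q)) p v = jVecDeriv (η p) (mvfderiv I η p v) := by
  rw [mvfderiv_comp_fderiv (differentiableAt_jVec h0) hη, fderiv_jVec_apply h0]

/-- The Leibniz rule for `J`: as `J_η` depends equivariantly on `η`, its covariant derivative is
its derivative in the direction of the covariant derivative of `η`. -/
theorem nablaVec_jEndo {f : M → X} {η : M → Spinor} {w : M → Fin 4 → ℝ} {p : M} (h0 : η p ≠ 0)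
    (hη : MDifferentiableAt I 𝓘(ℝ, Spinor) η p) (hw : MDifferentiableAt I 𝓘(ℝ, Fin 4 → ℝ) w p)
    (v : TangentSpace I p) :
    nablaVec g e I f (fun q => jEndo (η q) *ᵥ w q) p v =
      jEndo (η p) *ᵥ nablaVec g e I f w p v +
        quatEndo (jVecDeriv (η p) (nablaSpin g e I f η p v)) *ᵥ w p := by
  have h1 : MDifferentiableAt I 𝓘(ℝ, Fin 3 → ℝ) (fun q => jVec (η q)) p :=
    (differentiableAt_jVec h0).mdifferentiableAt.comp p hη
  have h2 : mvfderiv I (fun q => jEndo (η q) *ᵥ w q) p v =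
      quatEndo (jVecDeriv (η p) (mvfderiv I η p v)) *ᵥ w p +
        jEndo (η p) *ᵥ mvfderiv I w p v := by
    rw [← mvfderiv_jVec_comp h0 hη]
    exact mvfderiv_clm_apply₂ quatEndoCLM h1 hw v
  rw [nablaVec, nablaVec, nablaSpin, h2, jVecDeriv_add, quatEndo_add,
    jVecDeriv_spinAct (connForm_skew f p v) h0]
  simp only [Matrix.add_mulVec, Matrix.sub_mulVec, Matrix.mulVec_add, Matrix.mulVec_mulVec]
  abel

end

/-! ### The Nijenhuis expression in components -/

section
variable {X : Type*} [TopologicalSpace X] [ChartedSpace (EuclideanSpace ℝ (Fin 4)) X]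
  [IsManifold (𝓡 4) ∞ X] {g : Metric X} {e : Frame X}
  {E : Type*} [NormedAddCommGroup E] [NormedSpace ℝ E]
  {H : Type*} [TopologicalSpace H] {I : ModelWithCorners ℝ E H}
  {M : Type*} [TopologicalSpace M] [ChartedSpace H M]

theorem coframe_add (f : M → X) (q : M) (ξ ζ : TangentSpace I q) :
    coframe g e I f q (ξ + ζ) = coframe g e I f q ξ + coframe g e I f q ζ := by
  ext a
  simp [coframe]

theorem coframe_sub (f : M → X) (q : M) (ξ ζ : TangentSpace I q) :
    coframe g e I f q (ξ - ζ) = coframe g e I f q ξ - coframe g e I f q ζ := by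
  rw [eq_sub_iff_add_eq, ← coframe_add, sub_add_cancel]

theorem nablaSpin_add (f : M → X) (η : M → Spinor) (q : M) (ξ ζ : TangentSpace I q) :
    nablaSpin g e I f η q (ξ + ζ) = nablaSpin g e I f η q ξ + nablaSpin g e I f η q ζ := by
  simp only [nablaSpin, connForm, coframe_add, Pi.add_apply, add_smul, Finset.sum_add_distrib,
    spinAct_add, Matrix.add_mulVec, map_add]
  abel

theorem nablaSpin_sub (f : M → X) (η : M → Spinor) (q : M) (ξ ζ : TangentSpace I q) :
    nablaSpin g e I f η q (ξ - ζ) = nablaSpin g e I f η q ξ - nablaSpin g e I f η q ζ := by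
  rw [eq_sub_iff_add_eq, ← nablaSpin_add, sub_add_cancel]

theorem nablaVec_congr {f : M → X} {w w' : M → Fin 4 → ℝ} {q : M} (h : w =ᶠ[nhds q] w') :
    nablaVec g e I f w q = nablaVec g e I f w' q := by
  ext1 ξ
  rw [nablaVec, nablaVec, mvfderiv_congr h, h.eq_of_nhds]

theorem nablaSpin_congr {f : M → X} {δ δ' : M → Spinor} {q : M} (h : δ =ᶠ[nhds q] δ') :
    nablaSpin g e I f δ q = nablaSpin g e I f δ' q := by
  ext1 ξ
  rw [nablaSpin, nablaSpin, mvfderiv_congr h, h.eq_of_nhds]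

/-- For an anti-self-dual Einstein metric, the `(0,2)`-part of the curvature of `𝕊'` annihilates the
tautological section. -/
theorem spinAct_curvForm_type {x : X} (hW : ∀ a b c d, weylPlus g e x a b c d = 0)
    (hE : ∀ a b, ricci g e x a b = scalarCurv g e x / 4 * kron a b) {η : Spinor} (h : η ≠ 0)
    (v w : Fin 4 → ℝ) :
    spinAct (curvForm g e x v w) *ᵥ η + sigma (spinAct (curvForm g e x (jEndo η *ᵥ v) w) *ᵥ η +
      spinAct (curvForm g e x v (jEndo η *ᵥ w)) *ᵥ η) -
      spinAct (curvForm g e x (jEndo η *ᵥ v) (jEndo η *ᵥ w)) *ᵥ η = 0 := by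
  have hc : ∀ v w, spinAct (curvForm g e x v w) *ᵥ η =
      (2 * capLambda g e x) • (spinAct (wedge v w) *ᵥ η) := by
    intro v w
    simp only [curvForm, spinAct_sum, spinAct_smul, sum_spinAct_riem g hW hE, Matrix.smul_mulVec]
    exact (Complex.coe_smul _ _)
  simp only [hc, ← smul_add, map_smul, ← smul_sub, curvature_type h, smul_zero]

end

section
open VectorField
variable {X : Type*} [TopologicalSpace X] [ChartedSpace (EuclideanSpace ℝ (Fin 4)) X]
  [IsManifold (𝓡 4) ∞ X] {g : Metric X} {o : ∀ x : X, Orientation ℝ (TangentSpace (𝓡 4) x) (Fin 4)}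
  {e : Frame X} {U : Set X}
  {E : Type*} [NormedAddCommGroup E] [NormedSpace ℝ E] [CompleteSpace E]
  {H : Type*} [TopologicalSpace H] {I : ModelWithCorners ℝ E H}
  {M : Type*} [TopologicalSpace M] [ChartedSpace H M] [IsManifold I ∞ M]
  {f : M → X} {η : M → Spinor} {p : M} {J : ∀ q : M, TangentSpace I q →L[ℝ] TangentSpace I q}
  {V W : ∀ q : M, TangentSpace I q}

/-- The horizontal part of the Nijenhuis expression vanishes because the derivative of `J_η` in the
direction `σδ` is the composition of `J_η` with its derivative in the direction `δ`. -/
theorem coframe_nijenhuis (he : IsOrientedFrameOn g o e U)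
    (hp : f p ∈ U) (hf : ContMDiffAt I (𝓡 4) ∞ f p)
    (hη : ContMDiffAt I 𝓘(ℝ, Spinor) ∞ η p) (h0 : η p ≠ 0)
    (hJ : ∀ᶠ q in nhds p, ∀ ξ, coframe g e I f q (J q ξ) = jEndo (η q) *ᵥ coframe g e I f q ξ)
    (hJ' : ∀ ξ, nablaSpin g e I f η p (J p ξ) = sigma (nablaSpin g e I f η p ξ))
    (hV : ContMDiffAt I I.tangent ∞ (fun q => (⟨q, V q⟩ : TangentBundle I M)) p)
    (hW : ContMDiffAt I I.tangent ∞ (fun q => (⟨q, W q⟩ : TangentBundle I M)) p)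
    (hJV : ContMDiffAt I I.tangent ∞ (fun q => (⟨q, J q (V q)⟩ : TangentBundle I M)) p)
    (hJW : ContMDiffAt I I.tangent ∞ (fun q => (⟨q, J q (W q)⟩ : TangentBundle I M)) p) :
    coframe g e I f p (nijenhuis I J V W p) = 0 := by
  have hηd := hη.mdifferentiableAt (by simp)
  have hJp := hJ.self_of_nhds
  have hK : ∀ {Z : ∀ q : M, TangentSpace I q},
      ContMDiffAt I I.tangent ∞ (fun q => (⟨q, Z q⟩ : TangentBundle I M)) p →
      ∀ ξ, nablaVec g e I f (fun q => coframe g e I f q (J q (Z q))) p ξ =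
        jEndo (η p) *ᵥ nablaVec g e I f (fun q => coframe g e I f q (Z q)) p ξ +
        quatEndo (jVecDeriv (η p) (nablaSpin g e I f η p ξ)) *ᵥ coframe g e I f p (Z p) := by
    intro Z hZ ξ
    rw [nablaVec_congr (w' := fun q => jEndo (η q) *ᵥ coframe g e I f q (Z q))
      (by filter_upwards [hJ] with q hq using hq _)]
    exact nablaVec_jEndo h0 hηd
      ((contMDiffAt_coframe_vec he hp hf hZ).mdifferentiableAt (by simp)) ξ
  rw [nijenhuis, coframe_sub, coframe_add, hJp, coframe_add, coframe_mlieBracket he hp hf hV hW,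
    coframe_mlieBracket he hp hf hJV hW, coframe_mlieBracket he hp hf hV hJW,
    coframe_mlieBracket he hp hf hJV hJW, hK hV, hK hW, hK hV, hK hW, hJ', hJ']
  simp only [Matrix.mulVec_add, Matrix.mulVec_sub, Matrix.mulVec_mulVec, jEndo_mul_jEndo h0,
    jEndo_mul_deriv h0, Matrix.neg_mulVec, Matrix.one_mulVec]
  abel

/-- The vertical part of the Nijenhuis expression vanishes because the curvature of `𝕊'` has no
`(0,2)`-part on the tautological section. -/
theorem nablaSpin_nijenhuis (he : IsOrientedFrameOn g o e U)
    (hp : f p ∈ U) (hf : ContMDiffAt I (𝓡 4) ∞ f p)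
    (hη : ContMDiffAt I 𝓘(ℝ, Spinor) ∞ η p) (h0 : η p ≠ 0)
    (hASD : ∀ a b c d, weylPlus g e (f p) a b c d = 0)
    (hE : ∀ a b, ricci g e (f p) a b = scalarCurv g e (f p) / 4 * kron a b)
    (hJ : ∀ ξ, coframe g e I f p (J p ξ) = jEndo (η p) *ᵥ coframe g e I f p ξ)
    (hJ' : ∀ᶠ q in nhds p, ∀ ξ, nablaSpin g e I f η q (J q ξ) = sigma (nablaSpin g e I f η q ξ))
    (hV : ContMDiffAt I I.tangent ∞ (fun q => (⟨q, V q⟩ : TangentBundle I M)) p)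
    (hW : ContMDiffAt I I.tangent ∞ (fun q => (⟨q, W q⟩ : TangentBundle I M)) p)
    (hJV : ContMDiffAt I I.tangent ∞ (fun q => (⟨q, J q (V q)⟩ : TangentBundle I M)) p)
    (hJW : ContMDiffAt I I.tangent ∞ (fun q => (⟨q, J q (W q)⟩ : TangentBundle I M)) p) :
    nablaSpin g e I f η p (nijenhuis I J V W p) = 0 := by
  have hJp := hJ'.self_of_nhds
  have hK : ∀ {Z : ∀ q : M, TangentSpace I q},
      ContMDiffAt I I.tangent ∞ (fun q => (⟨q, Z q⟩ : TangentBundle I M)) p →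
      ∀ ξ, nablaSpin g e I f (fun q => nablaSpin g e I f η q (J q (Z q))) p ξ =
        sigma (nablaSpin g e I f (fun q => nablaSpin g e I f η q (Z q)) p ξ) := by
    intro Z hZ ξ
    rw [nablaSpin_congr (δ' := fun q => sigma (nablaSpin g e I f η q (Z q)))
      (by filter_upwards [hJ'] with q hq using hq _)]
    exact nablaSpin_sigma ((contMDiffAt_nablaSpin he hp hf hη hZ).mdifferentiableAt (by simp)) ξ
  rw [nijenhuis, nablaSpin_sub, nablaSpin_add, hJp, nablaSpin_add,
    nablaSpin_mlieBracket he hp hf hη hV hW,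
    nablaSpin_mlieBracket he hp hf hη hJV hW, nablaSpin_mlieBracket he hp hf hη hV hJW,
    nablaSpin_mlieBracket he hp hf hη hJV hJW, hK hV, hK hW, hK hV, hK hW, hJ, hJ]
  have hc := spinAct_curvForm_type hASD hE h0 (coframe g e I f p (V p)) (coframe g e I f p (W p))
  rw [← neg_eq_zero] at hc
  rw [← hc]
  simp only [map_add, map_sub, sigma_sigma]
  abel

end

/-! ### The change of the Levi-Civita connection under rotations of the frame -/

section
variable {E : Type*} [NormedAddCommGroup E] [NormedSpace ℝ E]
  {H : Type*} [TopologicalSpace H] {I : ModelWithCorners ℝ E H}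
  {M : Type*} [TopologicalSpace M] [ChartedSpace H M] {p : M}

variable (I) in
/-- The derivative of an `SU(2)`-valued function, as a matrix. -/
def su2Deriv (U : M → SU2) (p : M) (v : TangentSpace I p) : Matrix (Fin 2) (Fin 2) ℂ :=
  Matrix.of fun r s => mvfderiv I (fun q => (U q : Matrix (Fin 2) (Fin 2) ℂ) r s) p v

theorem isQuaternion_su2Deriv {U : M → SU2}
    (hU : ∀ r s, ContMDiffAt I 𝓘(ℝ, ℂ) ∞ (fun q => (U q : Matrix (Fin 2) (Fin 2) ℂ) r s) p)
    (v : TangentSpace I p) : IsQuaternion (su2Deriv I U p v) := by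
  constructor
  · refine Eq.trans ?_ (mvfderiv_clm_comp (Complex.conjCLE : ℂ →L[ℝ] ℂ) ((hU 0 0).mdifferentiableAt (by simp)) v)
    have h : (fun q => (U q : Matrix (Fin 2) (Fin 2) ℂ) 1 1) =
        fun q => (Complex.conjCLE : ℂ →L[ℝ] ℂ) ((U q : Matrix (Fin 2) (Fin 2) ℂ) 0 0) :=
      funext fun q => (SU2.isQuaternion (U q)).1
    exact congrArg (fun F : M → ℂ => mvfderiv I F p v) h
  · refine Eq.trans ?_ (mvfderiv_clm_comp (-(Complex.conjCLE : ℂ →L[ℝ] ℂ)) ((hU 0 1).mdifferentiableAt (by simp)) v)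
    have h : (fun q => (U q : Matrix (Fin 2) (Fin 2) ℂ) 1 0) =
        fun q => (-(Complex.conjCLE : ℂ →L[ℝ] ℂ)) ((U q : Matrix (Fin 2) (Fin 2) ℂ) 0 1) :=
      funext fun q => (SU2.isQuaternion (U q)).2
    exact congrArg (fun F : M → ℂ => mvfderiv I F p v) h

/-- The Maurer–Cartan form of `SU(2)` is anti-Hermitian. -/
theorem su2Deriv_conjTranspose_mul {U : M → SU2}
    (hU : ∀ r s, ContMDiffAt I 𝓘(ℝ, ℂ) ∞ (fun q => (U q : Matrix (Fin 2) (Fin 2) ℂ) r s) p)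
    (v : TangentSpace I p) :
    (su2Deriv I U p v)ᴴ * (U p : Matrix (Fin 2) (Fin 2) ℂ) =
      -((U p : Matrix (Fin 2) (Fin 2) ℂ)ᴴ * su2Deriv I U p v) := by
  ext r s
  let B : ℂ →L[ℝ] ℂ →L[ℝ] ℂ := (ContinuousLinearMap.mul ℝ ℂ) ∘L (Complex.conjCLE : ℂ →L[ℝ] ℂ)
  have h1 : ∀ q, ∑ k, B ((U q : Matrix (Fin 2) (Fin 2) ℂ) k r)
      ((U q : Matrix (Fin 2) (Fin 2) ℂ) k s) = (1 : Matrix (Fin 2) (Fin 2) ℂ) r s := fun q => by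
    rw [← SU2.conjTranspose_mul_self (U q)]
    rfl
  have hU' : ∀ r s, MDifferentiableAt I 𝓘(ℝ, ℂ)
      (fun q => (U q : Matrix (Fin 2) (Fin 2) ℂ) r s) p := fun r s =>
    (hU r s).mdifferentiableAt (by simp)
  have hd : ∀ k, MDifferentiableAt I 𝓘(ℝ, ℂ) (fun q => B ((U q : Matrix (Fin 2) (Fin 2) ℂ) k r)
      ((U q : Matrix (Fin 2) (Fin 2) ℂ) k s)) p := fun k =>
    (B.isBoundedBilinearMap.differentiableAt _).mdifferentiableAt.comp p
      ((hU' k r).prodMk_space (hU' k s))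
  have h2 := mvfderiv_sum Finset.univ hd v
  simp only [h1] at h2
  rw [mvfderiv_const] at h2
  simp only [mvfderiv_clm_apply₂ B (hU' _ _) (hU' _ _)] at h2
  rw [Finset.sum_add_distrib] at h2
  exact eq_neg_of_add_eq_zero_left h2.symm

theorem IsQuaternion.trace_eq_zero {Y : Matrix (Fin 2) (Fin 2) ℂ} (hY : IsQuaternion Y)
    (h : Yᴴ = -Y) : Y.trace = 0 := by
  have h0 : star (Y 0 0) = -Y 0 0 := congrFun (congrFun h 0) 0
  rw [Matrix.trace_fin_two, hY.1, h0, add_neg_cancel]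

theorem contMDiffAt_matrix {U : M → SU2}
    (hU : ∀ r s, ContMDiffAt I 𝓘(ℝ, ℂ) ∞ (fun q => (U q : Matrix (Fin 2) (Fin 2) ℂ) r s) p) :
    ContMDiffAt I 𝓘(ℝ, Fin 2 → Fin 2 → ℂ) ∞
      (fun q => (fun r s => (U q : Matrix (Fin 2) (Fin 2) ℂ) r s)) p :=
  contMDiffAt_pi_space.2 fun r => contMDiffAt_pi_space.2 fun s => hU r s

theorem mvfderiv_matrix_apply {U : M → SU2}
    (hU : ∀ r s, ContMDiffAt I 𝓘(ℝ, ℂ) ∞ (fun q => (U q : Matrix (Fin 2) (Fin 2) ℂ) r s) p)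
    (v : TangentSpace I p) :
    mvfderiv I (fun q => (fun r s => (U q : Matrix (Fin 2) (Fin 2) ℂ) r s)) p v =
      fun r s => su2Deriv I U p v r s := by
  have h : MDifferentiableAt I 𝓘(ℝ, Fin 2 → Fin 2 → ℂ)
      (fun q => (fun r s => (U q : Matrix (Fin 2) (Fin 2) ℂ) r s)) p :=
    (contMDiffAt_matrix hU).mdifferentiableAt (by simp)
  ext r s
  exact (mvfderiv_clm_comp ((ContinuousLinearMap.proj s : (Fin 2 → ℂ) →L[ℝ] ℂ) ∘L
    (ContinuousLinearMap.proj r : (Fin 2 → Fin 2 → ℂ) →L[ℝ] (Fin 2 → ℂ))) h v).symm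

/-- `spinRot` as a bilinear map. -/
def spinRotCLM (k b : Fin 4) :
    (Fin 2 → Fin 2 → ℂ) →L[ℝ] (Fin 2 → Fin 2 → ℂ) →L[ℝ] ℝ :=
  (LinearMap.mk₂ ℝ (fun A B => spinRot (Matrix.of A) (Matrix.of B) k b)
    (fun A A' B => by
      rw [← Matrix.of_add_of, spinRot, Matrix.add_mul, Matrix.add_mul, mCoord_add]
      rfl)
    (fun c A B => by
      rw [← Matrix.smul_of, ← Complex.coe_smul, spinRot, Matrix.smul_mul, Matrix.smul_mul,
        mCoord_smul]
      rfl)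
    (fun A B B' => by
      rw [← Matrix.of_add_of, spinRot, Matrix.conjTranspose_add, Matrix.mul_add, mCoord_add]
      rfl)
    (fun c A B => by
      rw [← Matrix.smul_of, ← Complex.coe_smul, spinRot, Matrix.conjTranspose_smul,
        Complex.star_def, Complex.conj_ofReal, Matrix.mul_smul, mCoord_smul]
      rfl)).toContinuousBilinearMap

theorem contMDiffAt_spinRot {A B : M → SU2}
    (hA : ∀ r s, ContMDiffAt I 𝓘(ℝ, ℂ) ∞ (fun q => (A q : Matrix (Fin 2) (Fin 2) ℂ) r s) p)
    (hB : ∀ r s, ContMDiffAt I 𝓘(ℝ, ℂ) ∞ (fun q => (B q : Matrix (Fin 2) (Fin 2) ℂ) r s) p)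
    (k b : Fin 4) : ContMDiffAt I 𝓘(ℝ, ℝ) ∞ (fun q => spinRot (A q) (B q) k b) p :=
  (((spinRotCLM k b).contMDiff.contMDiffAt.comp p (contMDiffAt_matrix hA)).clm_apply
    (contMDiffAt_matrix hB))

theorem mvfderiv_spinRot {A B : M → SU2}
    (hA : ∀ r s, ContMDiffAt I 𝓘(ℝ, ℂ) ∞ (fun q => (A q : Matrix (Fin 2) (Fin 2) ℂ) r s) p)
    (hB : ∀ r s, ContMDiffAt I 𝓘(ℝ, ℂ) ∞ (fun q => (B q : Matrix (Fin 2) (Fin 2) ℂ) r s) p)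
    (k b : Fin 4) (v : TangentSpace I p) :
    mvfderiv I (fun q => spinRot (A q) (B q) k b) p v =
      mCoord k (su2Deriv I A p v * mBasis b * (B p : Matrix (Fin 2) (Fin 2) ℂ)ᴴ +
        (A p : Matrix (Fin 2) (Fin 2) ℂ) * mBasis b * (su2Deriv I B p v)ᴴ) := by
  rw [mCoord_add]
  have h := mvfderiv_clm_apply₂ (spinRotCLM k b)
    ((contMDiffAt_matrix hA).mdifferentiableAt (by simp))
    ((contMDiffAt_matrix hB).mdifferentiableAt (by simp)) v
  rw [mvfderiv_matrix_apply hA, mvfderiv_matrix_apply hB] at h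
  exact h

end

section
open VectorField
variable {X : Type*} [TopologicalSpace X] [ChartedSpace (EuclideanSpace ℝ (Fin 4)) X]
  [IsManifold (𝓡 4) ∞ X] {g : Metric X} {o : ∀ x : X, Orientation ℝ (TangentSpace (𝓡 4) x) (Fin 4)}
  {e e' : Frame X} {U U' : Set X} {x : X}

theorem coframe_id (x : X) (v : TangentSpace (𝓡 4) x) (a : Fin 4) :
    coframe g e (𝓡 4) id x v a = g.inner x (e a x) v := by
  rw [coframe, mfderiv_id]
  rfl

theorem sum_mul_of_frame_change (he : IsOrientedFrameOn g o e U) (he' : IsOrientedFrameOn g o e' U')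
    (hx : x ∈ U) (hx' : x ∈ U') {R : Fin 4 → Fin 4 → ℝ}
    (hR : ∀ b, e' b x = ∑ a, R a b • e a x) (a b : Fin 4) :
    ∑ k, R k a * R k b = if a = b then 1 else 0 := by
  rw [← he'.orthonormal x hx' a b, hR, hR]
  simp [he.orthonormal x hx, mul_comm]

/-- The transformation law of the Levi-Civita connection form, from the uniqueness of the
torsion-free metric connection. -/
theorem lcCoeff_change (he : IsOrientedFrameOn g o e U) (he' : IsOrientedFrameOn g o e' U')
    (hx : x ∈ U) (hx' : x ∈ U') {R : X → Fin 4 → Fin 4 → ℝ}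
    (hRs : ∀ a b, ContMDiffAt (𝓡 4) 𝓘(ℝ, ℝ) ∞ (fun y => R y a b) x)
    (hR : ∀ᶠ y in nhds x, ∀ b, e' b y = ∑ a, R y a b • e a y) (c b a : Fin 4) :
    lcCoeff g e' c b a x = ∑ k, R x k a * mvfderiv (𝓡 4) (fun y => R y k b) x (e' c x) +
      ∑ k, ∑ l, R x k a * R x l b * connForm g e (𝓡 4) id x (e' c x) k l := by
  have hd : ∀ a b, MDifferentiableAt (𝓡 4) 𝓘(ℝ, ℝ) (fun y => R y a b) x := fun a b =>
    (hRs a b).mdifferentiableAt (by simp)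
  have hU : ∀ᶠ y in nhds x, y ∈ U := he.isOpen.mem_nhds hx
  have hU' : ∀ᶠ y in nhds x, y ∈ U' := he'.isOpen.mem_nhds hx'
  have hcof : ∀ b, (fun y => coframe g e (𝓡 4) id y (e' b y)) =ᶠ[nhds x] fun y a => R y a b := by
    intro b
    filter_upwards [hR, hU] with y hy hyU
    ext a
    rw [coframe_id, hy]
    simp [he.orthonormal y hyU]
  have horth : ∀ᶠ y in nhds x, ∀ a b, ∑ k, R y k a * R y k b = if a = b then 1 else 0 := by
    filter_upwards [hR, hU, hU'] with y hy hyU hyU' a b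
    exact sum_mul_of_frame_change he he' hyU hyU' hy a b
  -- the candidate for the connection form in the frame `e'`
  obtain ⟨w, hw⟩ : ∃ w : Fin 4 → Fin 4 → Fin 4 → ℝ, w = fun c a b =>
      ∑ k, R x k a * mvfderiv (𝓡 4) (fun y => R y k b) x (e' c x) +
      ∑ k, ∑ l, R x k a * R x l b * connForm g e (𝓡 4) id x (e' c x) k l := ⟨_, rfl⟩
  have hskew : ∀ c a b, w c a b = -w c b a := by
    intro c a b
    have h1 : ∑ k, (mvfderiv (𝓡 4) (fun y => R y k a) x (e' c x) * R x k b +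
        R x k a * mvfderiv (𝓡 4) (fun y => R y k b) x (e' c x)) = 0 := by
      have h2 := mvfderiv_sum (G := fun k y => R y k a * R y k b) Finset.univ
        (fun k => (hd k a).mul (hd k b)) (e' c x)
      rw [mvfderiv_congr (G' := fun _ => if a = b then (1 : ℝ) else 0)
        (by filter_upwards [horth] with y hy using hy a b), mvfderiv_const] at h2
      refine Eq.trans (Finset.sum_congr rfl fun k _ => ?_) h2.symm
      exact (mvfderiv_clm_apply₂ (ContinuousLinearMap.mul ℝ ℝ) (hd k a) (hd k b) (e' c x)).symm
    have h3 : ∑ k, ∑ l, R x k a * R x l b * connForm g e (𝓡 4) id x (e' c x) k l =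
        -∑ k, ∑ l, R x k b * R x l a * connForm g e (𝓡 4) id x (e' c x) k l := by
      rw [Finset.sum_comm, ← Finset.sum_neg_distrib]
      refine Finset.sum_congr rfl fun k _ => ?_
      rw [← Finset.sum_neg_distrib]
      refine Finset.sum_congr rfl fun l _ => ?_
      rw [connForm_skew id x _ l k]
      ring
    rw [hw]
    simp only [h3]
    rw [Finset.sum_add_distrib] at h1
    simp only [mul_comm (mvfderiv (𝓡 4) _ x _)] at h1
    linarith
  have htors : ∀ c b a, bracketCoeff g e' c b a x = w c a b - w b a c := by
    intro c b a
    have h1 := coframe_mlieBracket (I := 𝓡 4) (f := id) he hx contMDiffAt_id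
      (he'.contMDiffAt hx' c) (he'.contMDiffAt hx' b)
    rw [nablaVec_congr (hcof b), nablaVec_congr (hcof c)] at h1
    have h2 : bracketCoeff g e' c b a x =
        ∑ k, R x k a * coframe g e (𝓡 4) id x (mlieBracket (𝓡 4) (e' c) (e' b) x) k := by
      rw [bracketCoeff, hR.self_of_nhds a]
      simp only [map_sum, map_smul, smul_eq_mul, coframe_id]
      exact Finset.sum_congr rfl fun k _ => by rw [g.symm]
    have hpi : ∀ b (v : TangentSpace (𝓡 4) x) k, mvfderiv (𝓡 4) (fun y a => R y a b) x v k =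
        mvfderiv (𝓡 4) (fun y => R y k b) x v := fun b v k =>
      (mvfderiv_clm_comp (ContinuousLinearMap.proj k : (Fin 4 → ℝ) →L[ℝ] ℝ)
        ((contMDiffAt_pi_space.2 fun a => hRs a b).mdifferentiableAt (by simp)) v).symm
    rw [h2, h1, hw]
    simp only [nablaVec, Pi.sub_apply, Pi.add_apply, hpi, mul_sub, mul_add,
      Finset.sum_sub_distrib, Finset.sum_add_distrib, Matrix.mulVec, dotProduct, Matrix.of_apply,
      Finset.mul_sum, mul_assoc, mul_comm (connForm g e (𝓡 4) id x _ _ _)]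
  -- the Koszul formula recovers a skew `w` from its torsion-free brackets
  have h := congrFun (congrFun (congrFun hw c) a) b
  rw [← h, lcCoeff, htors, htors, htors, hskew c b a, hskew b c a, hskew a c b]
  ring

end

/-! ### The change of the spin connection -/

theorem liftBeta_eq_spinAct (w : Fin 4 → Fin 4 → ℝ) : liftBeta w = -(spinAct w)ᵀ := by
  rw [spinAct, Matrix.transpose_neg, Matrix.transpose_transpose, neg_neg]

theorem liftBeta_add (v w : Fin 4 → Fin 4 → ℝ) : liftBeta (v + w) = liftBeta v + liftBeta w := by
  simp only [liftBeta_eq_spinAct, spinAct_add, Matrix.transpose_add, neg_add]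

theorem liftBeta_smul (c : ℝ) (w : Fin 4 → Fin 4 → ℝ) : liftBeta (c • w) = c • liftBeta w := by
  simp only [liftBeta_eq_spinAct, spinAct_smul, Matrix.transpose_smul, Complex.coe_smul, smul_neg]

theorem liftBeta_sum {ι : Type*} (s : Finset ι) (w : ι → Fin 4 → Fin 4 → ℝ) :
    liftBeta (∑ i ∈ s, w i) = ∑ i ∈ s, liftBeta (w i) := by
  simp only [liftBeta_eq_spinAct, spinAct_sum, Matrix.transpose_sum, Finset.sum_neg_distrib]

/-- The complex conjugate of a `2 × 2` matrix as a real linear map of `ℂ²`. -/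
def conjCLM : (Fin 2 → Fin 2 → ℂ) →L[ℝ] Spinor →L[ℝ] Spinor :=
  matCLM ∘L ContinuousLinearMap.pi fun r => ContinuousLinearMap.pi fun s =>
    (Complex.conjCLE : ℂ →L[ℝ] ℂ) ∘L (ContinuousLinearMap.proj s : (Fin 2 → ℂ) →L[ℝ] ℂ) ∘L
      (ContinuousLinearMap.proj r : (Fin 2 → Fin 2 → ℂ) →L[ℝ] (Fin 2 → ℂ))

theorem conjCLM_apply (B : Matrix (Fin 2) (Fin 2) ℂ) (η : Spinor) :
    conjCLM B η = Bᴴᵀ *ᵥ η := rfl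

theorem conjCLM_eq_matCLM (B : Matrix (Fin 2) (Fin 2) ℂ) :
    conjCLM B = matCLM (fun r s => star (B r s)) := rfl

section
variable {X : Type*} [TopologicalSpace X] [ChartedSpace (EuclideanSpace ℝ (Fin 4)) X]
  [IsManifold (𝓡 4) ∞ X] {g : Metric X} {o : ∀ x : X, Orientation ℝ (TangentSpace (𝓡 4) x) (Fin 4)}
  {e e' : Frame X} {U U' : Set X} {x : X} {A B : X → SU2}
  {E : Type*} [NormedAddCommGroup E] [NormedSpace ℝ E]
  {H : Type*} [TopologicalSpace H] {I : ModelWithCorners ℝ E H}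
  {M : Type*} [TopologicalSpace M] [ChartedSpace H M]

theorem coframe_smul (f : M → X) (q : M) (c : ℝ) (ξ : TangentSpace I q) :
    coframe g e I f q (c • ξ) = c • coframe g e I f q ξ := by
  ext a
  simp [coframe]

theorem connForm_add (f : M → X) (q : M) (ξ ζ : TangentSpace I q) :
    connForm g e I f q (ξ + ζ) = connForm g e I f q ξ + connForm g e I f q ζ := by
  simp only [connForm, coframe_add, Pi.add_apply, add_smul, Finset.sum_add_distrib]

theorem connForm_smul (f : M → X) (q : M) (c : ℝ) (ξ : TangentSpace I q) :
    connForm g e I f q (c • ξ) = c • connForm g e I f q ξ := by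
  simp only [connForm, coframe_smul, Pi.smul_apply, smul_assoc, Finset.smul_sum]

theorem nablaSpin_smul (f : M → X) (η : M → Spinor) (q : M) (c : ℝ) (ξ : TangentSpace I q) :
    nablaSpin g e I f η q (c • ξ) = c • nablaSpin g e I f η q ξ := by
  rw [nablaSpin, connForm_smul, spinAct_smul, map_smul, nablaSpin, smul_add, Matrix.smul_mulVec,
    Complex.coe_smul]

theorem su2Deriv_add (V : M → SU2) (p : M) (ξ ζ : TangentSpace I p) :
    su2Deriv I V p (ξ + ζ) = su2Deriv I V p ξ + su2Deriv I V p ζ := by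
  ext r s
  simp [su2Deriv]

theorem su2Deriv_smul (V : M → SU2) (p : M) (c : ℝ) (ξ : TangentSpace I p) :
    su2Deriv I V p (c • ξ) = c • su2Deriv I V p ξ := by
  ext r s
  simp [su2Deriv]

theorem connForm_eq_id (f : M → X) (p : M) (ξ : TangentSpace I p) :
    connForm g e I f p ξ = connForm g e (𝓡 4) id (f p) (mfderiv I (𝓡 4) f p ξ) := by
  simp only [connForm, coframe_id]
  rfl

/-- The transformation law of the connection form of `𝕊'` in the directions of the frame. -/
theorem liftBeta_lcMat_change (he : IsOrientedFrameOn g o e U) (he' : IsOrientedFrameOn g o e' U')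
    (hx : x ∈ U) (hx' : x ∈ U')
    (hA : ∀ r s, ContMDiffAt (𝓡 4) 𝓘(ℝ, ℂ) ∞ (fun q => (A q : Matrix (Fin 2) (Fin 2) ℂ) r s) x)
    (hB : ∀ r s, ContMDiffAt (𝓡 4) 𝓘(ℝ, ℂ) ∞ (fun q => (B q : Matrix (Fin 2) (Fin 2) ℂ) r s) x)
    (hR : ∀ᶠ y in nhds x, ∀ b, e' b y = ∑ a, spinRot (A y) (B y) a b • e a y) (c : Fin 4) :
    liftBeta (lcMat g e' x c) =
      (B x : Matrix (Fin 2) (Fin 2) ℂ)ᴴ * su2Deriv (𝓡 4) B x (e' c x) +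
      (B x : Matrix (Fin 2) (Fin 2) ℂ)ᴴ * liftBeta (connForm g e (𝓡 4) id x (e' c x)) *
        (B x : Matrix (Fin 2) (Fin 2) ℂ) := by
  have hAq := SU2.isQuaternion (A x)
  have hBq := SU2.isQuaternion (B x)
  have hAd := isQuaternion_su2Deriv hA (e' c x)
  have hAA := su2Deriv_conjTranspose_mul hA (e' c x)
  rw [← liftBeta_rotate hAq hBq (SU2.mul_conjTranspose_self (A x)),
    ← liftBeta_maurerCartan hAq hBq hAd (isQuaternion_su2Deriv hB (e' c x))
      (SU2.conjTranspose_mul_self (A x)) (SU2.conjTranspose_mul_self (B x)) ?_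
      (su2Deriv_conjTranspose_mul hB (e' c x)), ← liftBeta_add]
  · congr 1
    ext a b
    refine (lcCoeff_change he he' hx hx' (R := fun y => spinRot (A y) (B y))
      (contMDiffAt_spinRot hA hB) hR c b a).trans ?_
    simp only [mvfderiv_spinRot hA hB]
    rfl
  · refine (hAq.conjTranspose.mul hAd).trace_eq_zero ?_
    rw [Matrix.conjTranspose_mul, Matrix.conjTranspose_conjTranspose, hAA]

/-- The transformation law of the connection form of `𝕊'`. -/
theorem liftBeta_connForm_change (he : IsOrientedFrameOn g o e U)
    (he' : IsOrientedFrameOn g o e' U') {f : M → X} {p : M} (hx : f p ∈ U) (hx' : f p ∈ U')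
    (hf : ContMDiffAt I (𝓡 4) ∞ f p)
    (hA : ∀ r s, ContMDiffAt (𝓡 4) 𝓘(ℝ, ℂ) ∞ (fun q => (A q : Matrix (Fin 2) (Fin 2) ℂ) r s) (f p))
    (hB : ∀ r s, ContMDiffAt (𝓡 4) 𝓘(ℝ, ℂ) ∞ (fun q => (B q : Matrix (Fin 2) (Fin 2) ℂ) r s) (f p))
    (hR : ∀ᶠ y in nhds (f p), ∀ b, e' b y = ∑ a, spinRot (A y) (B y) a b • e a y)
    (ξ : TangentSpace I p) :
    liftBeta (connForm g e' I f p ξ) =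
      (B (f p) : Matrix (Fin 2) (Fin 2) ℂ)ᴴ * su2Deriv I (fun q => B (f q)) p ξ +
      (B (f p) : Matrix (Fin 2) (Fin 2) ℂ)ᴴ * liftBeta (connForm g e I f p ξ) *
        (B (f p) : Matrix (Fin 2) (Fin 2) ℂ) := by
  have hchain : su2Deriv I (fun q => B (f q)) p ξ =
      su2Deriv (𝓡 4) B (f p) (mfderiv I (𝓡 4) f p ξ) := by
    ext r s
    exact mfderiv_comp_apply p ((hB r s).mdifferentiableAt (by simp))
      (hf.mdifferentiableAt (by simp)) ξ
  -- the right-hand side is linear in the tangent vector, so it can be checked on the frame `e'`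
  let L : TangentSpace (𝓡 4) (f p) →ₗ[ℝ] Matrix (Fin 2) (Fin 2) ℂ :=
    { toFun := fun v => (B (f p) : Matrix (Fin 2) (Fin 2) ℂ)ᴴ * su2Deriv (𝓡 4) B (f p) v +
        (B (f p) : Matrix (Fin 2) (Fin 2) ℂ)ᴴ * liftBeta (connForm g e (𝓡 4) id (f p) v) *
          (B (f p) : Matrix (Fin 2) (Fin 2) ℂ)
      map_add' := fun v w => by
        rw [su2Deriv_add, connForm_add, liftBeta_add]
        simp only [Matrix.mul_add, Matrix.add_mul]
        abel
      map_smul' := fun c v => by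
        rw [su2Deriv_smul, connForm_smul, liftBeta_smul]
        simp only [Matrix.mul_smul, Matrix.smul_mul, smul_add, RingHom.id_apply] }
  rw [hchain, connForm_eq_id (e := e) f p ξ]
  change _ = L (mfderiv I (𝓡 4) f p ξ)
  rw [← sum_coframe_smul he' hx' ξ, map_sum, connForm, liftBeta_sum]
  refine Finset.sum_congr rfl fun c _ => ?_
  rw [map_smul, liftBeta_smul, liftBeta_lcMat_change he he' hx hx' hA hB hR]
  rfl

/-- The covariant derivative of a spinor does not depend on the spin frame. -/
theorem nablaSpin_change (he : IsOrientedFrameOn g o e U)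
    (he' : IsOrientedFrameOn g o e' U') {f : M → X} {p : M} (hx : f p ∈ U) (hx' : f p ∈ U')
    (hf : ContMDiffAt I (𝓡 4) ∞ f p)
    (hA : ∀ r s, ContMDiffAt (𝓡 4) 𝓘(ℝ, ℂ) ∞ (fun q => (A q : Matrix (Fin 2) (Fin 2) ℂ) r s) (f p))
    (hB : ∀ r s, ContMDiffAt (𝓡 4) 𝓘(ℝ, ℂ) ∞ (fun q => (B q : Matrix (Fin 2) (Fin 2) ℂ) r s) (f p))
    (hR : ∀ᶠ y in nhds (f p), ∀ b, e' b y = ∑ a, spinRot (A y) (B y) a b • e a y)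
    {η η' : M → Spinor} (hη' : MDifferentiableAt I 𝓘(ℝ, Spinor) η' p)
    (hη : ∀ᶠ q in nhds p, η q = conjCLM (B (f q) : Matrix (Fin 2) (Fin 2) ℂ) (η' q))
    (ξ : TangentSpace I p) :
    nablaSpin g e I f η p ξ =
      conjCLM (B (f p) : Matrix (Fin 2) (Fin 2) ℂ) (nablaSpin g e' I f η' p ξ) := by
  have hBf : ∀ r s, ContMDiffAt I 𝓘(ℝ, ℂ) ∞
      (fun q => (B (f q) : Matrix (Fin 2) (Fin 2) ℂ) r s) p := fun r s => (hB r s).comp p hf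
  have h1 := mvfderiv_clm_apply₂ conjCLM
    ((contMDiffAt_matrix hBf).mdifferentiableAt (by simp)) hη' ξ
  rw [mvfderiv_matrix_apply hBf] at h1
  have h2 : mvfderiv I η p ξ = conjCLM (su2Deriv I (fun q => B (f q)) p ξ) (η' p) +
      conjCLM (B (f p) : Matrix (Fin 2) (Fin 2) ℂ) (mvfderiv I η' p ξ) :=
    (congrArg (fun L : TangentSpace I p →L[ℝ] Spinor => L ξ) (mvfderiv_congr hη)).trans h1
  rw [nablaSpin, nablaSpin, h2, hη.self_of_nhds, map_add]
  simp only [conjCLM_apply]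
  rw [spinAct, spinAct, liftBeta_connForm_change he he' hx hx' hf hA hB hR]
  have hBB := su2Deriv_conjTranspose_mul hBf ξ
  have hB1 := SU2.mul_conjTranspose_self (B (f p))
  set b := (B (f p) : Matrix (Fin 2) (Fin 2) ℂ)
  set b' := su2Deriv I (fun q => B (f q)) p ξ
  set β := liftBeta (connForm g e I f p ξ)
  have key : b'ᴴ - bᴴ * β = -((bᴴ * b' + bᴴ * β * b) * bᴴ) := by
    calc b'ᴴ - bᴴ * β = b'ᴴ * (b * bᴴ) - bᴴ * β * (b * bᴴ) := by rw [hB1, mul_one, mul_one]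
      _ = b'ᴴ * b * bᴴ - bᴴ * β * b * bᴴ := by simp only [mul_assoc]
      _ = _ := by rw [hBB]; noncomm_ring
  have key' := congrArg (fun Y => Yᵀ *ᵥ η' p) key
  simp only [Matrix.transpose_sub, Matrix.transpose_mul, Matrix.transpose_neg, Matrix.sub_mulVec,
    Matrix.neg_mulVec, ← Matrix.mulVec_mulVec] at key'
  simp only [Matrix.neg_mulVec, Matrix.mulVec_neg]
  rw [← key']
  abel

/-- The components of tangent vectors transform by the rotation of the frames. -/
theorem coframe_change (he : IsOrientedFrameOn g o e U) (he' : IsOrientedFrameOn g o e' U')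
    {f : M → X} {p : M} (hx : f p ∈ U) (hx' : f p ∈ U') {R : Fin 4 → Fin 4 → ℝ}
    (hR : ∀ b, e' b (f p) = ∑ a, R a b • e a (f p)) (ξ : TangentSpace I p) :
    coframe g e I f p ξ = Matrix.of R *ᵥ coframe g e' I f p ξ := by
  ext a
  rw [coframe, ← sum_coframe_smul he' hx' ξ]
  simp only [hR, map_sum, map_smul, he.orthonormal _ hx, Matrix.mulVec, dotProduct, smul_eq_mul,
    Matrix.of_apply]
  simp [mul_comm]

end

/-! ### The almost complex structures on `𝕊'` in local spin frames -/

section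
variable {X : Type*} [TopologicalSpace X] [ChartedSpace (EuclideanSpace ℝ (Fin 4)) X]
  [IsManifold (𝓡 4) ∞ X] {g : Metric X} {o : ∀ x : X, Orientation ℝ (TangentSpace (𝓡 4) x) (Fin 4)}

theorem connTerm_eq (e : Frame X) (x : X) (η : Spinor) (v : TangentSpace (𝓡 4) x) :
    connTerm g e x η v = spinAct (∑ c, g.inner x (e c x) v • lcMat g e x c) *ᵥ η := by
  rw [connTerm, _root_.sum_apply, spinAct_sum, Matrix.sum_mulVec]
  refine Finset.sum_congr rfl fun c _ => ?_
  rw [ContinuousLinearMap.smulRight_apply, spinAct_smul, Matrix.smul_mulVec, Complex.coe_smul]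
  rfl

/-- The matrix of `frameEndo e x C` in the frame `e` is `C`. -/
theorem inner_frameEndo {e : Frame X} {U : Set X} (he : IsOrientedFrameOn g o e U) {x : X}
    (hx : x ∈ U) (C : Fin 4 → Fin 4 → ℝ) (v : TangentSpace (𝓡 4) x) :
    (fun a => g.inner x (e a x) (frameEndo g e x C v)) =
      Matrix.of C *ᵥ fun b => g.inner x (e b x) v := by
  ext a
  simp only [frameEndo, _root_.sum_apply, _root_.smul_apply,
    ContinuousLinearMap.smulRight_apply, map_sum, map_smul, he.orthonormal x hx, smul_eq_mul,
    Matrix.mulVec, dotProduct, Matrix.of_apply]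
  rw [Finset.sum_comm]
  simp

end

namespace SpinStructure

variable {X : Type*} [TopologicalSpace X] [ChartedSpace (EuclideanSpace ℝ (Fin 4)) X]
  [IsManifold (𝓡 4) ∞ X] {g : Metric X} {o : ∀ x : X, Orientation ℝ (TangentSpace (𝓡 4) x) (Fin 4)}
  {ι : Type*} (S : SpinStructure g o ι)

/-- The fibre coordinate on `𝕊'` in the spin frame `s i`. -/
def coord (i : ι) (p : S.SPrime) : Spinor := (S.core.localTriv i p).2

/-- The projection `𝕊' → X`. -/
abbrev toBase : S.SPrime → X := Bundle.TotalSpace.proj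

theorem coord_indexAt (p : S.SPrime) : S.coord (S.indexAt p.1) p = p.2 :=
  S.core.coordChange_self _ _ (S.mem_baseSet_at p.1) _

/-- The coordinates of a spinor with respect to two spin frames, with transition function `B̄`. -/
theorem coord_change {i j : ι} {p : S.SPrime} (hi : p.1 ∈ S.baseSet i) (hj : p.1 ∈ S.baseSet j) :
    S.coord i p = conjCLM (S.B i j p.1 : Matrix (Fin 2) (Fin 2) ℂ) (S.coord j p) :=
  (S.core.coordChange_comp (S.indexAt p.1) j i p.1 ⟨⟨S.mem_baseSet_at p.1, hj⟩, hi⟩ p.2).symm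

theorem coord_ne_zero {i : ι} {p : S.SPrime} (hi : p.1 ∈ S.baseSet i) (hp : p ∈ S.nonzero) :
    S.coord i p ≠ 0 := by
  intro h
  apply hp
  rw [← S.coord_indexAt p, S.coord_change (S.mem_baseSet_at p.1) hi, h, map_zero]
  rfl

theorem contMDiffAt_toBase (p : S.SPrime) :
    ContMDiffAt modelSPrime (𝓡 4) ∞ S.toBase p :=
  Bundle.contMDiffAt_proj S.core.Fiber

theorem contMDiffAt_coord {i : ι} {p : S.SPrime} (hi : p.1 ∈ S.baseSet i) :
    ContMDiffAt modelSPrime 𝓘(ℝ, Spinor) ∞ (S.coord i) p :=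
  have : MemTrivializationAtlas (S.core.localTriv i) := ⟨⟨i, rfl⟩⟩
  ((Bundle.Trivialization.contMDiffAt_iff (e := S.core.localTriv i) (f := id) hi).1
    contMDiffAt_id).2

theorem eventually_mem_baseSet {i : ι} {p : S.SPrime} (hi : p.1 ∈ S.baseSet i) :
    ∀ᶠ q : S.SPrime in nhds p, q.1 ∈ S.baseSet i :=
  (S.contMDiffAt_toBase p).continuousAt.eventually
    ((S.isOrientedFrameOn i).isOpen.mem_nhds hi)

theorem frame_change_spinRot {i j : ι} {x : X} (hi : x ∈ S.baseSet i) (hj : x ∈ S.baseSet j)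
    (b : Fin 4) :
    S.frame j b x = ∑ a, spinRot (S.A i j x) (S.B i j x) a b • S.frame i a x :=
  S.frame_change i j x ⟨hi, hj⟩ b

theorem split_fst_eq (p : S.SPrime) (ξ : TangentSpace modelSPrime p) (a : Fin 4) :
    coframe g (S.frameAt p.1) modelSPrime S.toBase p ξ a =
      g.inner p.1 (S.frameAt p.1 a p.1) (S.split p ξ).1 := by
  rw [S.split_fst]
  rfl

/-- The vertical component of a tangent vector is the covariant derivative of the tautological section
of the pull-back of `𝕊'`. -/
theorem split_snd_eq (p : S.SPrime) (ξ : TangentSpace modelSPrime p) :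
    nablaSpin g (S.frameAt p.1) modelSPrime S.toBase (S.coord (S.indexAt p.1)) p ξ =
      (S.split p ξ).2 := by
  have h : connTerm g (S.frameAt p.1) p.1 p.2 (S.split p ξ).1 =
      connTerm g (S.frameAt p.1) p.1 (S.coord (S.indexAt p.1) p) (S.split p ξ).1 :=
    congrArg (fun η => connTerm g (S.frameAt p.1) p.1 η (S.split p ξ).1) (S.coord_indexAt p).symm
  rw [S.split_snd, h, connTerm_eq, nablaSpin, connForm]
  simp only [S.split_fst_eq]
  rfl

/-- A tangent vector is determined by its horizontal and vertical components. -/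
theorem ext_split {p : S.SPrime} {ξ ζ : TangentSpace modelSPrime p}
    (h : coframe g (S.frameAt p.1) modelSPrime S.toBase p ξ =
      coframe g (S.frameAt p.1) modelSPrime S.toBase p ζ)
    (h' : nablaSpin g (S.frameAt p.1) modelSPrime S.toBase (S.coord (S.indexAt p.1)) p ξ =
      nablaSpin g (S.frameAt p.1) modelSPrime S.toBase (S.coord (S.indexAt p.1)) p ζ) : ξ = ζ := by
  have he := S.isOrientedFrameOn (S.indexAt p.1)
  have hp := S.mem_baseSet_at p.1
  apply (S.split p).injective
  refine Prod.ext ?_ ?_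
  · rw [← he.sum_inner_smul hp (S.split p ξ).1, ← he.sum_inner_smul hp (S.split p ζ).1]
    refine Finset.sum_congr rfl fun a _ => ?_
    have := congrFun h a
    rw [S.split_fst_eq, S.split_fst_eq] at this
    exact congrArg (· • _) this
  · rw [← S.split_snd_eq, ← S.split_snd_eq, h']

theorem coframe_bigJ_self (p : S.SPrime) (ξ : TangentSpace modelSPrime p) :
    coframe g (S.frameAt p.1) modelSPrime S.toBase p (S.bigJ p ξ) =
      jEndo (S.coord (S.indexAt p.1) p) *ᵥ coframe g (S.frameAt p.1) modelSPrime S.toBase p ξ := by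
  have h : (S.split p (S.bigJ p ξ)).1 =
      S.baseJ p.1 (S.coord (S.indexAt p.1) p) (S.split p ξ).1 :=
    (congrArg Prod.fst ((S.split p).apply_symm_apply _)).trans
      (congrArg (fun η => S.baseJ p.1 η (S.split p ξ).1) (S.coord_indexAt p).symm)
  have h1 : coframe g (S.frameAt p.1) modelSPrime S.toBase p ξ =
    fun a => g.inner p.1 (S.frameAt p.1 a p.1) (S.split p ξ).1 := funext (S.split_fst_eq p ξ)
  rw [h1, ← rightMulMat_jMat]
  refine Eq.trans ?_ (inner_frameEndo (S.isOrientedFrameOn (S.indexAt p.1))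
    (S.mem_baseSet_at p.1) (rightMulMat (jMat (S.coord (S.indexAt p.1) p))) _)
  ext a
  rw [S.split_fst_eq, h]
  rfl

theorem coframe_bigI_self (p : S.SPrime) (ξ : TangentSpace modelSPrime p) :
    coframe g (S.frameAt p.1) modelSPrime S.toBase p (S.bigI p ξ) =
      Matrix.of (rightMulMat (iMat (S.coord (S.indexAt p.1) p))) *ᵥ
        coframe g (S.frameAt p.1) modelSPrime S.toBase p ξ := by
  have h : (S.split p (S.bigI p ξ)).1 =
      S.baseI p.1 (S.coord (S.indexAt p.1) p) (S.split p ξ).1 :=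
    (congrArg Prod.fst ((S.split p).apply_symm_apply _)).trans
      (congrArg (fun η => S.baseI p.1 η (S.split p ξ).1) (S.coord_indexAt p).symm)
  have h1 : coframe g (S.frameAt p.1) modelSPrime S.toBase p ξ =
    fun a => g.inner p.1 (S.frameAt p.1 a p.1) (S.split p ξ).1 := funext (S.split_fst_eq p ξ)
  rw [h1]
  refine Eq.trans ?_ (inner_frameEndo (S.isOrientedFrameOn (S.indexAt p.1))
    (S.mem_baseSet_at p.1) (rightMulMat (iMat (S.coord (S.indexAt p.1) p))) _)
  ext a
  rw [S.split_fst_eq, h]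
  rfl

theorem nablaSpin_bigJ_self (p : S.SPrime) (ξ : TangentSpace modelSPrime p) :
    nablaSpin g (S.frameAt p.1) modelSPrime S.toBase (S.coord (S.indexAt p.1)) p (S.bigJ p ξ) =
      sigma (nablaSpin g (S.frameAt p.1) modelSPrime S.toBase (S.coord (S.indexAt p.1)) p ξ) := by
  rw [S.split_snd_eq, S.split_snd_eq]
  exact congrArg Prod.snd ((S.split p).apply_symm_apply _)

theorem nablaSpin_bigI_self (p : S.SPrime) (ξ : TangentSpace modelSPrime p) :
    nablaSpin g (S.frameAt p.1) modelSPrime S.toBase (S.coord (S.indexAt p.1)) p (S.bigI p ξ) =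
      Complex.I •
        nablaSpin g (S.frameAt p.1) modelSPrime S.toBase (S.coord (S.indexAt p.1)) p ξ := by
  rw [S.split_snd_eq, S.split_snd_eq]
  exact congrArg Prod.snd ((S.split p).apply_symm_apply _)

/-- The horizontal part of `𝕁` in an arbitrary local spin frame. -/
theorem coframe_bigJ {i : ι} {p : S.SPrime} (hi : p.1 ∈ S.baseSet i)
    (ξ : TangentSpace modelSPrime p) :
    coframe g (S.frame i) modelSPrime S.toBase p (S.bigJ p ξ) =
      jEndo (S.coord i p) *ᵥ coframe g (S.frame i) modelSPrime S.toBase p ξ := by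
  have hj := S.mem_baseSet_at p.1
  have hc := fun ζ : TangentSpace modelSPrime p => coframe_change (f := S.toBase)
    (S.isOrientedFrameOn i) (S.isOrientedFrameOn (S.indexAt p.1)) hi hj
    (S.frame_change_spinRot hi hj) ζ
  have hB := SU2.isQuaternion (S.B i (S.indexAt p.1) p.1)
  have hB1 := SU2.conjTranspose_mul_self (S.B i (S.indexAt p.1) p.1)
  have hrot := spinRot_mul_rightMulMat (SU2.isQuaternion (S.A i (S.indexAt p.1) p.1)) hB
    (T := jMat (S.coord (S.indexAt p.1) p)) (by rw [jMat_eq_quat]; exact IsQuaternion.quat _) hB1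
  rw [← jMat_matCLM_star hB hB1, ← conjCLM_eq_matCLM,
    ← S.coord_change hi hj, rightMulMat_jMat, rightMulMat_jMat] at hrot
  rw [hc, hc, Matrix.mulVec_mulVec]
  refine (congrArg (_ *ᵥ ·) (S.coframe_bigJ_self p ξ)).trans ?_
  rw [Matrix.mulVec_mulVec]
  exact congrArg (· *ᵥ _) hrot

/-- The vertical part of `𝕁` in an arbitrary local spin frame. -/
theorem nablaSpin_bigJ {i : ι} {p : S.SPrime} (hi : p.1 ∈ S.baseSet i)
    (ξ : TangentSpace modelSPrime p) :
    nablaSpin g (S.frame i) modelSPrime S.toBase (S.coord i) p (S.bigJ p ξ) =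
      sigma (nablaSpin g (S.frame i) modelSPrime S.toBase (S.coord i) p ξ) := by
  have hj := S.mem_baseSet_at p.1
  have hij : S.baseSet i ∩ S.baseSet (S.indexAt p.1) ∈ nhds p.1 :=
    ((S.isOrientedFrameOn i).isOpen.inter (S.isOrientedFrameOn _).isOpen).mem_nhds ⟨hi, hj⟩
  have hc := fun ζ : TangentSpace modelSPrime p => nablaSpin_change
    (S.isOrientedFrameOn i) (S.isOrientedFrameOn (S.indexAt p.1)) hi hj (S.contMDiffAt_toBase p)
    (fun r s => (S.contMDiffOn_A i (S.indexAt p.1) r s).contMDiffAt hij)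
    (fun r s => (S.contMDiffOn_B i (S.indexAt p.1) r s).contMDiffAt hij)
    (by filter_upwards [hij] with y hy using S.frame_change_spinRot hy.1 hy.2)
    (η := S.coord i) ((S.contMDiffAt_coord hj).mdifferentiableAt (by simp))
    (by filter_upwards [S.eventually_mem_baseSet hi, S.eventually_mem_baseSet hj] with q h1 h2
          using S.coord_change h1 h2) ζ
  rw [hc, hc, conjCLM_eq_matCLM, sigma_matCLM_star (SU2.isQuaternion _)]
  exact congrArg _ (S.nablaSpin_bigJ_self p ξ)

end SpinStructure

/-! ### Smoothness and integrability of `𝕁` -/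

namespace SpinStructure

variable {X : Type*} [TopologicalSpace X] [ChartedSpace (EuclideanSpace ℝ (Fin 4)) X]
  [IsManifold (𝓡 4) ∞ X] {g : Metric X} {o : ∀ x : X, Orientation ℝ (TangentSpace (𝓡 4) x) (Fin 4)}
  {ι : Type*} (S : SpinStructure g o ι)

/-- The charts of the manifold `𝕊'` are given by a chart of `X` and the spin frame at the centre. -/
theorem extChartAt_eq (p : S.SPrime) :
    (extChartAt modelSPrime p : S.SPrime → EuclideanSpace ℝ (Fin 4) × Spinor) =ᶠ[nhds p]
      fun q => (extChartAt (𝓡 4) p.1 q.1, S.coord (S.indexAt p.1) q) := by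
  filter_upwards [S.eventually_mem_baseSet (S.mem_baseSet_at p.1)] with q hq
  rw [FiberBundle.extChartAt]
  rfl

/-- `𝕁` maps smooth vector fields to smooth vector fields: in a chart the components of `𝕁 V` are
smooth functions of those of `V`, of the fibre coordinate and of the connection form. -/
theorem contMDiffAt_bigJ_apply {p : S.SPrime} (hp : p ∈ S.nonzero)
    {V : ∀ q : S.SPrime, TangentSpace modelSPrime q}
    (hV : ContMDiffAt modelSPrime modelSPrime.tangent ∞
      (fun q => (⟨q, V q⟩ : TangentBundle modelSPrime S.SPrime)) p) :
    ContMDiffAt modelSPrime modelSPrime.tangent ∞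
      (fun q => (⟨q, S.bigJ q (V q)⟩ : TangentBundle modelSPrime S.SPrime)) p := by
  obtain ⟨i, hi⟩ : ∃ i, i = S.indexAt p.1 := ⟨_, rfl⟩
  have hpi : p.1 ∈ S.baseSet i := hi ▸ S.mem_baseSet_at p.1
  have he := S.isOrientedFrameOn i
  have hπ := S.contMDiffAt_toBase p
  have hη := S.contMDiffAt_coord hpi
  have h0 := S.coord_ne_zero hpi hp
  have hψ : ContMDiffAt (𝓡 4) 𝓘(ℝ, EuclideanSpace ℝ (Fin 4)) ∞
      (fun x => extChartAt (𝓡 4) p.1 x) p.1 := contMDiffAt_extChartAt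
  -- the components of `JV`
  have hJV : ContMDiffAt modelSPrime 𝓘(ℝ, Fin 4 → ℝ) ∞
      (fun q => jEndo (S.coord i q) *ᵥ coframe g (S.frame i) modelSPrime S.toBase q (V q)) p := by
    have h1 : ContMDiffAt modelSPrime 𝓘(ℝ, Fin 3 → ℝ) ∞ (fun q => jVec (S.coord i q)) p :=
      contMDiffAt_pi_space.2 fun k => (contDiffAt_jVec h0 k).contMDiffAt.comp p hη
    exact (quatEndoCLM.contMDiff.contMDiffAt.comp p h1).clm_apply
      (contMDiffAt_coframe_vec he hpi hπ hV)
  have hJVa := contMDiffAt_pi_space.1 hJV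
  -- the horizontal part in the chart
  have hfst : ContMDiffAt modelSPrime 𝓘(ℝ, EuclideanSpace ℝ (Fin 4)) ∞
      (fun q => ∑ a, (jEndo (S.coord i q) *ᵥ
        coframe g (S.frame i) modelSPrime S.toBase q (V q)) a •
        mvfderiv (𝓡 4) (fun x => extChartAt (𝓡 4) p.1 x) q.1 (S.frame i a q.1)) p :=
    ContMDiffAt.sum fun a _ => (hJVa a).smul
      ((contMDiffAt_mvfderiv_apply hψ (he.contMDiffAt hpi a)).comp p hπ)
  -- the vertical part in the chart
  have hsnd : ContMDiffAt modelSPrime 𝓘(ℝ, Spinor) ∞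
      (fun q => sigma (nablaSpin g (S.frame i) modelSPrime S.toBase (S.coord i) q (V q)) -
        spinActCLM (∑ c, (jEndo (S.coord i q) *ᵥ
          coframe g (S.frame i) modelSPrime S.toBase q (V q)) c • lcMat g (S.frame i) q.1 c)
          (S.coord i q)) p := by
    refine (sigma.contMDiff.contMDiffAt.comp p (contMDiffAt_nablaSpin he hpi hπ hη hV)).sub ?_
    refine (spinActCLM.contMDiff.contMDiffAt.comp p ?_).clm_apply hη
    exact ContMDiffAt.sum fun c _ => (hJVa c).smul ((he.contMDiffAt_lcMat hpi c).comp p hπ)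
  refine contMDiffAt_of_extChartAt ((hfst.prodMk_space hsnd).congr_of_eventuallyEq ?_)
  have hψd : ∀ᶠ x in nhds p.1, ContMDiffAt (𝓡 4) 𝓘(ℝ, EuclideanSpace ℝ (Fin 4)) 1
      (fun x => extChartAt (𝓡 4) p.1 x) x :=
    (contMDiffAt_iff_contMDiffAt_nhds (by simp)).1 (hψ.of_le (by simp))
  filter_upwards [(S.extChartAt_eq p).eventually_nhds, S.eventually_mem_baseSet hpi,
    hπ.continuousAt.eventually hψd] with q hq hqi hqψ
  rw [mvfderiv_congr hq, ← hi]
  have hπq := (S.contMDiffAt_toBase q).mdifferentiableAt (by simp)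
  have hηq := (S.contMDiffAt_coord hqi).mdifferentiableAt (by simp)
  have hψπ : MDifferentiableAt modelSPrime 𝓘(ℝ, EuclideanSpace ℝ (Fin 4))
      (fun q : S.SPrime => extChartAt (𝓡 4) p.1 q.1) q :=
    (hqψ.mdifferentiableAt (by simp)).comp q hπq
  have hpair := hψπ.prodMk_space hηq
  refine Prod.ext ?_ ?_
  · refine (mvfderiv_clm_comp (ContinuousLinearMap.fst ℝ (EuclideanSpace ℝ (Fin 4)) Spinor)
      hpair (S.bigJ q (V q))).symm.trans ?_
    have h1 := mfderiv_comp_apply q (hqψ.mdifferentiableAt (by simp)) hπq (S.bigJ q (V q))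
    refine h1.trans ?_
    rw [← sum_coframe_smul he hqi (S.bigJ q (V q)), S.coframe_bigJ hqi]
    simp only [map_sum, map_smul]
    rfl
  · refine (mvfderiv_clm_comp (ContinuousLinearMap.snd ℝ (EuclideanSpace ℝ (Fin 4)) Spinor)
      hpair (S.bigJ q (V q))).symm.trans ?_
    change mvfderiv modelSPrime (S.coord i) q (S.bigJ q (V q)) = _
    rw [← S.nablaSpin_bigJ hqi, ← S.coframe_bigJ hqi]
    exact (add_sub_cancel_right _ _).symm

theorem bigJ_bigJ {p : S.SPrime} (hp : p ∈ S.nonzero) (ξ : TangentSpace modelSPrime p) :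
    S.bigJ p (S.bigJ p ξ) = -ξ := by
  have h0 := S.coord_ne_zero (S.mem_baseSet_at p.1) hp
  rw [← neg_one_smul ℝ ξ]
  refine S.ext_split ?_ ?_
  · rw [S.coframe_bigJ_self, S.coframe_bigJ_self, Matrix.mulVec_mulVec, jEndo_mul_jEndo h0,
      coframe_smul, Matrix.neg_mulVec, Matrix.one_mulVec, neg_one_smul]
  · rw [S.nablaSpin_bigJ_self, S.nablaSpin_bigJ_self, sigma_sigma, nablaSpin_smul, neg_one_smul]

theorem sigma_I_smul (η : Spinor) : sigma (Complex.I • η) = -(Complex.I • sigma η) := by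
  ext i
  fin_cases i <;> simp [sigma_apply]

theorem bigI_bigJ (p : S.SPrime) (ξ : TangentSpace modelSPrime p) :
    S.bigI p (S.bigJ p ξ) = -S.bigJ p (S.bigI p ξ) := by
  rw [← neg_one_smul ℝ (S.bigJ p (S.bigI p ξ))]
  refine S.ext_split ?_ ?_
  · rw [coframe_smul, S.coframe_bigI_self, S.coframe_bigJ_self, S.coframe_bigJ_self,
      S.coframe_bigI_self, Matrix.mulVec_mulVec, Matrix.mulVec_mulVec, rightMulMat_iMat_mul_jMat,
      Matrix.neg_mulVec, neg_one_smul]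
  · rw [nablaSpin_smul, S.nablaSpin_bigI_self, S.nablaSpin_bigJ_self, S.nablaSpin_bigJ_self,
      S.nablaSpin_bigI_self, sigma_I_smul, neg_one_smul, neg_neg]

theorem isAlmostComplexOn_bigJ : IsAlmostComplexOn modelSPrime S.bigJ S.nonzero where
  contMDiffOn _ hp :=
    (contMDiffAt_endomorphism fun _ hZ => S.contMDiffAt_bigJ_apply hp hZ).contMDiffWithinAt
  sq_eq_neg _ hp ξ := S.bigJ_bigJ hp ξ

theorem isIntegrableOn_bigJ (hASD : IsAntiSelfDual g o) (hE : IsEinstein g o) :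
    IsIntegrableOn modelSPrime S.bigJ S.nonzero := by
  intro O V W hO hOU hV hW p hp
  have hpn := hOU hp
  have hV := (hV p hp).contMDiffAt (hO.mem_nhds hp)
  have hW := (hW p hp).contMDiffAt (hO.mem_nhds hp)
  have hJV := S.contMDiffAt_bigJ_apply hpn hV
  have hJW := S.contMDiffAt_bigJ_apply hpn hW
  have hi := S.mem_baseSet_at p.1
  have he := S.isOrientedFrameOn (S.indexAt p.1)
  have hη := S.contMDiffAt_coord hi
  have h0 := S.coord_ne_zero hi hpn
  -- zero is written as a multiple of a tangent vector to use the homogeneity of the components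
  rw [← zero_smul ℝ (nijenhuis modelSPrime S.bigJ V W p)]
  refine S.ext_split ?_ ?_
  · rw [coframe_smul, zero_smul]
    refine coframe_nijenhuis he hi (S.contMDiffAt_toBase p) hη h0 ?_
      (S.nablaSpin_bigJ hi) hV hW hJV hJW
    filter_upwards [S.eventually_mem_baseSet hi] with q hq ξ using S.coframe_bigJ hq ξ
  · rw [nablaSpin_smul, zero_smul]
    refine nablaSpin_nijenhuis he hi (S.contMDiffAt_toBase p) hη h0 (hASD _ _ he p.1 hi)
      (hE _ _ he p.1 hi) (S.coframe_bigJ hi) ?_ hV hW hJV hJW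
    filter_upwards [S.eventually_mem_baseSet hi] with q hq ξ using S.nablaSpin_bigJ hq ξ

end SpinStructure

end SpinorTwistor

end

theorem theorem3p2 {X : Type*} [TopologicalSpace X] [ChartedSpace (EuclideanSpace ℝ (Fin 4)) X]
    [IsManifold (𝓡 4) ∞ X] (g : Metric X)
    (o : ∀ x : X, Orientation ℝ (TangentSpace (𝓡 4) x) (Fin 4))
    (hASD : IsAntiSelfDual g o) (hE : IsEinstein g o) (hΛ : LambdaNeZero g o)
    {ι : Type*} (S : SpinStructure g o ι) :
    IsAlmostComplexOn SpinStructure.modelSPrime S.bigJ S.nonzero ∧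
    IsIntegrableOn SpinStructure.modelSPrime S.bigJ S.nonzero ∧
    ∀ p ∈ S.nonzero, ∀ ξ : TangentSpace SpinStructure.modelSPrime p,
      S.bigI p (S.bigJ p ξ) = -S.bigJ p (S.bigI p ξ) :=
  ⟨S.isAlmostComplexOn_bigJ, S.isIntegrableOn_bigJ hASD hE, fun p _ ξ => S.bigI_bigJ p ξ⟩
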